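/- Let $N\ge 3$ and let $\mathbb{B}^N$ be the Poincaré ball model of hyperbolic space: the unit ball $\{|x|<1\}\subset\mathbb{R}^N$ with the metric $\rho^2\delta_{ij}$, $\rho(x)=\frac{2}{1-|x|^2}$. Write $dV=\rho^N dx$, $\nabla_{\mathbb{B}^N}=\rho^{-1}\nabla$, $d(x)=\log\frac{1+|x|}{1-|x|}$ (the hyperbolic distance from $x$ to the origin), and $$\Delta^\alpha_{\mathbb{B}^N}u=\rho^{-N}\sum_{i=1}^N\partial_i\big(\rho^{N-2}d^\alpha\,\partial_i u\big).$$ Let $H^1_0(\mathbb{B}^N;d^\alpha dV)$ be the completion of $C_c^\infty(\mathbb{B}^N)$, realized as a space of functions, for the norm $\big(\int_{\mathbb{B}^N} d^\alpha|\nabla_{\mathbb{B}^N}u|^2\,dV\big)^{1/2}$. Let $\alpha,\beta,\lambda,q\in\mathbb{R}$ satisfy $$\beta>\alpha-2>-N,\qquad \lambda<\Big(\frac{N-2+\alpha}{2}\Big)^2,\qquad 2<q<2^\beta_\alpha:=\frac{2(N+\beta)}{N-2+\alpha}.$$ Then the equation $$-\Delta^\alpha_{\mathbb{B}^N}u=\lambda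 d^{\alpha-2}u+d^\beta|u|^{q-2}u$$ has a positive radial weak solution in $H^1_0(\mathbb{B}^N;d^\alpha dV)$. That is, there is a radial function $u\in H^1_0(\mathbb{B}^N;d^\alpha dV)$, continuous and strictly positive on $\mathbb{B}^N\setminus\{0\}$, such that for every $v\in H^1_0(\mathbb{B}^N;d^\alpha dV)$ the following integrals converge absolutely and $$\int_{\mathbb{B}^N} d^\alpha\,\nabla_{\mathbb{B}^N}u\cdot\nabla_{\mathbb{B}^N}v\,dV=\lambda\int_{\mathbb{B}^N} d^{\alpha-2}uv\,dV+\int_{\mathbb{B}^N} d^\beta|u|^{q-2}uv\,dV .$$ -/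

import Mathlib

open MeasureTheory Filter Topology
open scoped ContDiff

noncomputable section

namespace PoincareBall

/-- The open unit ball of `ℝ^N`, the underlying set of the Poincaré ball model `𝔹^N`. -/
def ball (N : ℕ) : Set (EuclideanSpace ℝ (Fin N)) := Metric.ball 0 1

/-- The conformal factor `ρ(x) = 2 / (1 - |x|²)`; the metric is `ρ² δ_ij`. -/
def rho {N : ℕ} (x : EuclideanSpace ℝ (Fin N)) : ℝ := 2 / (1 - ‖x‖ ^ 2)

/-- The hyperbolic distance to the origin, `d(x) = log ((1 + |x|) / (1 - |x|))`. -/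
def dist0 {N : ℕ} (x : EuclideanSpace ℝ (Fin N)) : ℝ := Real.log ((1 + ‖x‖) / (1 - ‖x‖))

/-- The hyperbolic volume `dV = ρ^N dx` on the unit ball, as a measure on `ℝ^N` that does not
charge the complement of the ball. -/
def vol (N : ℕ) : Measure (EuclideanSpace ℝ (Fin N)) :=
  (volume.restrict (ball N)).withDensity (fun x => ENNReal.ofReal (rho x ^ N))

/-- The hyperbolic gradient `∇_𝔹 φ = ρ⁻¹ ∇φ`. -/
def hgrad {N : ℕ} (φ : EuclideanSpace ℝ (Fin N) → ℝ) (x : EuclideanSpace ℝ (Fin N)) :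
    EuclideanSpace ℝ (Fin N) :=
  (rho x)⁻¹ • gradient φ x

/-- `φ ∈ C_c^∞(𝔹^N)`. The support may contain the origin. -/
structure IsTestFunction {N : ℕ} (φ : EuclideanSpace ℝ (Fin N) → ℝ) : Prop where
  smooth : ContDiff ℝ ∞ φ
  compact : HasCompactSupport φ
  support_subset : tsupport φ ⊆ ball N

/-- `MemH10 α u G`: the function `u` belongs to `H^1_0(𝔹^N; d^α dV)`, the completion of
`C_c^∞(𝔹^N)` for the norm `(∫ d^α |∇_𝔹 φ|² dV)^{1/2}`, and `G` is its hyperbolic gradient.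
The completion is realized by functions: `u` is the almost everywhere limit of a sequence of test
functions whose hyperbolic gradients converge to `G` in `L²(d^α dV)`. -/
structure MemH10 {N : ℕ} (α : ℝ) (u : EuclideanSpace ℝ (Fin N) → ℝ)
    (G : EuclideanSpace ℝ (Fin N) → EuclideanSpace ℝ (Fin N)) : Prop where
  aestronglyMeasurable_grad : AEStronglyMeasurable G (vol N)
  approx : ∃ φ : ℕ → EuclideanSpace ℝ (Fin N) → ℝ,
    (∀ n, IsTestFunction (φ n)) ∧
    Tendsto (fun n => ∫⁻ x, ENNReal.ofReal (dist0 x ^ α * ‖hgrad (φ n) x - G x‖ ^ 2) ∂(vol N))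
      atTop (𝓝 0) ∧
    ∀ᵐ x ∂(vol N), Tendsto (fun n => φ n x) atTop (𝓝 (u x))

/-- `u ∈ H^1_0(𝔹^N; d^α dV)` is a weak solution of
`-Δ_𝔹^α u = lam d^{α-2} u + d^β |u|^{q-2} u`, tested against all of `H^1_0(𝔹^N; d^α dV)`;
all the integrals converge absolutely. -/
def IsWeakSolution {N : ℕ} (α β lam q : ℝ) (u : EuclideanSpace ℝ (Fin N) → ℝ) : Prop :=
  ∃ G : EuclideanSpace ℝ (Fin N) → EuclideanSpace ℝ (Fin N), MemH10 α u G ∧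
    ∀ (v : EuclideanSpace ℝ (Fin N) → ℝ)
      (H : EuclideanSpace ℝ (Fin N) → EuclideanSpace ℝ (Fin N)), MemH10 α v H →
      Integrable (fun x => dist0 x ^ α * inner ℝ (G x) (H x)) (vol N) ∧
      Integrable (fun x => dist0 x ^ (α - 2) * (u x * v x)) (vol N) ∧
      Integrable (fun x => dist0 x ^ β * (|u x| ^ (q - 2) * u x * v x)) (vol N) ∧
      ∫ x, dist0 x ^ α * inner ℝ (G x) (H x) ∂(vol N) =
        lam * ∫ x, dist0 x ^ (α - 2) * (u x * v x) ∂(vol N) +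
          ∫ x, dist0 x ^ β * (|u x| ^ (q - 2) * u x * v x) ∂(vol N)

/-- `u` is radial on the ball. -/
def IsRadial {N : ℕ} (u : EuclideanSpace ℝ (Fin N) → ℝ) : Prop :=
  ∀ x ∈ ball N, ∀ y ∈ ball N, ‖x‖ = ‖y‖ → u x = u y

end PoincareBall

end

/-- Bounded sequences in a separable Hilbert space have weakly convergent subsequences. -/
theorem exists_weak_subseq_limit {H : Type*} [NormedAddCommGroup H] [InnerProductSpace ℝ H]
    [CompleteSpace H] [TopologicalSpace.SeparableSpace H] (x : ℕ → H) (R : ℝ)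
    (hx : ∀ n, ‖x n‖ ≤ R) :
    ∃ (f : H) (φ : ℕ → ℕ), StrictMono φ ∧
      ∀ g : H, Tendsto (fun n => inner ℝ (x (φ n)) g) atTop (𝓝 (inner ℝ f g)) := by
  have hc := WeakDual.isSeqCompact_closedBall ℝ H (0 : StrongDual ℝ H) R
  obtain ⟨ℓ, -, φ, hφ, hlim⟩ := hc
    (x := fun n => StrongDual.toWeakDual (InnerProductSpace.toDual ℝ H (x n)))
    (fun n => by simpa using hx n)
  refine ⟨(InnerProductSpace.toDual ℝ H).symm (WeakDual.toStrongDual ℓ), φ, hφ, fun g => ?_⟩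
  have h := ((WeakBilin.eval_continuous (topDualPairing ℝ H) g).tendsto ℓ).comp hlim
  rw [InnerProductSpace.toDual_symm_apply]
  exact h

section Variational

variable {H : Type*} [NormedAddCommGroup H] [InnerProductSpace ℝ H]
variable {X : Type*} [MeasurableSpace X] {m : Measure X} {k : X → H} {κ : X → ℝ} {q : ℝ}

theorem abs_kernel_le (hκ : ∀ᵐ x ∂m, ‖k x‖ ≤ κ x) :
    ∀ᵐ x ∂m, ∀ f : H, |inner ℝ (k x) f| ≤ κ x * ‖f‖ := by
  filter_upwards [hκ] with x hx f
  exact (abs_real_inner_le_norm _ _).trans (by gcongr)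

theorem rpow_abs_kernel_le (hq : 2 < q) (hκ : ∀ᵐ x ∂m, ‖k x‖ ≤ κ x) {R : ℝ} :
    ∀ᵐ x ∂m, ∀ f : H, ‖f‖ ≤ R → ‖|inner ℝ (k x) f| ^ q‖ ≤ κ x ^ q * R ^ q := by
  filter_upwards [hκ, abs_kernel_le hκ] with x hx0 hx f hf
  have h0 : 0 ≤ κ x := (norm_nonneg _).trans hx0
  have hR : 0 ≤ R := (norm_nonneg _).trans hf
  rw [Real.norm_of_nonneg (by positivity), ← Real.mul_rpow h0 hR]
  gcongr
  exact (hx f).trans (by gcongr)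

theorem integrable_rpow_abs_kernel (hq : 2 < q)
    (hmeas : ∀ f : H, AEStronglyMeasurable (fun x => inner ℝ (k x) f) m)
    (hκ : ∀ᵐ x ∂m, ‖k x‖ ≤ κ x) (hκq : Integrable (fun x => κ x ^ q) m) (f : H) :
    Integrable (fun x => |inner ℝ (k x) f| ^ q) m := by
  refine (hκq.mul_const (‖f‖ ^ q)).mono' ?_ ?_
  · exact ((hmeas f).aemeasurable.abs.pow_const q).aestronglyMeasurable
  · filter_upwards [rpow_abs_kernel_le (H := H) hq hκ] with x hx using hx f le_rfl

/-- Differentiability of `f ↦ ∫ |⟪k x, f⟫| ^ q` along lines. -/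
theorem hasDerivAt_integral_rpow_abs_kernel (hq : 2 < q)
    (hmeas : ∀ f : H, AEStronglyMeasurable (fun x => inner ℝ (k x) f) m)
    (hκ : ∀ᵐ x ∂m, ‖k x‖ ≤ κ x) (hκq : Integrable (fun x => κ x ^ q) m) (f g : H) :
    HasDerivAt (fun t : ℝ => ∫ x, |inner ℝ (k x) (f + t • g)| ^ q ∂m)
      (∫ x, q * (|inner ℝ (k x) f| ^ (q - 2) * inner ℝ (k x) f * inner ℝ (k x) g) ∂m) 0 := by
  have key := hasDerivAt_integral_of_dominated_loc_of_deriv_le (μ := m) (x₀ := (0 : ℝ))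
    (s := Set.Ioo (-1) 1) (F := fun t x => |inner ℝ (k x) (f + t • g)| ^ q)
    (F' := fun t x => q * |inner ℝ (k x) (f + t • g)| ^ (q - 2) * inner ℝ (k x) (f + t • g) *
      inner ℝ (k x) g)
    (bound := fun x => κ x ^ q * (q * (‖f‖ + ‖g‖) ^ (q - 1) * ‖g‖))
    (Ioo_mem_nhds (by norm_num) (by norm_num)) ?_ ?_ ?_ ?_ ?_ ?_
  · refine key.2.congr_deriv (integral_congr_ae (Eventually.of_forall fun x => ?_))
    simp only [zero_smul, add_zero]
    ring
  · exact Eventually.of_forall fun t =>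
      ((hmeas _).aemeasurable.abs.pow_const q).aestronglyMeasurable
  · exact integrable_rpow_abs_kernel hq hmeas hκ hκq _
  · exact ((((hmeas _).aemeasurable.abs.pow_const _).const_mul q).mul
      (hmeas _).aemeasurable |>.mul (hmeas _).aemeasurable).aestronglyMeasurable
  · filter_upwards [hκ, abs_kernel_le hκ] with x hx0 hx t ht
    have h0 : 0 ≤ κ x := (norm_nonneg _).trans hx0
    set a := inner ℝ (k x) (f + t • g)
    have ha : |a| ≤ κ x * (‖f‖ + ‖g‖) := by
      refine (hx _).trans ?_
      gcongr
      refine (norm_add_le _ _).trans ?_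
      rw [norm_smul, Real.norm_eq_abs]
      have : |t| ≤ 1 := abs_le.2 ⟨ht.1.le, ht.2.le⟩
      nlinarith [norm_nonneg g]
    have e : |a| ^ (q - 2) * |a| = |a| ^ (q - 1) := by
      rcases (abs_nonneg a).eq_or_lt with h | h
      · rw [← h, Real.zero_rpow (by linarith), Real.zero_rpow (by linarith), zero_mul]
      · rw [← Real.rpow_add_one h.ne']; ring_nf
    have e2 : κ x ^ (q - 1) * κ x = κ x ^ q := by
      rcases h0.eq_or_lt with h | h
      · rw [← h, Real.zero_rpow (by linarith), Real.zero_rpow (by linarith), zero_mul]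
      · rw [← Real.rpow_add_one h.ne']; ring_nf
    rw [norm_mul, norm_mul, norm_mul, Real.norm_eq_abs, Real.norm_eq_abs, Real.norm_eq_abs,
      Real.norm_eq_abs, abs_of_pos (by linarith : 0 < q), abs_of_nonneg (by positivity), mul_assoc q,
      e]
    calc q * |a| ^ (q - 1) * |inner ℝ (k x) g|
        ≤ q * (κ x * (‖f‖ + ‖g‖)) ^ (q - 1) * (κ x * ‖g‖) := by
          gcongr
          · linarith
          · exact hx g
      _ = (κ x ^ (q - 1) * κ x) * (q * (‖f‖ + ‖g‖) ^ (q - 1) * ‖g‖) := by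
          rw [Real.mul_rpow h0 (by positivity)]; ring
      _ = _ := by rw [e2]
  · exact hκq.mul_const _
  · refine Eventually.of_forall fun x t _ => ?_
    have h1 : HasDerivAt (fun t : ℝ => inner ℝ (k x) (f + t • g)) (inner ℝ (k x) g) t := by
      have : (fun t : ℝ => inner ℝ (k x) (f + t • g)) =
          fun t : ℝ => inner ℝ (k x) f + t * inner ℝ (k x) g := by
        ext t; rw [inner_add_right, inner_smul_right]
      rw [this]
      simpa using ((hasDerivAt_id t).mul_const (inner ℝ (k x) g)).const_add (inner ℝ (k x) f)
    exact (hasDerivAt_abs_rpow _ (by linarith)).comp t h1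

variable [CompleteSpace H] [TopologicalSpace.SeparableSpace H]

/-- The functional `f ↦ ∫ |⟪k x, f⟫| ^ q` attains its supremum over the unit ball of a coercive
quadratic form, and its value there controls it everywhere by homogeneity. -/
theorem exists_extremal_kernel (hq : 2 < q)
    (hmeas : ∀ f : H, AEStronglyMeasurable (fun x => inner ℝ (k x) f) m)
    (hκ : ∀ᵐ x ∂m, ‖k x‖ ≤ κ x) (hκq : Integrable (fun x => κ x ^ q) m)
    (B : H →L[ℝ] H →L[ℝ] ℝ) (hBs : ∀ f g, B f g = B g f)
    {c : ℝ} (hc : 0 < c) (hBc : ∀ f, c * ‖f‖ ^ 2 ≤ B f f)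
    (hne : ∃ f : H, 0 < ∫ x, |inner ℝ (k x) f| ^ q ∂m) :
    ∃ f : H, B f f ≤ 1 ∧ 0 < ∫ x, |inner ℝ (k x) f| ^ q ∂m ∧
      ∀ g : H, ∫ x, |inner ℝ (k x) g| ^ q ∂m ≤
        (∫ x, |inner ℝ (k x) f| ^ q ∂m) * B g g ^ (q / 2) := by
  set J : H → ℝ := fun f => ∫ x, |inner ℝ (k x) f| ^ q ∂m with hJ
  have hB0 : ∀ f, 0 ≤ B f f := fun f => le_trans (by positivity) (hBc f)
  have hBpos : ∀ f, f ≠ 0 → 0 < B f f := fun f hf =>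
    lt_of_lt_of_le (mul_pos hc (by positivity)) (hBc f)
  have hJs : ∀ (t : ℝ) (f : H), 0 ≤ t → J (t • f) = t ^ q * J f := by
    intro t f ht
    simp only [hJ, inner_smul_right, abs_mul, abs_of_nonneg ht]
    rw [← integral_const_mul]
    congr 1; ext x
    rw [Real.mul_rpow ht (abs_nonneg _)]
  set R := Real.sqrt (1 / c) with hR
  have hR1 : ∀ f, B f f ≤ 1 → ‖f‖ ≤ R := by
    intro f hf
    apply Real.le_sqrt_of_sq_le
    rw [le_div_iff₀ hc]
    linarith [hBc f]
  have hbd : ∀ f, ‖f‖ ≤ R → J f ≤ ∫ x, κ x ^ q * R ^ q ∂m := by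
    intro f hf
    refine integral_mono_ae (integrable_rpow_abs_kernel hq hmeas hκ hκq f) (hκq.mul_const _) ?_
    filter_upwards [rpow_abs_kernel_le (H := H) hq hκ] with x hx
    exact (le_abs_self _).trans (hx f hf)
  set A : Set ℝ := J '' {f | B f f ≤ 1} with hA
  have hAb : BddAbove A := ⟨_, by
    rintro _ ⟨f, hf, rfl⟩
    exact hbd f (hR1 f hf)⟩
  have hAn : A.Nonempty := ⟨J 0, 0, by simp, rfl⟩
  obtain ⟨a, -, ha, haA⟩ := exists_seq_tendsto_sSup hAn hAb
  choose x hx1 hx2 using haA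
  obtain ⟨f, φ, hφ, hw⟩ := exists_weak_subseq_limit x R fun n => hR1 _ (hx1 n)
  have hJf : J f = sSup A := by
    refine tendsto_nhds_unique ?_ (ha.comp hφ.tendsto_atTop)
    have : a ∘ φ = fun n => J (x (φ n)) := by ext n; exact (hx2 _).symm
    rw [this]
    refine tendsto_integral_of_dominated_convergence (fun x => κ x ^ q * R ^ q) ?_
      (hκq.mul_const _) ?_ ?_
    · exact fun n => ((hmeas _).aemeasurable.abs.pow_const q).aestronglyMeasurable
    · intro n
      filter_upwards [rpow_abs_kernel_le (H := H) hq hκ] with y hy using hy _ (hR1 _ (hx1 _))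
    · refine Eventually.of_forall fun y => ?_
      have := hw (k y)
      simp only [real_inner_comm (k y)] at this
      exact (this.abs).rpow_const (Or.inr (by linarith))
  have hBf : B f f ≤ 1 := by
    have h1 : Tendsto (fun n => 2 * B f (x (φ n)) - B f f) atTop (𝓝 (2 * B f f - B f f)) := by
      refine (Tendsto.const_mul 2 ?_).sub_const _
      have := hw ((InnerProductSpace.toDual ℝ H).symm (B f))
      simpa only [real_inner_comm ((InnerProductSpace.toDual ℝ H).symm (B f)),
        ← real_inner_comm _ ((InnerProductSpace.toDual ℝ H).symm (B f)),
        InnerProductSpace.toDual_symm_apply] using this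
    have h2 : ∀ n, 2 * B f (x (φ n)) - B f f ≤ 1 := by
      intro n
      have h3 := hB0 (x (φ n) - f)
      have h4 := hx1 (φ n)
      simp only [Set.mem_ofPred_eq] at h4
      simp only [map_sub, sub_apply, hBs (x (φ n)) f] at h3
      linarith
    have := le_of_tendsto' h1 h2
    linarith
  have hmain : ∀ g, J g ≤ J f * B g g ^ (q / 2) := by
    intro g
    rcases eq_or_ne g 0 with rfl | hg
    · have h0 : J 0 = 0 := by
        simp [hJ, Real.zero_rpow (by linarith : q ≠ 0)]
      rw [h0]
      have : 0 ≤ J f := integral_nonneg fun x => by positivity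
      simp [Real.zero_rpow (by linarith : q / 2 ≠ 0)]
    · have hp := hBpos g hg
      set r := Real.sqrt (B g g) with hr
      have hr0 : 0 < r := Real.sqrt_pos.2 hp
      have h1 : B (r⁻¹ • g) (r⁻¹ • g) ≤ 1 := by
        simp only [map_smul, smul_apply, smul_eq_mul]
        have : B g g = r * r := (Real.mul_self_sqrt hp.le).symm
        rw [this]
        field_simp; rfl
      have h2 : J (r⁻¹ • g) ≤ J f := by
        rw [hJf]; exact le_csSup hAb ⟨_, h1, rfl⟩
      have h3 : J g = r ^ q * J (r⁻¹ • g) := by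
        rw [← hJs r _ hr0.le, smul_inv_smul₀ hr0.ne']
      have h4 : r ^ q = B g g ^ (q / 2) := by
        rw [hr, Real.sqrt_eq_rpow, ← Real.rpow_mul hp.le]; congr 1; ring
      rw [h3, h4, mul_comm]
      gcongr
  refine ⟨f, hBf, ?_, hmain⟩
  obtain ⟨g, hg⟩ := hne
  by_contra hcon
  have h1 := hmain g
  have h2 : J f * B g g ^ (q / 2) ≤ 0 :=
    mul_nonpos_of_nonpos_of_nonneg (not_lt.1 hcon) (Real.rpow_nonneg (hB0 g) _)
  exact absurd hg (not_lt.2 (h1.trans h2))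

/-- Existence of a nonnegative nonzero solution of `B f = J'(f) / q`, where
`J f = ∫ |⟪k x, f⟫| ^ q`. -/
theorem exists_nonneg_critical_point (hq : 2 < q)
    (hmeas : ∀ f : H, AEStronglyMeasurable (fun x => inner ℝ (k x) f) m)
    (hκ : ∀ᵐ x ∂m, ‖k x‖ ≤ κ x) (hκq : Integrable (fun x => κ x ^ q) m)
    (B : H →L[ℝ] H →L[ℝ] ℝ) (hBs : ∀ f g, B f g = B g f)
    {c : ℝ} (hc : 0 < c) (hBc : ∀ f, c * ‖f‖ ^ 2 ≤ B f f)
    (hne : ∃ f : H, 0 < ∫ x, |inner ℝ (k x) f| ^ q ∂m)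
    (habs : ∀ f : H, ∃ g : H, B g g ≤ B f f ∧ ∀ᵐ x ∂m, inner ℝ (k x) g = |inner ℝ (k x) f|) :
    ∃ f : H, f ≠ 0 ∧ (∀ᵐ x ∂m, 0 ≤ inner ℝ (k x) f) ∧
      ∀ g : H, B f g = ∫ x, |inner ℝ (k x) f| ^ (q - 2) * inner ℝ (k x) f * inner ℝ (k x) g ∂m := by
  obtain ⟨f₀, hf₀1, hf₀2, hf₀3⟩ := exists_extremal_kernel hq hmeas hκ hκq B hBs hc hBc hne
  obtain ⟨f, hfB, hfa⟩ := habs f₀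
  set J : H → ℝ := fun f => ∫ x, |inner ℝ (k x) f| ^ q ∂m with hJ
  have hJf : J f = J f₀ := by
    refine integral_congr_ae ?_
    filter_upwards [hfa] with x hx
    rw [hx, abs_abs]
  have hB0 : ∀ f, 0 ≤ B f f := fun f => le_trans (by positivity) (hBc f)
  have hSpos : 0 < J f := by rw [hJf]; exact hf₀2
  have hmax : ∀ g, J g ≤ J f * B g g ^ (q / 2) := by rw [hJf]; exact hf₀3
  have hBf : B f f = 1 := by
    refine le_antisymm (hfB.trans hf₀1) ?_
    by_contra hlt
    have h1 : B f f ^ (q / 2) < 1 := Real.rpow_lt_one (hB0 f) (not_le.1 hlt) (by linarith)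
    have := hmax f
    nlinarith
  have hEL : ∀ g, J f * B f g =
      ∫ x, |inner ℝ (k x) f| ^ (q - 2) * inner ℝ (k x) f * inner ℝ (k x) g ∂m := by
    intro g
    have hd1 := hasDerivAt_integral_rpow_abs_kernel hq hmeas hκ hκq f g
    have hquad : (fun t : ℝ => B (f + t • g) (f + t • g)) =
        fun t : ℝ => B f f + t * (2 * B f g) + t ^ 2 * B g g := by
      ext t
      simp only [map_add, map_smul, add_apply, smul_apply,
        smul_eq_mul, hBs g f]
      ring
    have hd2 : HasDerivAt (fun t : ℝ => B (f + t • g) (f + t • g)) (2 * B f g) 0 := by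
      rw [hquad]
      refine (((((hasDerivAt_id (0 : ℝ)).mul_const (2 * B f g)).const_add (B f f)).add
        (((hasDerivAt_id (0 : ℝ)).pow 2).mul_const (B g g))).congr_deriv (by simp))
    have hd3 := (hd2.rpow_const (p := q / 2) (Or.inr (by linarith))).const_mul (J f)
    have hd4 := hd1.sub hd3
    have hmx : IsLocalMax ((fun t : ℝ => ∫ x, |inner ℝ (k x) (f + t • g)| ^ q ∂m) -
        fun t => J f * B (f + t • g) (f + t • g) ^ (q / 2)) 0 := by
      refine Eventually.of_forall fun t => ?_
      have h1 := hmax (f + t • g)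
      simp only [Pi.sub_apply, zero_smul, add_zero, hBf, Real.one_rpow, mul_one]
      simp only [hJ] at h1 ⊢
      linarith
    have h0 := hmx.hasDerivAt_eq_zero hd4
    rw [integral_const_mul] at h0
    simp only [zero_smul, add_zero, hBf, Real.one_rpow, mul_one] at h0
    have hq0 : q ≠ 0 := by linarith
    have : q * (J f * B f g - ∫ x, |inner ℝ (k x) f| ^ (q - 2) * inner ℝ (k x) f *
        inner ℝ (k x) g ∂m) = 0 := by linarith
    rcases mul_eq_zero.1 this with h | h
    · exact absurd h hq0
    · linarith
  set t : ℝ := J f ^ (-(1 / (q - 2))) with ht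
  have ht0 : 0 < t := Real.rpow_pos_of_pos hSpos _
  have htq : t ^ (q - 2) * J f = 1 := by
    rw [ht, ← Real.rpow_mul hSpos.le, show -(1 / (q - 2)) * (q - 2) = -1 by
      have : q - 2 ≠ 0 := by linarith
      field_simp, Real.rpow_neg_one, inv_mul_cancel₀ hSpos.ne']
  refine ⟨t • f, ?_, ?_, fun g => ?_⟩
  · intro h
    rcases smul_eq_zero.1 h with h | h
    · exact ht0.ne' h
    · rw [h] at hBf; simp at hBf
  · filter_upwards [hfa] with x hx
    rw [inner_smul_right, hx]; positivity
  · have h1 : ∀ x, |inner ℝ (k x) (t • f)| ^ (q - 2) * inner ℝ (k x) (t • f) * inner ℝ (k x) g =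
        (t ^ (q - 2) * t) *
          (|inner ℝ (k x) f| ^ (q - 2) * inner ℝ (k x) f * inner ℝ (k x) g) := by
      intro x
      rw [inner_smul_right, abs_mul, abs_of_pos ht0, Real.mul_rpow ht0.le (abs_nonneg _)]
      ring
    simp only [h1]
    rw [integral_const_mul, ← hEL g]
    simp only [map_smul, smul_apply, smul_eq_mul]
    calc t * B f g = (t ^ (q - 2) * J f) * (t * B f g) := by rw [htq, one_mul]
      _ = _ := by ring

end Variational

namespace HalfLine

/-- `tail k f s = ∫_s^∞ k f`. -/
noncomputable def tail (k f : ℝ → ℝ) (s : ℝ) : ℝ := ∫ t in Set.Ioi s, k t * f t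

/-- A positive continuous function on `(0, ∞)` that is square integrable at infinity. -/
structure IsTailKernel (k : ℝ → ℝ) : Prop where
  cont : ContinuousOn k (Set.Ioi 0)
  pos : ∀ s, 0 < s → 0 < k s
  sq_int : ∀ s, 0 < s → IntegrableOn (fun t => k t ^ 2) (Set.Ioi s)

variable {k f g : ℝ → ℝ}

theorem IsTailKernel.memLp (hk : IsTailKernel k) {s : ℝ} (hs : 0 < s) :
    MemLp k 2 (volume.restrict (Set.Ioi s)) := by
  have hm : AEStronglyMeasurable k (volume.restrict (Set.Ioi s)) :=
    (hk.cont.mono (Set.Ioi_subset_Ioi hs.le)).aestronglyMeasurable measurableSet_Ioi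
  exact (memLp_two_iff_integrable_sq hm).2 (hk.sq_int s hs)

theorem memLp_Ioi_mono (hf : MemLp f 2 (volume.restrict (Set.Ioi 0))) {s : ℝ} (hs : 0 < s) :
    MemLp f 2 (volume.restrict (Set.Ioi s)) :=
  hf.mono_measure (Measure.restrict_mono (Set.Ioi_subset_Ioi hs.le) le_rfl)

theorem integrableOn_tail (hk : IsTailKernel k) (hf : MemLp f 2 (volume.restrict (Set.Ioi 0)))
    {s : ℝ} (hs : 0 < s) : IntegrableOn (fun t => k t * f t) (Set.Ioi s) :=
  (hk.memLp hs).integrable_mul (memLp_Ioi_mono hf hs)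

theorem tail_sub_tail (hk : IsTailKernel k) (hf : MemLp f 2 (volume.restrict (Set.Ioi 0)))
    {a b : ℝ} (ha : 0 < a) (hb : 0 < b) :
    tail k f a - tail k f b = ∫ t in a..b, k t * f t :=
  intervalIntegral.integral_Ioi_sub_Ioi' (integrableOn_tail hk hf ha) (integrableOn_tail hk hf hb)

theorem continuousOn_tail (hk : IsTailKernel k) (hf : MemLp f 2 (volume.restrict (Set.Ioi 0))) :
    ContinuousOn (tail k f) (Set.Ioi 0) := by
  intro s hs
  replace hs : 0 < s := hs
  have hs' : 0 < s / 2 := half_pos hs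
  have := (integrableOn_tail hk hf hs').continuousOn_Ici_primitive_Ioi
  have h2 := (this s (by simpa using (half_lt_self hs).le)).continuousAt
    (Ici_mem_nhds (half_lt_self hs))
  exact h2.continuousWithinAt

theorem tendsto_tail_atTop (hk : IsTailKernel k) (hf : MemLp f 2 (volume.restrict (Set.Ioi 0))) :
    Tendsto (tail k f) atTop (𝓝 0) := by
  have h1 := intervalIntegral_tendsto_integral_Ioi 1 (integrableOn_tail hk hf one_pos)
    (tendsto_id (α := ℝ) (x := atTop))
  have h2 : Tendsto (fun b => tail k f 1 - ∫ t in (1 : ℝ)..b, k t * f t) atTop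
      (𝓝 (tail k f 1 - tail k f 1)) := tendsto_const_nhds.sub h1
  rw [sub_self] at h2
  refine h2.congr' ?_
  filter_upwards [eventually_gt_atTop 0] with b hb
  rw [← tail_sub_tail hk hf one_pos hb]; ring

theorem tail_congr (h : f =ᵐ[volume.restrict (Set.Ioi 0)] g) {s : ℝ} (hs : 0 ≤ s) :
    tail k f s = tail k g s := by
  refine integral_congr_ae ?_
  filter_upwards [ae_restrict_of_ae_restrict_of_subset (Set.Ioi_subset_Ioi hs) h] with t ht
  rw [ht]

theorem tail_add (hk : IsTailKernel k) (hf : MemLp f 2 (volume.restrict (Set.Ioi 0)))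
    (hg : MemLp g 2 (volume.restrict (Set.Ioi 0))) {s : ℝ} (hs : 0 < s) :
    tail k (f + g) s = tail k f s + tail k g s := by
  unfold tail
  rw [← integral_add (integrableOn_tail hk hf hs) (integrableOn_tail hk hg hs)]
  congr 1; ext t; simp [mul_add]

theorem tail_smul (c : ℝ) (s : ℝ) : tail k (c • f) s = c * tail k f s := by
  unfold tail
  rw [← integral_const_mul]
  congr 1; ext t; simp; ring

theorem ae_hasDerivAt_tail (hk : IsTailKernel k) (hf : MemLp f 2 (volume.restrict (Set.Ioi 0))) :
    ∀ᵐ t, 0 < t → HasDerivAt (tail k f) (-(k t * f t)) t := by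
  have h : ∀ n : ℕ, ∀ᵐ t, ∀ c, HasDerivAt
      (fun x => ∫ y in c..x, (Set.Ioi (1 / ((n : ℝ) + 1))).indicator (fun y => k y * f y) y)
      ((Set.Ioi (1 / ((n : ℝ) + 1))).indicator (fun y => k y * f y) t) t := fun n =>
    LocallyIntegrable.ae_hasDerivAt_integral
      ((integrable_indicator_iff measurableSet_Ioi).2
        (integrableOn_tail hk hf (by positivity))).locallyIntegrable
  filter_upwards [ae_all_iff.2 h] with t ht ht0
  obtain ⟨n, hn⟩ := exists_nat_one_div_lt ht0
  have h0 : (0 : ℝ) < 1 / ((n : ℝ) + 1) := by positivity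
  have h1 := (ht n t).const_sub (tail k f t)
  rw [Set.indicator_of_mem (by exact hn)] at h1
  refine h1.congr_of_eventuallyEq ?_
  filter_upwards [Ioi_mem_nhds hn] with x hx
  have h2 := tail_sub_tail hk hf ht0 (h0.trans hx)
  have h3 : ∫ y in t..x, (Set.Ioi (1 / ((n : ℝ) + 1))).indicator (fun y => k y * f y) y =
      ∫ y in t..x, k y * f y := by
    refine intervalIntegral.integral_congr fun y hy => ?_
    have : 1 / ((n : ℝ) + 1) < y := lt_of_lt_of_le (lt_min hn hx) hy.1
    exact Set.indicator_of_mem (by exact this) _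
  rw [h3, ← h2]; ring

theorem abs_deriv_abs_le {F : ℝ → ℝ} {F' t : ℝ} (h : HasDerivAt F F' t) :
    |deriv (fun s => |F s|) t| ≤ |F'| := by
  rcases lt_trichotomy (F t) 0 with h0 | h0 | h0
  · have := (hasDerivAt_abs_neg h0).comp t h
    rw [show (fun s => |F s|) = (fun x => |x|) ∘ F from rfl, this.deriv]; simp
  · have : IsLocalMin (fun s => |F s|) t :=
      Eventually.of_forall fun s => by simp [h0]
    rw [this.deriv_eq_zero]; simp
  · have := (hasDerivAt_abs_pos h0).comp t h
    rw [show (fun s => |F s|) = (fun x => |x|) ∘ F from rfl, this.deriv]; simp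

theorem _root_.AbsolutelyContinuousOnInterval.of_dist_le {F G : ℝ → ℝ} {a b : ℝ}
    (hF : AbsolutelyContinuousOnInterval F a b)
    (h : ∀ x ∈ Set.uIcc a b, ∀ y ∈ Set.uIcc a b, dist (G x) (G y) ≤ dist (F x) (F y)) :
    AbsolutelyContinuousOnInterval G a b := by
  rw [absolutelyContinuousOnInterval_iff] at hF ⊢
  intro ε hε
  obtain ⟨δ, hδ, H⟩ := hF ε hε
  refine ⟨δ, hδ, fun E hE hE' => lt_of_le_of_lt (Finset.sum_le_sum fun i hi => ?_) (H E hE hE')⟩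
  exact h _ (hE.1 i hi).1 _ (hE.1 i hi).2

/-- The absolute value of a tail integral is the tail integral of a function that is no larger. -/
theorem exists_tail_eq_abs_tail (hk : IsTailKernel k)
    (hf : MemLp f 2 (volume.restrict (Set.Ioi 0))) :
    ∃ g : ℝ → ℝ, MemLp g 2 (volume.restrict (Set.Ioi 0)) ∧
      (∀ᵐ t ∂volume.restrict (Set.Ioi 0), |g t| ≤ |f t|) ∧
      ∀ s, 0 < s → tail k g s = |tail k f s| := by
  set V : ℝ → ℝ := fun s => |tail k f s| with hV
  set g : ℝ → ℝ := fun t => -(deriv V t) / k t with hg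
  have hle : ∀ᵐ t ∂volume.restrict (Set.Ioi 0), |g t| ≤ |f t| := by
    rw [ae_restrict_iff' measurableSet_Ioi]
    filter_upwards [ae_hasDerivAt_tail hk hf] with t ht ht0
    have hkt := hk.pos t ht0
    have := abs_deriv_abs_le (ht ht0)
    rw [hg, abs_div, abs_neg, abs_of_pos hkt, div_le_iff₀ hkt]
    refine this.trans (le_of_eq ?_)
    rw [abs_neg, abs_mul, abs_of_pos hkt, mul_comm]
  have hgm : MemLp g 2 (volume.restrict (Set.Ioi 0)) := by
    refine hf.mono ?_ hle
    exact ((measurable_deriv V).neg.aemeasurable.div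
      (hk.cont.aemeasurable measurableSet_Ioi)).aestronglyMeasurable
  refine ⟨g, hgm, hle, fun a ha => ?_⟩
  have hlim : Tendsto (fun b => V a - V b) atTop (𝓝 (V a)) := by
    have := (tendsto_tail_atTop hk hf).abs
    simpa using (tendsto_const_nhds (x := V a)).sub this
  refine tendsto_nhds_unique (intervalIntegral_tendsto_integral_Ioi a
    (integrableOn_tail hk hgm ha) tendsto_id) (hlim.congr' ?_)
  filter_upwards [eventually_ge_atTop a] with b hb
  have hab : ∀ x ∈ Set.uIcc a b, 0 < x := fun x hx => by
    rw [Set.uIcc_of_le hb] at hx; exact ha.trans_le hx.1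
  have h_int : IntervalIntegrable (fun t => k t * f t) volume a b :=
    (intervalIntegrable_iff_integrableOn_Ioc_of_le hb).2
      ((integrableOn_tail hk hf ha).mono_set Set.Ioc_subset_Ioi_self)
  have hac : AbsolutelyContinuousOnInterval V a b := by
    refine (h_int.absolutelyContinuousOnInterval_intervalIntegral
      (c := a) Set.left_mem_uIcc).of_dist_le fun x hx y hy => ?_
    rw [Real.dist_eq, Real.dist_eq, ← tail_sub_tail hk hf ha (hab x hx),
      ← tail_sub_tail hk hf ha (hab y hy)]
    refine (abs_abs_sub_abs_le_abs_sub _ _).trans (le_of_eq ?_)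
    rw [← abs_neg]; congr 1; ring
  have h1 := hac.integral_deriv_eq_sub
  have h2 : ∫ t in a..b, k t * g t = -∫ t in a..b, deriv V t := by
    rw [← intervalIntegral.integral_neg]
    refine intervalIntegral.integral_congr fun t ht => ?_
    have := (hk.pos t (hab t ht)).ne'
    simp only [hg]; field_simp
  simp only [id]
  rw [h2, h1]; ring

theorem IsTailKernel.memLp_indicator (hk : IsTailKernel k) {s : ℝ} (hs : 0 < s) :
    MemLp ((Set.Ioi s).indicator k) 2 (volume.restrict (Set.Ioi 0)) := by
  rw [memLp_indicator_iff_restrict measurableSet_Ioi, Measure.restrict_restrict measurableSet_Ioi,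
    Set.inter_eq_left.2 (Set.Ioi_subset_Ioi hs.le)]
  exact hk.memLp hs

/-- The representative of the kernel `t ↦ 1_{t > s} k t` in `L²(0, ∞)`. -/
noncomputable def kernelLp (hk : IsTailKernel k) (s : ℝ) :
    Lp ℝ 2 (volume.restrict (Set.Ioi (0 : ℝ))) :=
  if h : 0 < s then (hk.memLp_indicator h).toLp _ else 0

theorem inner_kernelLp (hk : IsTailKernel k) {s : ℝ} (hs : 0 < s)
    (f : Lp ℝ 2 (volume.restrict (Set.Ioi (0 : ℝ)))) :
    inner ℝ (kernelLp hk s) f = tail k f s := by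
  rw [L2.inner_def, kernelLp, dif_pos hs]
  have : (fun t => inner ℝ ((hk.memLp_indicator hs).toLp _ t) (f t)) =ᵐ[volume.restrict (Set.Ioi 0)]
      (Set.Ioi s).indicator (fun t => k t * f t) := by
    filter_upwards [(hk.memLp_indicator hs).coeFn_toLp] with t ht
    rw [ht]
    by_cases hts : t ∈ Set.Ioi s
    · simp [Set.indicator_of_mem hts, mul_comm]
    · simp [Set.indicator_of_notMem hts]
  rw [integral_congr_ae this, integral_indicator measurableSet_Ioi,
    Measure.restrict_restrict measurableSet_Ioi, Set.inter_eq_left.2 (Set.Ioi_subset_Ioi hs.le)]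
  rfl

theorem norm_kernelLp_sq (hk : IsTailKernel k) {s : ℝ} (hs : 0 < s) :
    ‖kernelLp hk s‖ ^ 2 = ∫ t in Set.Ioi s, k t ^ 2 := by
  rw [← real_inner_self_eq_norm_sq, inner_kernelLp hk hs, tail]
  refine setIntegral_congr_ae measurableSet_Ioi ?_
  have : ∀ᵐ t ∂volume.restrict (Set.Ioi 0), kernelLp hk s t = (Set.Ioi s).indicator k t := by
    rw [kernelLp, dif_pos hs]
    exact MemLp.coeFn_toLp _
  rw [ae_restrict_iff' measurableSet_Ioi] at this
  filter_upwards [this] with t ht hts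
  rw [ht (hs.trans hts), Set.indicator_of_mem hts, sq]

theorem norm_toLp_sq (hf : MemLp f 2 (volume.restrict (Set.Ioi 0))) :
    ‖hf.toLp f‖ ^ 2 = ∫ t in Set.Ioi 0, f t ^ 2 := by
  rw [← real_inner_self_eq_norm_sq, L2.inner_def]
  refine integral_congr_ae ?_
  filter_upwards [hf.coeFn_toLp] with t ht
  rw [ht]; simp [sq]

theorem inner_toLp (hf : MemLp f 2 (volume.restrict (Set.Ioi 0)))
    (hg : MemLp g 2 (volume.restrict (Set.Ioi 0))) :
    inner ℝ (hf.toLp f) (hg.toLp g) = ∫ t in Set.Ioi 0, f t * g t := by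
  rw [L2.inner_def]
  refine integral_congr_ae ?_
  filter_upwards [hf.coeFn_toLp, hg.coeFn_toLp] with t ht ht'
  rw [ht, ht']; simp [mul_comm]

theorem abs_tail_le_sqrt (hk : IsTailKernel k) (hf : MemLp f 2 (volume.restrict (Set.Ioi 0)))
    {s : ℝ} (hs : 0 < s) :
    |tail k f s| ≤ √(∫ t in Set.Ioi s, k t ^ 2) * √(∫ t in Set.Ioi 0, f t ^ 2) := by
  rw [← norm_toLp_sq hf, ← norm_kernelLp_sq hk hs, Real.sqrt_sq (norm_nonneg _),
    Real.sqrt_sq (norm_nonneg _), ← tail_congr hf.coeFn_toLp hs.le, ← inner_kernelLp hk hs]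
  exact abs_real_inner_le_norm _ _

end HalfLine

namespace HalfLine

/-- Weights `m₁`, `m₂` on `(0, ∞)` adapted to the operator `tail k`: a Hardy inequality with
constant `C` for `m₁`, and integrability of the pointwise bound for `m₂`. -/
structure IsAdapted (k m₁ m₂ κ : ℝ → ℝ) (q C : ℝ) : Prop where
  kernel : IsTailKernel k
  cont₁ : ContinuousOn m₁ (Set.Ioi 0)
  pos₁ : ∀ s, 0 < s → 0 < m₁ s
  cont₂ : ContinuousOn m₂ (Set.Ioi 0)
  pos₂ : ∀ s, 0 < s → 0 < m₂ s
  hardy : ∀ f, MemLp f 2 (volume.restrict (Set.Ioi 0)) →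
    IntegrableOn (fun s => m₁ s * tail k f s ^ 2) (Set.Ioi 0) ∧
      ∫ s in Set.Ioi 0, m₁ s * tail k f s ^ 2 ≤ C * ∫ s in Set.Ioi 0, f s ^ 2
  kappa_nonneg : ∀ s, 0 < s → 0 ≤ κ s
  kernel_le : ∀ s, 0 < s → ∫ t in Set.Ioi s, k t ^ 2 ≤ κ s ^ 2
  integrable_kappa : IntegrableOn (fun s => m₂ s * κ s ^ q) (Set.Ioi 0)

variable {k m₁ m₂ κ f g : ℝ → ℝ} {q C : ℝ}

theorem abs_tail_le_kappa (hw : IsAdapted k m₁ m₂ κ q C)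
    (hf : MemLp f 2 (volume.restrict (Set.Ioi 0))) {s : ℝ} (hs : 0 < s) :
    |tail k f s| ≤ κ s * √(∫ t in Set.Ioi 0, f t ^ 2) := by
  refine (abs_tail_le_sqrt hw.kernel hf hs).trans ?_
  gcongr
  exact Real.sqrt_le_iff.2 ⟨hw.kappa_nonneg s hs, hw.kernel_le s hs⟩

theorem memLp_sqrt_mul_tail (hw : IsAdapted k m₁ m₂ κ q C)
    (hf : MemLp f 2 (volume.restrict (Set.Ioi 0))) :
    MemLp (fun s => √(m₁ s) * tail k f s) 2 (volume.restrict (Set.Ioi 0)) := by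
  have hm : AEStronglyMeasurable (fun s => √(m₁ s) * tail k f s)
      (volume.restrict (Set.Ioi 0)) :=
    ((hw.cont₁.sqrt).mul (continuousOn_tail hw.kernel hf)).aestronglyMeasurable measurableSet_Ioi
  refine (memLp_two_iff_integrable_sq hm).2 ((hw.hardy f hf).1.congr_fun (fun s hs => ?_)
    measurableSet_Ioi)
  simp only [mul_pow, Real.sq_sqrt (hw.pos₁ s hs).le]

/-- The operator `f ↦ √m₁ · tail k f` on `L²(0, ∞)`. -/
noncomputable def hardyOp (hw : IsAdapted k m₁ m₂ κ q C) :
    Lp ℝ 2 (volume.restrict (Set.Ioi (0 : ℝ))) →L[ℝ]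
      Lp ℝ 2 (volume.restrict (Set.Ioi (0 : ℝ))) :=
  LinearMap.mkContinuous
    { toFun := fun f => (memLp_sqrt_mul_tail hw (Lp.memLp f)).toLp _
      map_add' := fun f g => by
        rw [← MemLp.toLp_add, MemLp.toLp_eq_toLp_iff]
        filter_upwards [ae_restrict_mem measurableSet_Ioi] with s hs
        rw [tail_congr (Lp.coeFn_add f g) (le_of_lt hs),
          tail_add hw.kernel (Lp.memLp f) (Lp.memLp g) hs]
        simp [mul_add]
      map_smul' := fun c f => by
        rw [RingHom.id_apply, ← MemLp.toLp_const_smul, MemLp.toLp_eq_toLp_iff]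
        filter_upwards [ae_restrict_mem measurableSet_Ioi] with s hs
        rw [tail_congr (Lp.coeFn_smul c f) (le_of_lt hs), tail_smul]
        simp only [Pi.smul_apply, smul_eq_mul]; ring }
    (√C) (fun f => by
      refine (sq_le_sq₀ (norm_nonneg _) (by positivity)).1 ?_
      simp only [LinearMap.coe_mk, AddHom.coe_mk]
      rw [norm_toLp_sq, mul_pow]
      have h1 := (hw.hardy f (Lp.memLp f)).2
      have h2 : ∫ s in Set.Ioi 0, f s ^ 2 = ‖f‖ ^ 2 := by
        rw [← norm_toLp_sq (Lp.memLp f), Lp.toLp_coeFn]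
      have h3 : ∫ s in Set.Ioi 0, (√(m₁ s) * tail k f s) ^ 2 =
          ∫ s in Set.Ioi 0, m₁ s * tail k f s ^ 2 :=
        setIntegral_congr_fun measurableSet_Ioi fun s hs => by
          simp only [mul_pow, Real.sq_sqrt (hw.pos₁ s hs).le]
      rw [h3]
      refine h1.trans ?_
      rw [h2]
      gcongr
      rcases le_total 0 C with h | h
      · rw [Real.sq_sqrt h]
      · exact h.trans (sq_nonneg _))

theorem inner_hardyOp (hw : IsAdapted k m₁ m₂ κ q C)
    (f g : Lp ℝ 2 (volume.restrict (Set.Ioi (0 : ℝ)))) :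
    inner ℝ (hardyOp hw f) (hardyOp hw g) = ∫ s in Set.Ioi 0, m₁ s * (tail k f s * tail k g s) := by
  refine (inner_toLp (memLp_sqrt_mul_tail hw (Lp.memLp f))
    (memLp_sqrt_mul_tail hw (Lp.memLp g))).trans ?_
  refine setIntegral_congr_fun measurableSet_Ioi fun s hs => ?_
  have := Real.mul_self_sqrt (hw.pos₁ s hs).le
  calc _ = (√(m₁ s) * √(m₁ s)) * (tail k f s * tail k g s) := by ring
    _ = _ := by rw [this]

theorem integrableOn_hardy_mul (hw : IsAdapted k m₁ m₂ κ q C)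
    (hf : MemLp f 2 (volume.restrict (Set.Ioi 0)))
    (hg : MemLp g 2 (volume.restrict (Set.Ioi 0))) :
    IntegrableOn (fun s => m₁ s * (tail k f s * tail k g s)) (Set.Ioi 0) := by
  refine IntegrableOn.congr_fun ((memLp_sqrt_mul_tail hw hf).integrable_mul
    (memLp_sqrt_mul_tail hw hg)) (fun s hs => ?_) measurableSet_Ioi
  have := Real.mul_self_sqrt (hw.pos₁ s hs).le
  simp only [Pi.mul_apply]
  calc _ = (√(m₁ s) * √(m₁ s)) * (tail k f s * tail k g s) := by ring
    _ = _ := by rw [this]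

theorem norm_rpow_mul_tail_le (hw : IsAdapted k m₁ m₂ κ q C) (hq : 2 < q)
    (hf : MemLp f 2 (volume.restrict (Set.Ioi 0)))
    (hg : MemLp g 2 (volume.restrict (Set.Ioi 0))) {s : ℝ} (hs : 0 < s) :
    |m₂ s * (|tail k f s| ^ (q - 2) * tail k f s * tail k g s)| ≤
      m₂ s * κ s ^ q * (√(∫ t in Set.Ioi 0, f t ^ 2) ^ (q - 1) * √(∫ t in Set.Ioi 0, g t ^ 2)) := by
  have hf' := abs_tail_le_kappa hw hf hs
  have hg' := abs_tail_le_kappa hw hg hs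
  have h0 := hw.kappa_nonneg s hs
  set a := tail k f s
  set b := tail k g s
  have e : |a| ^ (q - 2) * |a| = |a| ^ (q - 1) := by
    rcases (abs_nonneg a).eq_or_lt with h | h
    · rw [← h, Real.zero_rpow (by linarith), Real.zero_rpow (by linarith), zero_mul]
    · rw [← Real.rpow_add_one h.ne']; ring_nf
  have e2 : κ s ^ (q - 1) * κ s = κ s ^ q := by
    rcases h0.eq_or_lt with h | h
    · rw [← h, Real.zero_rpow (by linarith), Real.zero_rpow (by linarith), zero_mul]
    · rw [← Real.rpow_add_one h.ne']; ring_nf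
  rw [abs_mul, abs_mul, abs_mul, abs_of_pos (hw.pos₂ s hs), abs_of_nonneg (by positivity), e]
  rw [mul_assoc]
  refine mul_le_mul_of_nonneg_left ?_ (hw.pos₂ s hs).le
  calc |a| ^ (q - 1) * |b| ≤ (κ s * √(∫ t in Set.Ioi 0, f t ^ 2)) ^ (q - 1) *
        (κ s * √(∫ t in Set.Ioi 0, g t ^ 2)) := by
        gcongr
        linarith
    _ = (κ s ^ (q - 1) * κ s) * (√(∫ t in Set.Ioi 0, f t ^ 2) ^ (q - 1) *
        √(∫ t in Set.Ioi 0, g t ^ 2)) := by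
        rw [Real.mul_rpow h0 (Real.sqrt_nonneg _)]; ring
    _ = _ := by rw [e2]

theorem integrableOn_rpow_mul (hw : IsAdapted k m₁ m₂ κ q C) (hq : 2 < q)
    (hf : MemLp f 2 (volume.restrict (Set.Ioi 0)))
    (hg : MemLp g 2 (volume.restrict (Set.Ioi 0))) :
    IntegrableOn (fun s => m₂ s * (|tail k f s| ^ (q - 2) * tail k f s * tail k g s))
      (Set.Ioi 0) := by
  refine (hw.integrable_kappa.mul_const (√(∫ t in Set.Ioi 0, f t ^ 2) ^ (q - 1) *
    √(∫ t in Set.Ioi 0, g t ^ 2))).mono' ?_ ?_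
  · have hF := continuousOn_tail hw.kernel hf
    have hG := continuousOn_tail hw.kernel hg
    refine ContinuousOn.aestronglyMeasurable ?_ measurableSet_Ioi
    exact hw.cont₂.mul (((hF.abs.rpow_const fun _ _ => Or.inr (by linarith)).mul hF).mul hG)
  · filter_upwards [ae_restrict_mem measurableSet_Ioi] with s hs
    exact norm_rpow_mul_tail_le hw hq hf hg hs

theorem tail_indicator_pos (hk : IsTailKernel k) {a b s : ℝ} (hab : a < b) (hs : 0 < s)
    (hsa : s ≤ a) :
    tail k ((Set.Ioo a b).indicator 1) s = ∫ t in Set.Ioo a b, k t ∧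
      0 < ∫ t in Set.Ioo a b, k t := by
  have hsub : Set.Ioo a b ⊆ Set.Ioi s := fun t ht => hsa.trans_lt ht.1
  refine ⟨?_, ?_⟩
  · have : (fun t => k t * (Set.Ioo a b).indicator (1 : ℝ → ℝ) t) = (Set.Ioo a b).indicator k := by
      ext t
      by_cases ht : t ∈ Set.Ioo a b
      · simp [Set.indicator_of_mem ht]
      · simp [Set.indicator_of_notMem ht]
    rw [tail, this, integral_indicator measurableSet_Ioo,
      Measure.restrict_restrict measurableSet_Ioo, Set.inter_eq_left.2 hsub]
  · have hc : ContinuousOn k (Set.Icc a b) :=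
      hk.cont.mono fun t ht => (hs.trans_le hsa).trans_le ht.1
    rw [← integral_Ioc_eq_integral_Ioo, ← intervalIntegral.integral_of_le hab.le]
    refine intervalIntegral.intervalIntegral_pos_of_pos_on ?_ (fun t ht => ?_) hab
    · exact ContinuousOn.intervalIntegrable (by rwa [Set.uIcc_of_le hab.le])
    · exact hk.pos t ((hs.trans_le hsa).trans ht.1)

theorem memLp_indicator_Ioo (a b : ℝ) :
    MemLp ((Set.Ioo a b).indicator (1 : ℝ → ℝ)) 2 (volume.restrict (Set.Ioi 0)) := by
  refine memLp_indicator_const 2 measurableSet_Ioo (1 : ℝ) (Or.inr ?_)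
  exact ((Measure.restrict_le_self _).trans_lt (by simp)).ne

/-- Existence of a nonnegative weak solution of the one-dimensional problem. -/
theorem exists_nonneg_weak_solution (hw : IsAdapted k m₁ m₂ κ q C) (hq : 2 < q) {lam : ℝ}
    (hlam : lam * C < 1) :
    ∃ f : Lp ℝ 2 (volume.restrict (Set.Ioi (0 : ℝ))), f ≠ 0 ∧ (∀ s, 0 < s → 0 ≤ tail k f s) ∧
      ∀ g : Lp ℝ 2 (volume.restrict (Set.Ioi (0 : ℝ))),
        inner ℝ f g - lam * ∫ s in Set.Ioi 0, m₁ s * (tail k f s * tail k g s) =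
          ∫ s in Set.Ioi 0, m₂ s * (|tail k f s| ^ (q - 2) * tail k f s * tail k g s) := by
  have : Fact ((2 : ENNReal) ≠ ⊤) := ⟨by simp⟩
  set H := Lp ℝ 2 (volume.restrict (Set.Ioi (0 : ℝ))) with hH
  set B : H →L[ℝ] H →L[ℝ] ℝ := innerSL ℝ - lam •
    (innerSL ℝ).bilinearComp (hardyOp hw) (hardyOp hw) with hB
  have hBapp : ∀ f g : H, B f g = inner ℝ f g - lam * inner ℝ (hardyOp hw f) (hardyOp hw g) := by
    intro f g; rfl
  have hop : ∀ f : H, ‖hardyOp hw f‖ ^ 2 ≤ C * ‖f‖ ^ 2 := by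
    intro f
    rw [← real_inner_self_eq_norm_sq, inner_hardyOp]
    have h1 := (hw.hardy f (Lp.memLp f)).2
    rw [← norm_toLp_sq (Lp.memLp f), Lp.toLp_coeFn] at h1
    simpa only [sq] using h1
  have hpow : ∀ s, 0 < s → (m₂ s ^ (1 / q)) ^ q = m₂ s := fun s hs => by
    rw [← Real.rpow_mul (hw.pos₂ s hs).le, one_div_mul_cancel (by linarith), Real.rpow_one]
  have hpow' : ∀ s, 0 < s → (m₂ s ^ (1 / q)) ^ (q - 2) * m₂ s ^ (1 / q) * m₂ s ^ (1 / q) = m₂ s :=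
    fun s hs => by
      have := Real.rpow_pos_of_pos (hw.pos₂ s hs) (1 / q)
      rw [mul_assoc, ← sq, ← Real.rpow_natCast (m₂ s ^ (1 / q)) 2, ← Real.rpow_add this]
      push_cast
      rw [sub_add_cancel, hpow s hs]
  set K : ℝ → H := fun s => m₂ s ^ (1 / q) • kernelLp hw.kernel s with hK
  have hKin : ∀ s, 0 < s → ∀ f : H, inner ℝ (K s) f = m₂ s ^ (1 / q) * tail k f s := by
    intro s hs f
    rw [hK, real_inner_smul_left, inner_kernelLp hw.kernel hs]
  have hmeas : ∀ f : H, AEStronglyMeasurable (fun s => inner ℝ (K s) f)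
      (volume.restrict (Set.Ioi 0)) := by
    intro f
    refine (ContinuousOn.aestronglyMeasurable (f := fun s => m₂ s ^ (1 / q) * tail k f s)
      ?_ measurableSet_Ioi).congr ?_
    · exact (hw.cont₂.rpow_const fun s hs => Or.inl (hw.pos₂ s hs).ne').mul
        (continuousOn_tail hw.kernel (Lp.memLp f))
    · filter_upwards [ae_restrict_mem measurableSet_Ioi] with s hs
      exact (hKin s hs f).symm
  have hKn : ∀ᵐ s ∂volume.restrict (Set.Ioi (0 : ℝ)), ‖K s‖ ≤ m₂ s ^ (1 / q) * κ s := by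
    filter_upwards [ae_restrict_mem measurableSet_Ioi] with s hs
    have := Real.rpow_pos_of_pos (hw.pos₂ s hs) (1 / q)
    rw [hK, norm_smul, Real.norm_of_nonneg this.le]
    gcongr
    refine (sq_le_sq₀ (norm_nonneg _) (hw.kappa_nonneg s hs)).1 ?_
    rw [norm_kernelLp_sq hw.kernel hs]
    exact hw.kernel_le s hs
  have hKq : Integrable (fun s => (m₂ s ^ (1 / q) * κ s) ^ q) (volume.restrict (Set.Ioi 0)) := by
    refine hw.integrable_kappa.congr_fun (fun s hs => ?_) measurableSet_Ioi
    simp only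
    rw [Real.mul_rpow (Real.rpow_nonneg (hw.pos₂ s hs).le _) (hw.kappa_nonneg s hs), hpow s hs]
  have hBs : ∀ f g : H, B f g = B g f := by
    intro f g
    rw [hBapp, hBapp, real_inner_comm, real_inner_comm (hardyOp hw f)]
  have hc : 0 < 1 - max lam 0 * C := by
    rcases le_total lam 0 with h | h
    · rw [max_eq_right h]; simp
    · rw [max_eq_left h]; linarith
  have hBc : ∀ f : H, (1 - max lam 0 * C) * ‖f‖ ^ 2 ≤ B f f := by
    intro f
    rw [hBapp, real_inner_self_eq_norm_sq, real_inner_self_eq_norm_sq]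
    have h1 := hop f
    have h2 := sq_nonneg ‖hardyOp hw f‖
    rcases le_total lam 0 with h | h
    · rw [max_eq_right h]; nlinarith
    · rw [max_eq_left h]; nlinarith
  have hne : ∃ f : H, 0 < ∫ s in Set.Ioi 0, |inner ℝ (K s) f| ^ q := by
    set φ := (memLp_indicator_Ioo 1 2).toLp _ with hφ
    refine ⟨φ, ?_⟩
    have h_int := integrable_rpow_abs_kernel hq hmeas hKn hKq φ
    rw [integral_pos_iff_support_of_nonneg (fun s => by positivity) h_int]
    have hsub : Set.Ioo (0 : ℝ) 1 ⊆ Function.support fun s => |inner ℝ (K s) φ| ^ q := by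
      intro s hs
      have h1 := tail_indicator_pos hw.kernel (one_lt_two) hs.1 hs.2.le
      have h2 := Real.rpow_pos_of_pos (hw.pos₂ s hs.1) (1 / q)
      rw [Function.mem_support, hKin s hs.1,
        tail_congr (memLp_indicator_Ioo 1 2).coeFn_toLp hs.1.le, h1.1]
      have := h1.2
      positivity
    refine lt_of_lt_of_le ?_ (measure_mono hsub)
    rw [Measure.restrict_apply measurableSet_Ioo,
      Set.inter_eq_left.2 (fun s hs => hs.1)]
    simp
  have habs : ∀ f : H, ∃ g : H, B g g ≤ B f f ∧
      ∀ᵐ s ∂volume.restrict (Set.Ioi 0), inner ℝ (K s) g = |inner ℝ (K s) f| := by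
    intro f
    obtain ⟨g, hg, hgf, hgt⟩ := exists_tail_eq_abs_tail hw.kernel (Lp.memLp f)
    have htail : ∀ s, 0 < s → tail k (hg.toLp g) s = |tail k f s| := fun s hs => by
      rw [tail_congr hg.coeFn_toLp hs.le, hgt s hs]
    refine ⟨hg.toLp g, ?_, ?_⟩
    · rw [hBapp, hBapp, inner_hardyOp, inner_hardyOp]
      have h1 : ∫ s in Set.Ioi 0, m₁ s * (tail k (hg.toLp g) s * tail k (hg.toLp g) s) =
          ∫ s in Set.Ioi 0, m₁ s * (tail k f s * tail k f s) :=
        setIntegral_congr_fun measurableSet_Ioi fun s hs => by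
          simp only [htail s hs, abs_mul_abs_self]
      rw [h1, real_inner_self_eq_norm_sq, real_inner_self_eq_norm_sq]
      have h2 : ‖hg.toLp g‖ ≤ ‖f‖ := by
        refine Lp.norm_le_norm_of_ae_le ?_
        filter_upwards [hgf, hg.coeFn_toLp] with s hs hs'
        rw [hs']; exact hs
      have := pow_le_pow_left₀ (norm_nonneg _) h2 2
      linarith
    · filter_upwards [ae_restrict_mem measurableSet_Ioi] with s hs
      have hm := Real.rpow_pos_of_pos (hw.pos₂ s hs) (1 / q)
      rw [hKin s hs, hKin s hs, htail s hs, abs_mul, abs_of_pos hm]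
  obtain ⟨f, hf0, hfn, hfe⟩ :=
    exists_nonneg_critical_point hq hmeas hKn hKq B hBs hc hBc hne habs
  refine ⟨f, hf0, ?_, fun g => ?_⟩
  · have hcont := continuousOn_tail hw.kernel (Lp.memLp f)
    have hae : tail k f =ᵐ[volume.restrict (Set.Ioi 0)] fun s => |tail k f s| := by
      filter_upwards [hfn, ae_restrict_mem measurableSet_Ioi] with s hs hs0
      rw [hKin s hs0] at hs
      exact (abs_of_nonneg ((mul_nonneg_iff_of_pos_left
        (Real.rpow_pos_of_pos (hw.pos₂ s hs0) _)).1 hs)).symm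
    have heq := Measure.eqOn_open_of_ae_eq hae isOpen_Ioi hcont hcont.abs
    intro s hs
    have := heq hs
    rw [this]; positivity
  · have h1 := hfe g
    rw [hBapp, inner_hardyOp] at h1
    rw [h1]
    refine setIntegral_congr_fun measurableSet_Ioi fun s hs => ?_
    have hm := Real.rpow_pos_of_pos (hw.pos₂ s hs) (1 / q)
    rw [hKin s hs, hKin s hs, abs_mul, abs_of_pos hm, Real.mul_rpow hm.le (abs_nonneg _)]
    conv_rhs => rw [← hpow' s hs]
    ring

end HalfLine

namespace HalfLine

variable {k m₁ m₂ κ f g : ℝ → ℝ} {q C lam : ℝ}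

/-- A continuous density tested against tail integrals: `∫ M · tail k g = ∫ g k ∫_0^t M`. -/
theorem integral_mul_tail_eq (hk : IsTailKernel k) {M : ℝ → ℝ}
    (hM : ∀ t, 0 < t → IntegrableOn M (Set.Ioo 0 t))
    (hg : Continuous g) (hgc : HasCompactSupport g) (hgs : tsupport g ⊆ Set.Ioi 0) :
    ∫ s in Set.Ioi 0, M s * tail k g s = ∫ t in Set.Ioi 0, g t * (k t * ∫ s in Set.Ioo 0 t, M s) := by
  obtain ⟨b, hb⟩ := hgc.isCompact.bddAbove
  set b' := max b 1
  have hb' : 0 < b' := lt_of_lt_of_le one_pos (le_max_right _ _)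
  have hg0 : ∀ t, b' < t → g t = 0 := fun t ht => by
    by_contra h
    exact absurd (hb (subset_tsupport g h)) (not_le.2 ((le_max_left _ _).trans_lt ht))
  have hkg : IntegrableOn (fun t => k t * g t) (Set.Ioi 0) := by
    have h1 : ContinuousOn (fun t => k t * g t) (tsupport g) :=
      (hk.cont.mono hgs).mul hg.continuousOn
    have h2 : IntegrableOn (fun t => k t * g t) (tsupport g) :=
      h1.integrableOn_compact hgc.isCompact
    refine ((integrableOn_iff_integrable_of_support_subset ?_).1 h2).integrableOn
    intro t ht
    exact subset_tsupport g (right_ne_zero_of_mul ht)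
  have hMi : IntegrableOn ((Set.Ioo 0 (b' + 1)).indicator M) (Set.Ioi 0) :=
    ((integrable_indicator_iff measurableSet_Ioo).2 (hM _ (by linarith))).integrableOn
  have hprod := hMi.mul_prod hkg
  have hS : MeasurableSet {p : ℝ × ℝ | p.1 < p.2} := measurableSet_lt measurable_fst measurable_snd
  have hswap := integral_integral_swap (f := fun s t => {p : ℝ × ℝ | p.1 < p.2}.indicator
    (fun z => (Set.Ioo 0 (b' + 1)).indicator M z.1 * (k z.2 * g z.2)) (s, t)) (hprod.indicator hS)
  calc ∫ s in Set.Ioi 0, M s * tail k g s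
      = ∫ s in Set.Ioi 0, ∫ t in Set.Ioi 0, {p : ℝ × ℝ | p.1 < p.2}.indicator
          (fun z => (Set.Ioo 0 (b' + 1)).indicator M z.1 * (k z.2 * g z.2)) (s, t) := by
        refine setIntegral_congr_fun measurableSet_Ioi fun s hs => ?_
        have h1 : ∀ t, {p : ℝ × ℝ | p.1 < p.2}.indicator
            (fun z => (Set.Ioo 0 (b' + 1)).indicator M z.1 * (k z.2 * g z.2)) (s, t) =
            (Set.Ioi s).indicator (fun t => M s * (k t * g t)) t := by
          intro t
          by_cases hst : s < t
          · by_cases hsb : s < b' + 1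
            · simp [Set.indicator, hst, hsb, Set.mem_Ioi.1 hs]
            · simp [Set.indicator, hg0 t (by linarith)]
          · simp [Set.indicator, hst]
        simp only [h1]
        rw [integral_indicator measurableSet_Ioi, Measure.restrict_restrict measurableSet_Ioi,
          Set.inter_eq_left.2 (Set.Ioi_subset_Ioi (le_of_lt hs)), integral_const_mul]
        rfl
    _ = ∫ t in Set.Ioi 0, ∫ s in Set.Ioi 0, {p : ℝ × ℝ | p.1 < p.2}.indicator
          (fun z => (Set.Ioo 0 (b' + 1)).indicator M z.1 * (k z.2 * g z.2)) (s, t) := hswap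
    _ = _ := by
        refine setIntegral_congr_fun measurableSet_Ioi fun t ht => ?_
        have h1 : ∀ s ∈ Set.Ioi (0 : ℝ), {p : ℝ × ℝ | p.1 < p.2}.indicator
            (fun z => (Set.Ioo 0 (b' + 1)).indicator M z.1 * (k z.2 * g z.2)) (s, t) =
            (Set.Ioo 0 t).indicator (fun s => M s * (k t * g t)) s := by
          intro s hs
          by_cases hst : s < t
          · by_cases hsb : s < b' + 1
            · simp [Set.indicator, hst, hsb, Set.mem_Ioi.1 hs]
            · simp [Set.indicator, hg0 t (by linarith)]
          · simp [Set.indicator, hst]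
        rw [setIntegral_congr_fun measurableSet_Ioi h1, integral_indicator measurableSet_Ioo,
          Measure.restrict_restrict measurableSet_Ioo,
          Set.inter_eq_left.2 (fun s hs => hs.1), integral_mul_const]
        ring

theorem memLp_of_continuous_compact (hg : Continuous g) (hgc : HasCompactSupport g) :
    MemLp g 2 (volume.restrict (Set.Ioi 0)) :=
  (hg.memLp_of_hasCompactSupport hgc).restrict _

/-- A nonnegative solution of `U' = -a P`, `P' = b U` on `(0, ∞)` that vanishes somewhere vanishes
identically. -/
theorem eqOn_zero_of_linear_ode {U P a b : ℝ → ℝ} (ha : ContinuousOn a (Set.Ioi 0))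
    (ha0 : ∀ s, 0 < s → a s ≠ 0)
    (hb : ContinuousOn b (Set.Ioi 0)) (hU : ∀ s, 0 < s → HasDerivAt U (-(a s * P s)) s)
    (hP : ∀ s, 0 < s → HasDerivAt P (b s * U s) s) (hU0 : ∀ s, 0 < s → 0 ≤ U s)
    {s₀ : ℝ} (hs₀ : 0 < s₀) (hUs₀ : U s₀ = 0) : ∀ s, 0 < s → U s = 0 := by
  intro s hs
  have hP0 : P s₀ = 0 := by
    have hmin : IsLocalMin U s₀ := by
      filter_upwards [Ioi_mem_nhds hs₀] with t ht
      rw [hUs₀]; exact hU0 t ht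
    have := hmin.hasDerivAt_eq_zero (hU s₀ hs₀)
    rw [neg_eq_zero, mul_eq_zero] at this
    exact this.resolve_left (ha0 s₀ hs₀)
  set l := min s s₀ / 2
  set r := max s s₀ + 1
  have hl : 0 < l := half_pos (lt_min hs hs₀)
  have hl' : l < min s s₀ := half_lt_self (lt_min hs hs₀)
  have hsub : Set.Icc l r ⊆ Set.Ioi 0 := fun t ht => hl.trans_le ht.1
  obtain ⟨A, hA⟩ := isCompact_Icc.exists_bound_of_continuousOn (ha.mono hsub)
  obtain ⟨D, hD⟩ := isCompact_Icc.exists_bound_of_continuousOn (hb.mono hsub)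
  have huniq := ODE_solution_unique_of_mem_Ioo (E := ℝ × ℝ) (a := l) (b := r) (t₀ := s₀)
    (v := fun t x => (-(a t * x.2), b t * x.1)) (K := Real.toNNReal (max A D))
    (s := fun _ => Set.univ) (f := fun t => (U t, P t)) (g := fun _ => 0) ?_ ?_ ?_ ?_ ?_
  · have := huniq ⟨hl'.trans_le (min_le_left _ _), (le_max_left s s₀).trans_lt (lt_add_one _)⟩
    exact congrArg Prod.fst this
  · intro t ht
    have ht' := Set.Ioo_subset_Icc_self ht
    have h1 := hA t ht'
    have h2 := hD t ht'
    refine LipschitzOnWith.of_dist_le_mul fun x _ y _ => ?_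
    rw [Real.coe_toNNReal _ ((norm_nonneg _).trans (h1.trans (le_max_left _ _))), Prod.dist_eq,
      Prod.dist_eq]
    have e1 : dist (-(a t * x.2)) (-(a t * y.2)) = ‖a t‖ * dist x.2 y.2 := by
      rw [dist_neg_neg, Real.dist_eq, Real.dist_eq, ← mul_sub, abs_mul, Real.norm_eq_abs]
    have e2 : dist (b t * x.1) (b t * y.1) = ‖b t‖ * dist x.1 y.1 := by
      rw [Real.dist_eq, Real.dist_eq, ← mul_sub, abs_mul, Real.norm_eq_abs]
    refine max_le ?_ ?_
    · rw [e1]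
      exact mul_le_mul (h1.trans (le_max_left _ _)) (le_max_right _ _) dist_nonneg
        ((norm_nonneg _).trans (h1.trans (le_max_left _ _)))
    · rw [e2]
      exact mul_le_mul (h2.trans (le_max_right _ _)) (le_max_left _ _) dist_nonneg
        ((norm_nonneg _).trans (h1.trans (le_max_left _ _)))
  · exact ⟨hl'.trans_le (min_le_right _ _), (le_max_right s s₀).trans_lt (lt_add_one _)⟩
  · intro t ht
    have ht0 := hsub (Set.Ioo_subset_Icc_self ht)
    exact ⟨(hU t ht0).prodMk (hP t ht0), trivial⟩
  · intro t ht
    refine ⟨?_, trivial⟩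
    exact (hasDerivAt_const t (0 : ℝ × ℝ)).congr_deriv (by ext <;> simp)
  · simp [hUs₀, hP0]

/-- Existence of a positive solution of the one-dimensional problem. -/
theorem exists_pos_weak_solution (hw : IsAdapted k m₁ m₂ κ q C) (hq : 2 < q)
    (hlam : lam * C < 1) :
    ∃ f : ℝ → ℝ, Measurable f ∧ MemLp f 2 (volume.restrict (Set.Ioi 0)) ∧
      (∀ s, 0 < s → 0 < tail k f s) ∧
      ∀ g, MemLp g 2 (volume.restrict (Set.Ioi 0)) →
        ∫ s in Set.Ioi 0, f s * g s =
          lam * (∫ s in Set.Ioi 0, m₁ s * (tail k f s * tail k g s)) +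
          ∫ s in Set.Ioi 0, m₂ s * (|tail k f s| ^ (q - 2) * tail k f s * tail k g s) := by
  obtain ⟨F, hF0, hFn, hFe⟩ := exists_nonneg_weak_solution hw hq hlam
  have hf := Lp.memLp F
  have hweak : ∀ g, MemLp g 2 (volume.restrict (Set.Ioi 0)) →
        ∫ s in Set.Ioi 0, F s * g s =
          lam * (∫ s in Set.Ioi 0, m₁ s * (tail k F s * tail k g s)) +
          ∫ s in Set.Ioi 0, m₂ s * (|tail k F s| ^ (q - 2) * tail k F s * tail k g s) := by
    intro g hg
    have h1 := hFe (hg.toLp g)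
    have h2 : inner ℝ F (hg.toLp g) = ∫ s in Set.Ioi 0, F s * g s := by
      conv_lhs => rw [← Lp.toLp_coeFn F hf]
      exact inner_toLp hf hg
    have h3 : ∀ s ∈ Set.Ioi (0 : ℝ), tail k (hg.toLp g) s = tail k g s := fun s hs =>
      tail_congr hg.coeFn_toLp (le_of_lt hs)
    rw [h2, setIntegral_congr_fun (μ := volume) measurableSet_Ioi
        (f := fun s => m₁ s * (tail k F s * tail k (hg.toLp g) s))
        (g := fun s => m₁ s * (tail k F s * tail k g s)) (fun s hs => by simp only [h3 s hs]),
      setIntegral_congr_fun (μ := volume) measurableSet_Ioi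
        (f := fun s => m₂ s * (|tail k F s| ^ (q - 2) * tail k F s * tail k (hg.toLp g) s))
        (g := fun s => m₂ s * (|tail k F s| ^ (q - 2) * tail k F s * tail k g s))
        (fun s hs => by simp only [h3 s hs])] at h1
    linarith
  refine ⟨F, (Lp.stronglyMeasurable F).measurable, hf, ?_, hweak⟩
  set U := tail k F with hU
  have hUc : ContinuousOn U (Set.Ioi 0) := continuousOn_tail hw.kernel hf
  set V : ℝ → ℝ := fun s => lam * m₁ s + m₂ s * |U s| ^ (q - 2) with hV
  have hVc : ContinuousOn V (Set.Ioi 0) :=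
    (continuousOn_const.mul hw.cont₁).add
      (hw.cont₂.mul (hUc.abs.rpow_const fun _ _ => Or.inr (by linarith)))
  set M : ℝ → ℝ := fun s => V s * U s with hM
  have hMc : ContinuousOn M (Set.Ioi 0) := hVc.mul hUc
  have hMg : ∀ g, MemLp g 2 (volume.restrict (Set.Ioi 0)) →
      IntegrableOn (fun s => M s * tail k g s) (Set.Ioi 0) ∧
      ∫ s in Set.Ioi 0, F s * g s = ∫ s in Set.Ioi 0, M s * tail k g s := by
    intro g hg
    have i1 := (integrableOn_hardy_mul hw hf hg).const_mul lam
    have i2 := integrableOn_rpow_mul hw hq hf hg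
    have e : (fun s => M s * tail k g s) = fun s => lam * (m₁ s * (tail k F s * tail k g s)) +
        m₂ s * (|tail k F s| ^ (q - 2) * tail k F s * tail k g s) := by
      ext s; simp only [hM, hV, hU]; ring
    rw [e]
    refine ⟨i1.add i2, ?_⟩
    rw [hweak g hg, integral_add i1 i2, integral_const_mul]
  have hMi : ∀ t, 0 < t → IntegrableOn M (Set.Ioo 0 t) := by
    intro t ht
    have h1 := ((hMg _ (memLp_indicator_Ioo t (t + 1))).1).mono_set
      (Set.Ioo_subset_Ioi_self : Set.Ioo 0 t ⊆ Set.Ioi 0)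
    set c := ∫ y in Set.Ioo t (t + 1), k y with hc
    have hc0 : c ≠ 0 := (tail_indicator_pos hw.kernel (lt_add_one t) ht le_rfl).2.ne'
    have h2 : IntegrableOn (fun s => M s * c) (Set.Ioo 0 t) :=
      h1.congr_fun (fun s hs => by
        simp only [(tail_indicator_pos hw.kernel (lt_add_one t) hs.1 hs.2.le).1, hc])
        measurableSet_Ioo
    have h3 := Integrable.mul_const h2 c⁻¹
    refine h3.congr (Eventually.of_forall fun s => ?_)
    simp only; field_simp
  set P : ℝ → ℝ := fun t => ∫ s in (0 : ℝ)..t, M s with hP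
  have hMii : ∀ t, 0 < t → IntervalIntegrable M volume 0 t := fun t ht =>
    (intervalIntegrable_iff_integrableOn_Ioo_of_le ht.le).2 (hMi t ht)
  have hPd : ∀ t, 0 < t → HasDerivAt P (M t) t := fun t ht =>
    intervalIntegral.integral_hasDerivAt_right (hMii t ht)
      (hMc.stronglyMeasurableAtFilter isOpen_Ioi t ht) (hMc.continuousAt (Ioi_mem_nhds ht))
  have hPc : ContinuousOn P (Set.Ioi 0) := fun t ht => (hPd t ht).continuousAt.continuousWithinAt
  have hkP : ContinuousOn (fun t => k t * P t) (Set.Ioi 0) := hw.kernel.cont.mul hPc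
  have hFloc : LocallyIntegrableOn F (Set.Ioi 0) := by
    rw [locallyIntegrableOn_iff isOpen_Ioi.isLocallyClosed]
    intro K hK1 hK2
    have : MemLp F 2 (volume.restrict K) :=
      hf.mono_measure (Measure.restrict_mono hK1 le_rfl)
    have : IsFiniteMeasure (volume.restrict K) := ⟨by simpa using hK2.measure_lt_top⟩
    exact MemLp.integrable one_le_two ‹_›
  have hae : ∀ᵐ t, t ∈ Set.Ioi (0 : ℝ) → F t - k t * P t = 0 := by
    refine isOpen_Ioi.ae_eq_zero_of_integral_contDiff_smul_eq_zero
      (hFloc.sub (hkP.locallyIntegrableOn measurableSet_Ioi)) ?_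
    intro g hg hgc hgs
    have hgm := memLp_of_continuous_compact hg.continuous hgc
    have h1 := (hMg g hgm).2
    rw [integral_mul_tail_eq hw.kernel hMi hg.continuous hgc hgs] at h1
    have h2 : ∫ t in Set.Ioi 0, g t * (k t * ∫ s in Set.Ioo 0 t, M s) =
        ∫ t in Set.Ioi 0, g t * (k t * P t) := by
      refine setIntegral_congr_fun measurableSet_Ioi fun t ht => ?_
      simp only [hP]
      rw [intervalIntegral.integral_of_le (le_of_lt ht), integral_Ioc_eq_integral_Ioo]
    rw [h2] at h1
    have h3 : ∀ G : ℝ → ℝ, ∫ t in Set.Ioi 0, g t * G t = ∫ t, g t * G t := fun G =>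
      setIntegral_eq_integral_of_forall_compl_eq_zero fun t ht => by
        rw [image_eq_zero_of_notMem_tsupport (fun h => ht (hgs h)), zero_mul]
    have h4 : ∫ t in Set.Ioi 0, F t * g t = ∫ t, g t * F t := by
      rw [← h3]; congr 1; ext t; ring
    rw [h4, h3] at h1
    have hcsupp : ∀ G : ℝ → ℝ, LocallyIntegrableOn G (Set.Ioi 0) →
        Integrable (fun t => g t * G t) := by
      intro G hG
      have h5 : IntegrableOn G (tsupport g) := hG.integrableOn_compact_subset hgs hgc.isCompact
      have h6 : IntegrableOn (fun t => g t * G t) (tsupport g) :=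
        h5.continuousOn_mul hg.continuous.continuousOn hgc.isCompact
      refine (integrableOn_iff_integrable_of_support_subset ?_).1 h6
      intro t ht
      exact subset_tsupport g (left_ne_zero_of_mul ht)
    simp only [smul_eq_mul, mul_sub]
    rw [integral_sub (hcsupp _ hFloc)
      (hcsupp (fun t => k t * P t) (hkP.locallyIntegrableOn measurableSet_Ioi)), h1, sub_self]
  have hUint : ∀ a b, 0 < a → 0 < b → U a - U b = ∫ t in a..b, k t ^ 2 * P t := by
    intro a b ha hb
    rw [hU, tail_sub_tail hw.kernel hf ha hb]
    refine intervalIntegral.integral_congr_ae ?_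
    filter_upwards [hae] with t ht ht'
    have : 0 < t := (lt_min ha hb).trans ht'.1
    have := ht this
    rw [sub_eq_zero.1 this]; ring
  have hk2P : ContinuousOn (fun t => k t ^ 2 * P t) (Set.Ioi 0) := (hw.kernel.cont.pow 2).mul hPc
  have hUd : ∀ s, 0 < s → HasDerivAt U (-(k s ^ 2 * P s)) s := by
    intro s hs
    have h1 : HasDerivAt (fun x => ∫ t in s..x, k t ^ 2 * P t) (k s ^ 2 * P s) s :=
      intervalIntegral.integral_hasDerivAt_right (by simp)
        (hk2P.stronglyMeasurableAtFilter isOpen_Ioi s hs) (hk2P.continuousAt (Ioi_mem_nhds hs))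
    refine (h1.const_sub (U s)).congr_of_eventuallyEq ?_
    filter_upwards [Ioi_mem_nhds hs] with x hx
    rw [← hUint s x hs hx]; ring
  intro s₀ hs₀
  by_contra hcon
  have hz : U s₀ = 0 := le_antisymm (not_lt.1 hcon) (hFn s₀ hs₀)
  have hUz := eqOn_zero_of_linear_ode (a := fun s => k s ^ 2) (hw.kernel.cont.pow 2)
    (fun s hs => pow_ne_zero 2 (hw.kernel.pos s hs).ne') hVc hUd hPd hFn hs₀ hz
  apply hF0
  have h1 : inner ℝ F F = 0 := by
    have h := hFe F
    rw [setIntegral_congr_fun (g := fun _ => (0 : ℝ)) measurableSet_Ioi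
        (fun s hs => by simp only [hUz s hs]; simp),
      setIntegral_congr_fun (μ := volume) (g := fun _ => (0 : ℝ))
        (f := fun s => m₂ s * (|tail k F s| ^ (q - 2) * tail k F s * tail k F s)) measurableSet_Ioi
        (fun s hs => by simp only [← hU, hUz s hs]; simp)] at h
    simpa using h
  exact inner_self_eq_zero.1 h1

end HalfLine

/-- The Cauchy–Schwarz inequality for the lower Lebesgue integral. -/
theorem lintegral_mul_sq_le {X : Type*} [MeasurableSpace X] (μ : Measure X) {a b : X → ENNReal}
    (ha : AEMeasurable a μ) (hb : AEMeasurable b μ) :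
    (∫⁻ x, a x * b x ∂μ) ^ 2 ≤ (∫⁻ x, a x ^ 2 ∂μ) * ∫⁻ x, b x ^ 2 ∂μ := by
  have h := ENNReal.lintegral_mul_le_Lp_mul_Lq μ Real.HolderConjugate.two_two ha hb
  simp only [Pi.mul_apply, ENNReal.rpow_two] at h
  calc (∫⁻ x, a x * b x ∂μ) ^ 2
      ≤ ((∫⁻ x, a x ^ 2 ∂μ) ^ (1 / 2 : ℝ) * (∫⁻ x, b x ^ 2 ∂μ) ^ (1 / 2 : ℝ)) ^ 2 := by gcongr
    _ = _ := by
      rw [mul_pow, ← ENNReal.rpow_natCast, ← ENNReal.rpow_natCast, ← ENNReal.rpow_mul,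
        ← ENNReal.rpow_mul]
      norm_num

namespace HalfLine

theorem lintegral_Ioi_mul_lintegral_Ioi {A B : ℝ → ENNReal}
    (hA : AEMeasurable A (volume.restrict (Set.Ioi 0)))
    (hB : AEMeasurable B (volume.restrict (Set.Ioi 0))) :
    ∫⁻ s in Set.Ioi 0, A s * ∫⁻ t in Set.Ioi s, B t =
      ∫⁻ t in Set.Ioi 0, B t * ∫⁻ s in Set.Ioo 0 t, A s := by
  have hS : MeasurableSet {p : ℝ × ℝ | p.1 < p.2} := measurableSet_lt measurable_fst measurable_snd
  have hm : AEMeasurable (Function.uncurry fun s t : ℝ => {p : ℝ × ℝ | p.1 < p.2}.indicator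
      (fun p => A p.1 * B p.2) (s, t))
      ((volume.restrict (Set.Ioi 0)).prod (volume.restrict (Set.Ioi 0))) :=
    (hA.comp_fst.mul hB.comp_snd).indicator hS
  calc ∫⁻ s in Set.Ioi 0, A s * ∫⁻ t in Set.Ioi s, B t
      = ∫⁻ s in Set.Ioi 0, ∫⁻ t in Set.Ioi 0, {p : ℝ × ℝ | p.1 < p.2}.indicator
          (fun p => A p.1 * B p.2) (s, t) := by
        refine setLIntegral_congr_fun measurableSet_Ioi fun s hs => ?_
        have h1 : ∀ t, {p : ℝ × ℝ | p.1 < p.2}.indicator (fun p => A p.1 * B p.2) (s, t) =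
            (Set.Ioi s).indicator (fun t => A s * B t) t := fun t => by
          simp [Set.indicator]
        simp only [h1]
        rw [lintegral_indicator measurableSet_Ioi, Measure.restrict_restrict measurableSet_Ioi,
          Set.inter_eq_left.2 (Set.Ioi_subset_Ioi (le_of_lt hs)), lintegral_const_mul'']
        exact hB.mono_set (Set.Ioi_subset_Ioi (le_of_lt hs))
    _ = ∫⁻ t in Set.Ioi 0, ∫⁻ s in Set.Ioi 0, {p : ℝ × ℝ | p.1 < p.2}.indicator
          (fun p => A p.1 * B p.2) (s, t) := lintegral_lintegral_swap hm
    _ = _ := by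
        refine setLIntegral_congr_fun measurableSet_Ioi fun t ht => ?_
        have h1 : ∀ s ∈ Set.Ioi (0 : ℝ), {p : ℝ × ℝ | p.1 < p.2}.indicator
            (fun p => A p.1 * B p.2) (s, t) = (Set.Ioo 0 t).indicator (fun s => B t * A s) s :=
          fun s hs => by simp [Set.indicator, Set.mem_Ioi.1 hs, mul_comm]
        rw [setLIntegral_congr_fun measurableSet_Ioi h1, lintegral_indicator measurableSet_Ioo,
          Measure.restrict_restrict measurableSet_Ioo,
          Set.inter_eq_left.2 (fun s hs => hs.1), lintegral_const_mul'']
        exact hA.mono_set (fun s hs => hs.1)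

theorem lintegral_Ioi_rpow_neg {p s : ℝ} (hp : 0 < p) (hs : 0 < s) :
    ∫⁻ t in Set.Ioi s, ENNReal.ofReal (t ^ (-p - 1)) = ENNReal.ofReal (s ^ (-p) / p) := by
  rw [← ofReal_integral_eq_lintegral_ofReal (integrableOn_Ioi_rpow_of_lt (by linarith) hs),
    integral_Ioi_rpow_of_lt (by linarith) hs]
  · congr 1
    rw [sub_add_cancel, neg_div_neg_eq]
  · filter_upwards [ae_restrict_mem measurableSet_Ioi] with t ht
    exact Real.rpow_nonneg (hs.trans ht).le _

theorem lintegral_Ioo_rpow {p t : ℝ} (hp : 0 < p) (ht : 0 < t) :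
    ∫⁻ s in Set.Ioo 0 t, ENNReal.ofReal (s ^ (p - 1)) = ENNReal.ofReal (t ^ p / p) := by
  have hi : IntervalIntegrable (fun s : ℝ => s ^ (p - 1)) volume 0 t :=
    intervalIntegral.intervalIntegrable_rpow' (by linarith)
  rw [← ofReal_integral_eq_lintegral_ofReal
    ((intervalIntegrable_iff_integrableOn_Ioo_of_le ht.le).1 hi), ← integral_Ioc_eq_integral_Ioo,
    ← intervalIntegral.integral_of_le ht.le, integral_rpow (Or.inl (by linarith))]
  · congr 1
    rw [sub_add_cancel, Real.zero_rpow hp.ne', sub_zero]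
  · filter_upwards [ae_restrict_mem measurableSet_Ioo] with s hs
    exact Real.rpow_nonneg hs.1.le _

theorem sinh_div_self_mono {s t : ℝ} (hs : 0 < s) (hst : s ≤ t) :
    Real.sinh s / s ≤ Real.sinh t / t := by
  have hconv : ConvexOn ℝ (Set.Ici 0) Real.sinh := by
    refine MonotoneOn.convexOn_of_deriv (convex_Ici 0) Real.continuous_sinh.continuousOn
      Real.differentiable_sinh.differentiableOn ?_
    rw [interior_Ici, Real.deriv_sinh]
    intro x hx y hy hxy
    exact Real.cosh_le_cosh.2 (by rwa [abs_of_pos hx, abs_of_pos hy])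
  have := hconv.secant_mono (a := 0) (x := s) (y := t) (by simp) (le_of_lt hs)
    (hs.le.trans hst) hs.ne' (hs.trans_le hst).ne' hst
  simpa using this

theorem exp_half_div_four_le_sinh_div_self {s : ℝ} (hs : 0 < s) :
    Real.exp (s / 2) / 4 ≤ Real.sinh s / s := by
  rw [le_div_iff₀ hs, Real.sinh_eq]
  have h1 : Real.exp s = Real.exp (s / 2) * Real.exp (s / 2) := by rw [← Real.exp_add]; ring_nf
  have h3 := Real.add_one_le_exp (s / 2)
  have h5 := Real.add_one_le_exp (2 * s)
  have h6 : Real.exp (-s) = Real.exp s * (Real.exp (2 * s))⁻¹ := by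
    rw [← Real.exp_neg, ← Real.exp_add]; ring_nf
  have h7 : (Real.exp (2 * s))⁻¹ ≤ (2 * s + 1)⁻¹ := inv_anti₀ (by positivity) h5
  have hE := Real.exp_pos (s / 2)
  have h8 : Real.exp (-s) ≤ Real.exp s * (2 * s + 1)⁻¹ := by rw [h6]; gcongr
  have h9 : s / 2 ≤ Real.exp (s / 2) * (1 - (2 * s + 1)⁻¹) := by
    have : 1 - (2 * s + 1)⁻¹ = 2 * s / (2 * s + 1) := by field_simp; ring
    rw [this]
    calc s / 2 ≤ (s / 2 + 1) * (2 * s / (2 * s + 1)) := by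
          rw [mul_div_assoc', le_div_iff₀ (by positivity)]; nlinarith
      _ ≤ _ := by gcongr
  have h10 : Real.exp (s / 2) * (s / 2) ≤
      Real.exp (s / 2) * (Real.exp (s / 2) * (1 - (2 * s + 1)⁻¹)) := by gcongr
  have h11 : Real.exp (s / 2) * (Real.exp (s / 2) * (1 - (2 * s + 1)⁻¹)) =
      Real.exp s - Real.exp s * (2 * s + 1)⁻¹ := by rw [h1]; ring
  linarith

section Weights

variable {n : ℕ} {α β q : ℝ}

/-- `(s^α sinh^n s)^{-1/2}`. -/
noncomputable def hypKernel (n : ℕ) (α s : ℝ) : ℝ := (√(s ^ α * Real.sinh s ^ n))⁻¹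

/-- `s^p sinh^n s`. -/
noncomputable def hypWeight (n : ℕ) (p s : ℝ) : ℝ := s ^ p * Real.sinh s ^ n

theorem hypWeight_pos (n : ℕ) (p : ℝ) {s : ℝ} (hs : 0 < s) : 0 < hypWeight n p s :=
  mul_pos (Real.rpow_pos_of_pos hs _) (pow_pos (Real.sinh_pos_iff.2 hs) _)

theorem continuousOn_hypWeight (n : ℕ) (p : ℝ) : ContinuousOn (hypWeight n p) (Set.Ioi 0) :=
  (continuousOn_id.rpow_const fun _ hs => Or.inl (ne_of_gt hs)).mul
    (Real.continuous_sinh.pow n).continuousOn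

theorem hypKernel_pos (n : ℕ) (α : ℝ) {s : ℝ} (hs : 0 < s) : 0 < hypKernel n α s :=
  inv_pos.2 (Real.sqrt_pos.2 (hypWeight_pos n α hs))

theorem hypKernel_sq (n : ℕ) (α : ℝ) {s : ℝ} (hs : 0 < s) :
    hypKernel n α s ^ 2 = (hypWeight n α s)⁻¹ := by
  have h := (hypWeight_pos n α hs).le
  rw [hypWeight] at h ⊢
  rw [hypKernel, inv_pow, Real.sq_sqrt h]

theorem continuousOn_hypKernel (n : ℕ) (α : ℝ) : ContinuousOn (hypKernel n α) (Set.Ioi 0) :=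
  (continuousOn_hypWeight n α).sqrt.inv₀ fun _ hs => (Real.sqrt_pos.2 (hypWeight_pos n α hs)).ne'

theorem hypWeight_eq (n : ℕ) (p : ℝ) {s : ℝ} (hs : 0 < s) :
    hypWeight n p s = s ^ (p + n) * (Real.sinh s / s) ^ n := by
  rw [hypWeight, Real.rpow_add hs, Real.rpow_natCast, div_pow]
  have : s ^ n ≠ 0 := (pow_pos hs n).ne'
  field_simp

theorem sinh_div_self_pos {s : ℝ} (hs : 0 < s) : 0 < Real.sinh s / s :=
  div_pos (Real.sinh_pos_iff.2 hs) hs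

theorem hypKernel_sq_le (n : ℕ) (α : ℝ) {s t : ℝ} (hs : 0 < s) (hst : s ≤ t) :
    hypKernel n α t ^ 2 ≤ ((Real.sinh s / s) ^ n)⁻¹ * t ^ (-(n - 1 + α) - 1) := by
  have ht := hs.trans_le hst
  rw [hypKernel_sq n α ht, hypWeight_eq n α ht, mul_inv, mul_comm,
    show -((n : ℝ) - 1 + α) - 1 = -(α + n) by ring, Real.rpow_neg ht.le]
  have h1 := sinh_div_self_pos hs
  have h2 := Real.rpow_pos_of_pos ht (α + n)
  gcongr ?_ * _
  exact inv_anti₀ (pow_pos h1 n) (pow_le_pow_left₀ h1.le (sinh_div_self_mono hs hst) n)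

theorem isTailKernel_hypKernel (hγ : 0 < (n : ℝ) - 1 + α) : IsTailKernel (hypKernel n α) where
  cont := continuousOn_hypKernel n α
  pos _ hs := hypKernel_pos n α hs
  sq_int s hs := by
    refine ((integrableOn_Ioi_rpow_of_lt (a := -((n : ℝ) - 1 + α) - 1) (by linarith)
      hs).const_mul ((Real.sinh s / s) ^ n)⁻¹).mono' ?_ ?_
    · exact (((continuousOn_hypKernel n α).pow 2).mono
        (Set.Ioi_subset_Ioi hs.le)).aestronglyMeasurable measurableSet_Ioi
    · filter_upwards [ae_restrict_mem measurableSet_Ioi] with t ht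
      rw [Real.norm_of_nonneg (by positivity)]
      exact hypKernel_sq_le n α hs (le_of_lt ht)

theorem integral_hypKernel_sq_le (hγ : 0 < (n : ℝ) - 1 + α) {s : ℝ} (hs : 0 < s) :
    ∫ t in Set.Ioi s, hypKernel n α t ^ 2 ≤
      ((Real.sinh s / s) ^ n)⁻¹ * (s ^ (-((n : ℝ) - 1 + α)) / ((n : ℝ) - 1 + α)) := by
  have hi := integrableOn_Ioi_rpow_of_lt (a := -((n : ℝ) - 1 + α) - 1) (by linarith) hs
  calc ∫ t in Set.Ioi s, hypKernel n α t ^ 2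
      ≤ ∫ t in Set.Ioi s, ((Real.sinh s / s) ^ n)⁻¹ * t ^ (-((n : ℝ) - 1 + α) - 1) :=
        setIntegral_mono_on ((isTailKernel_hypKernel hγ).sq_int s hs) (hi.const_mul _)
          measurableSet_Ioi fun t ht => hypKernel_sq_le n α hs (le_of_lt ht)
    _ = _ := by
        rw [integral_const_mul, integral_Ioi_rpow_of_lt (by linarith) hs, sub_add_cancel,
          neg_div_neg_eq]

/-- The sharp Hardy inequality for the hyperbolic weights, in `L²` form. -/
theorem lintegral_hardy (hγ : 0 < (n : ℝ) - 1 + α) {f : ℝ → ℝ}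
    (hf : AEStronglyMeasurable f (volume.restrict (Set.Ioi 0))) :
    ∫⁻ s in Set.Ioi 0, ENNReal.ofReal (hypWeight n (α - 2) s * tail (hypKernel n α) f s ^ 2) ≤
      ENNReal.ofReal ((2 / ((n : ℝ) - 1 + α)) ^ 2) *
        ∫⁻ s in Set.Ioi 0, ENNReal.ofReal (f s ^ 2) := by
  set γ := (n : ℝ) - 1 + α with hγd
  set k := hypKernel n α
  have hkc : ContinuousOn k (Set.Ioi 0) := continuousOn_hypKernel n α
  set F : ℝ → ENNReal := fun t => ENNReal.ofReal (f t ^ 2) with hF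
  have hFm : AEMeasurable F (volume.restrict (Set.Ioi 0)) :=
    (hf.aemeasurable.pow_const 2).ennreal_ofReal
  have hrp : ∀ p : ℝ, Measurable fun t : ℝ => ENNReal.ofReal (t ^ p) := fun p =>
    (measurable_id.pow_const p).ennreal_ofReal
  have hstep : ∀ s ∈ Set.Ioi (0 : ℝ), ENNReal.ofReal (hypWeight n (α - 2) s * tail k f s ^ 2) ≤
      ENNReal.ofReal (2 / γ) * (ENNReal.ofReal (s ^ (γ / 2 - 1)) *
        ∫⁻ t in Set.Ioi s, ENNReal.ofReal (t ^ (-(γ / 2))) * F t) := by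
    intro s hs
    replace hs : 0 < s := hs
    have hsub : Set.Ioi s ⊆ Set.Ioi 0 := Set.Ioi_subset_Ioi hs.le
    have hσ := pow_pos (sinh_div_self_pos hs) n
    have h1 : ENNReal.ofReal (tail k f s ^ 2) ≤
        (∫⁻ t in Set.Ioi s, ENNReal.ofReal (t ^ (-(γ / 2))) * F t) *
          ∫⁻ t in Set.Ioi s, ENNReal.ofReal (t ^ (γ / 2)) * ENNReal.ofReal (k t ^ 2) := by
      have e1 : ENNReal.ofReal (tail k f s ^ 2) = ‖tail k f s‖ₑ ^ 2 := by
        rw [← sq_abs, ENNReal.ofReal_pow (abs_nonneg _), ← Real.enorm_eq_ofReal_abs]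
      have e2 : ‖tail k f s‖ₑ ≤ ∫⁻ t in Set.Ioi s, ‖k t * f t‖ₑ := enorm_integral_le_lintegral_enorm _
      have e3 : ∫⁻ t in Set.Ioi s, ‖k t * f t‖ₑ =
          ∫⁻ t in Set.Ioi s, (ENNReal.ofReal (t ^ (-(γ / 4))) * ‖f t‖ₑ) *
            (ENNReal.ofReal (t ^ (γ / 4)) * ‖k t‖ₑ) := by
        refine setLIntegral_congr_fun measurableSet_Ioi fun t ht => ?_
        have ht0 : 0 < t := hs.trans ht
        have : ENNReal.ofReal (t ^ (-(γ / 4))) * ENNReal.ofReal (t ^ (γ / 4)) = 1 := by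
          rw [← ENNReal.ofReal_mul (Real.rpow_nonneg ht0.le _), ← Real.rpow_add ht0]
          simp
        simp only [enorm_mul]
        calc ‖k t‖ₑ * ‖f t‖ₑ = 1 * (‖k t‖ₑ * ‖f t‖ₑ) := (one_mul _).symm
          _ = _ := by rw [← this]; ring
      have hm1 : AEMeasurable (fun t => ENNReal.ofReal (t ^ (-(γ / 4))) * ‖f t‖ₑ)
          (volume.restrict (Set.Ioi s)) :=
        (hrp _).aemeasurable.mul (hf.mono_set hsub).enorm
      have hm2 : AEMeasurable (fun t => ENNReal.ofReal (t ^ (γ / 4)) * ‖k t‖ₑ)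
          (volume.restrict (Set.Ioi s)) :=
        (hrp _).aemeasurable.mul
          ((hkc.mono hsub).aestronglyMeasurable measurableSet_Ioi).enorm
      rw [e1]
      refine (pow_le_pow_left' (e2.trans_eq e3) 2).trans
        ((lintegral_mul_sq_le _ hm1 hm2).trans (le_of_eq ?_))
      have hsq : ∀ x : ℝ, ‖x‖ₑ ^ 2 = ENNReal.ofReal (x ^ 2) := fun x => by
        rw [Real.enorm_eq_ofReal_abs, ← ENNReal.ofReal_pow (abs_nonneg _), sq_abs]
      congr 1
      · refine setLIntegral_congr_fun measurableSet_Ioi fun t ht => ?_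
        have ht0 : 0 < t := hs.trans ht
        simp only [hF]
        rw [mul_pow, hsq, ← ENNReal.ofReal_pow (Real.rpow_nonneg ht0.le _),
          ← Real.rpow_natCast, ← Real.rpow_mul ht0.le]
        congr 3; push_cast; ring
      · refine setLIntegral_congr_fun measurableSet_Ioi fun t ht => ?_
        have ht0 : 0 < t := hs.trans ht
        rw [mul_pow, hsq, ← ENNReal.ofReal_pow (Real.rpow_nonneg ht0.le _),
          ← Real.rpow_natCast, ← Real.rpow_mul ht0.le]
        congr 3; push_cast; ring
    have h2 : ∫⁻ t in Set.Ioi s, ENNReal.ofReal (t ^ (γ / 2)) * ENNReal.ofReal (k t ^ 2) ≤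
        ENNReal.ofReal (((Real.sinh s / s) ^ n)⁻¹ * (s ^ (-(γ / 2)) / (γ / 2))) := by
      rw [ENNReal.ofReal_mul (inv_nonneg.2 hσ.le), ← lintegral_Ioi_rpow_neg (half_pos hγ) hs,
        ← lintegral_const_mul _ (hrp _)]
      refine setLIntegral_mono' measurableSet_Ioi fun t ht => ?_
      have ht0 : 0 < t := hs.trans ht
      rw [← ENNReal.ofReal_mul (Real.rpow_nonneg ht0.le _),
        ← ENNReal.ofReal_mul (inv_nonneg.2 hσ.le)]
      refine ENNReal.ofReal_le_ofReal ?_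
      calc t ^ (γ / 2) * k t ^ 2
          ≤ t ^ (γ / 2) * (((Real.sinh s / s) ^ n)⁻¹ * t ^ (-γ - 1)) :=
            mul_le_mul_of_nonneg_left (hypKernel_sq_le n α hs (le_of_lt ht))
              (Real.rpow_nonneg ht0.le _)
        _ = ((Real.sinh s / s) ^ n)⁻¹ * (t ^ (γ / 2) * t ^ (-γ - 1)) := by ring
        _ = _ := by rw [← Real.rpow_add ht0]; congr 2; ring
    rw [ENNReal.ofReal_mul (hypWeight_pos n _ hs).le]
    calc ENNReal.ofReal (hypWeight n (α - 2) s) * ENNReal.ofReal (tail k f s ^ 2)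
        ≤ ENNReal.ofReal (hypWeight n (α - 2) s) *
          ((∫⁻ t in Set.Ioi s, ENNReal.ofReal (t ^ (-(γ / 2))) * F t) *
            ENNReal.ofReal (((Real.sinh s / s) ^ n)⁻¹ * (s ^ (-(γ / 2)) / (γ / 2)))) := by
          gcongr
          exact h1.trans (by gcongr)
      _ = (ENNReal.ofReal (hypWeight n (α - 2) s) *
            ENNReal.ofReal (((Real.sinh s / s) ^ n)⁻¹ * (s ^ (-(γ / 2)) / (γ / 2)))) *
          (∫⁻ t in Set.Ioi s, ENNReal.ofReal (t ^ (-(γ / 2))) * F t) := by ring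
      _ = (ENNReal.ofReal (2 / γ) * ENNReal.ofReal (s ^ (γ / 2 - 1))) *
          (∫⁻ t in Set.Ioi s, ENNReal.ofReal (t ^ (-(γ / 2))) * F t) := by
          congr 1
          rw [← ENNReal.ofReal_mul (hypWeight_pos n _ hs).le, ← ENNReal.ofReal_mul (by positivity)]
          congr 1
          rw [hypWeight_eq n _ hs]
          have e : s ^ (α - 2 + n) * s ^ (-(γ / 2)) = s ^ (γ / 2 - 1) := by
            rw [← Real.rpow_add hs]; congr 1; rw [hγd]; ring
          rw [← e]
          field_simp
      _ = _ := by ring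
  refine (setLIntegral_mono' measurableSet_Ioi hstep).trans ?_
  rw [lintegral_const_mul'' _ ?_, lintegral_Ioi_mul_lintegral_Ioi
    (B := fun t => ENNReal.ofReal (t ^ (-(γ / 2))) * F t) (hrp _).aemeasurable
    ((hrp _).aemeasurable.mul hFm)]
  · rw [← lintegral_const_mul'' _ hFm, ← lintegral_const_mul'' _ ?_]
    · refine setLIntegral_mono' measurableSet_Ioi fun t ht => le_of_eq ?_
      replace ht : 0 < t := ht
      rw [lintegral_Ioo_rpow (half_pos hγ) ht]
      have : ENNReal.ofReal (t ^ (-(γ / 2))) * ENNReal.ofReal (t ^ (γ / 2) / (γ / 2)) =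
          ENNReal.ofReal (2 / γ) := by
        rw [← ENNReal.ofReal_mul (Real.rpow_nonneg ht.le _), ← mul_div_assoc, ← Real.rpow_add ht]
        congr 1; simp
      calc _ = ENNReal.ofReal (2 / γ) *
            (ENNReal.ofReal (t ^ (-(γ / 2))) * ENNReal.ofReal (t ^ (γ / 2) / (γ / 2))) * F t := by
            ring
        _ = _ := by rw [this, sq, ENNReal.ofReal_mul (by positivity)]
    · refine ((hrp _).aemeasurable.mul hFm).mul ?_
      refine AEMeasurable.congr (f := fun t => ENNReal.ofReal (t ^ (γ / 2) / (γ / 2))) ?_ ?_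
      · exact ((measurable_id.pow_const _).div_const _).ennreal_ofReal.aemeasurable
      · filter_upwards [ae_restrict_mem measurableSet_Ioi] with t ht
        exact (lintegral_Ioo_rpow (half_pos hγ) ht).symm
  · refine (hrp _).aemeasurable.mul (Antitone.measurable ?_).aemeasurable
    intro a b hab
    exact lintegral_mono_set (Set.Ioi_subset_Ioi hab)

theorem hardy (hγ : 0 < (n : ℝ) - 1 + α) {f : ℝ → ℝ}
    (hf : MemLp f 2 (volume.restrict (Set.Ioi 0))) :
    IntegrableOn (fun s => hypWeight n (α - 2) s * tail (hypKernel n α) f s ^ 2) (Set.Ioi 0) ∧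
      ∫ s in Set.Ioi 0, hypWeight n (α - 2) s * tail (hypKernel n α) f s ^ 2 ≤
        (2 / ((n : ℝ) - 1 + α)) ^ 2 * ∫ s in Set.Ioi 0, f s ^ 2 := by
  have h := lintegral_hardy hγ hf.aestronglyMeasurable
  have hc : ContinuousOn (fun s => hypWeight n (α - 2) s * tail (hypKernel n α) f s ^ 2)
      (Set.Ioi 0) := (continuousOn_hypWeight n _).mul
        ((continuousOn_tail (isTailKernel_hypKernel hγ) hf).pow 2)
  have hm := hc.aestronglyMeasurable (μ := volume) measurableSet_Ioi
  have hnn : ∀ s ∈ Set.Ioi (0 : ℝ), 0 ≤ hypWeight n (α - 2) s * tail (hypKernel n α) f s ^ 2 :=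
    fun s hs => mul_nonneg (hypWeight_pos n _ hs).le (sq_nonneg _)
  have hae := (ae_restrict_iff' (μ := volume) measurableSet_Ioi).2 (Eventually.of_forall hnn)
  rw [← ofReal_integral_eq_lintegral_ofReal hf.integrable_sq
    (Eventually.of_forall fun s => sq_nonneg _), ← ENNReal.ofReal_mul (by positivity)] at h
  have hi : IntegrableOn (fun s => hypWeight n (α - 2) s * tail (hypKernel n α) f s ^ 2)
      (Set.Ioi 0) := by
    refine ⟨hm, ?_⟩
    rw [hasFiniteIntegral_iff_ofReal hae]
    exact h.trans_lt ENNReal.ofReal_lt_top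
  refine ⟨hi, ?_⟩
  rw [← ofReal_integral_eq_lintegral_ofReal hi hae] at h
  refine (ENNReal.ofReal_le_ofReal_iff ?_).1 h
  exact mul_nonneg (by positivity) (integral_nonneg fun s => sq_nonneg _)

/-- The pointwise bound for tail integrals with the hyperbolic kernel. -/
noncomputable def hypKappa (n : ℕ) (α s : ℝ) : ℝ :=
  √(((Real.sinh s / s) ^ n)⁻¹ * (s ^ (-((n : ℝ) - 1 + α)) / ((n : ℝ) - 1 + α)))

theorem integrableOn_hypKappa (hn : 1 ≤ n) (hγ : 0 < (n : ℝ) - 1 + α) (hq : 2 < q)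
    (hqβ : q / 2 * ((n : ℝ) - 1 + α) < n + 1 + β) :
    IntegrableOn (fun s => hypWeight n β s * hypKappa n α s ^ q) (Set.Ioi 0) := by
  set γ := (n : ℝ) - 1 + α with hγd
  set a := β + n - q / 2 * γ with ha
  set c := (n : ℝ) * (q / 2 - 1) / 2 with hc
  have hn' : (1 : ℝ) ≤ n := by exact_mod_cast hn
  have hc0 : 0 < c := by
    have : 0 < q / 2 - 1 := by linarith
    positivity
  have hI := (integrableOn_rpow_mul_exp_neg_mul_rpow (p := 1) (s := a) (b := c) (by linarith)
    one_pos hc0).const_mul (γ ^ (-(q / 2)) * 4 ^ ((n : ℝ) * (q / 2 - 1)))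
  have hcont : ContinuousOn (fun s => hypWeight n β s * hypKappa n α s ^ q) (Set.Ioi 0) := by
    refine (continuousOn_hypWeight n β).mul (ContinuousOn.rpow_const ?_ fun _ _ => Or.inr (by linarith))
    refine ContinuousOn.sqrt (ContinuousOn.mul (ContinuousOn.inv₀ ?_ ?_) ?_)
    · exact (Real.continuous_sinh.continuousOn.div continuousOn_id
        fun s hs => ne_of_gt hs).pow n
    · exact fun s hs => (pow_pos (sinh_div_self_pos hs) n).ne'
    · exact (continuousOn_id.rpow_const fun s hs => Or.inl (ne_of_gt hs)).div_const _
  refine hI.mono' (hcont.aestronglyMeasurable measurableSet_Ioi) ?_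
  filter_upwards [ae_restrict_mem measurableSet_Ioi] with s hs
  replace hs : 0 < s := hs
  have hσ := sinh_div_self_pos hs
  set σ := Real.sinh s / s
  have hκ : hypKappa n α s ^ q = (σ ^ n) ^ (-(q / 2)) * (s ^ (-(q / 2 * γ)) * γ ^ (-(q / 2))) := by
    have h1 := Real.rpow_nonneg hs.le (-γ)
    rw [hypKappa, Real.sqrt_eq_rpow, ← Real.rpow_mul (by positivity),
      Real.mul_rpow (by positivity) (by positivity), Real.div_rpow h1 hγ.le, Real.inv_rpow (by positivity),
      show (1 / 2 : ℝ) * q = q / 2 by ring, ← Real.rpow_mul hs.le,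
      Real.rpow_neg (pow_pos hσ n).le, Real.rpow_neg hγ.le, ← div_eq_mul_inv,
      show -γ * (q / 2) = -(q / 2 * γ) by ring]
  have hval : hypWeight n β s * hypKappa n α s ^ q =
      γ ^ (-(q / 2)) * (s ^ a * σ ^ (-((n : ℝ) * (q / 2 - 1)))) := by
    rw [hκ, hypWeight_eq n β hs]
    have e1 : s ^ (β + n) * s ^ (-(q / 2 * γ)) = s ^ a := by
      rw [← Real.rpow_add hs]; congr 1
    have e2 : σ ^ n * (σ ^ n) ^ (-(q / 2)) = σ ^ (-((n : ℝ) * (q / 2 - 1))) := by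
      rw [← Real.rpow_natCast, ← Real.rpow_mul hσ.le, ← Real.rpow_add hσ]; congr 1; ring
    rw [← e1, ← e2]; ring
  rw [hval, Real.norm_of_nonneg (by positivity), mul_assoc]
  have hpow0 : 0 ≤ (n : ℝ) * (q / 2 - 1) := by
    have : 0 ≤ q / 2 - 1 := by linarith
    positivity
  have e3 : σ ^ (-((n : ℝ) * (q / 2 - 1))) ≤ 4 ^ ((n : ℝ) * (q / 2 - 1)) * Real.exp (-c * s ^ (1 : ℝ)) := by
    rw [Real.rpow_one]
    calc σ ^ (-((n : ℝ) * (q / 2 - 1)))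
        ≤ (Real.exp (s / 2) / 4) ^ (-((n : ℝ) * (q / 2 - 1))) :=
          Real.rpow_le_rpow_of_nonpos (by positivity) (exp_half_div_four_le_sinh_div_self hs)
            (by linarith)
      _ = _ := by
          rw [Real.rpow_neg (by positivity), Real.div_rpow (by positivity) (by positivity),
            ← Real.exp_mul, inv_div, div_eq_mul_inv, ← Real.exp_neg]
          congr 2; rw [hc]; ring
  have := Real.rpow_nonneg hγ.le (-(q / 2))
  calc γ ^ (-(q / 2)) * (s ^ a * σ ^ (-((n : ℝ) * (q / 2 - 1))))
      ≤ γ ^ (-(q / 2)) * (s ^ a * (4 ^ ((n : ℝ) * (q / 2 - 1)) * Real.exp (-c * s ^ (1 : ℝ)))) := by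
        gcongr
    _ = _ := by ring

theorem isAdapted_hyp (hn : 1 ≤ n) (hγ : 0 < (n : ℝ) - 1 + α) (hq : 2 < q)
    (hqβ : q / 2 * ((n : ℝ) - 1 + α) < n + 1 + β) :
    IsAdapted (hypKernel n α) (hypWeight n (α - 2)) (hypWeight n β) (hypKappa n α) q
      ((2 / ((n : ℝ) - 1 + α)) ^ 2) where
  kernel := isTailKernel_hypKernel hγ
  cont₁ := continuousOn_hypWeight n _
  pos₁ _ hs := hypWeight_pos n _ hs
  cont₂ := continuousOn_hypWeight n _
  pos₂ _ hs := hypWeight_pos n _ hs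
  hardy _ hf := hardy hγ hf
  kappa_nonneg _ _ := Real.sqrt_nonneg _
  kernel_le s hs := by
    have := pow_pos (sinh_div_self_pos hs) n
    have := Real.rpow_nonneg hs.le (-((n : ℝ) - 1 + α))
    rw [hypKappa, Real.sq_sqrt (by positivity)]
    exact integral_hypKernel_sq_le hγ hs
  integrable_kappa := integrableOn_hypKappa hn hγ hq hqβ

end Weights

end HalfLine

namespace PoincareBall

/-- The Euclidean norm of a point at hyperbolic distance `s` from the origin, that is
`tanh (s / 2)`. -/
noncomputable def radius (s : ℝ) : ℝ := 1 - 2 / (Real.exp s + 1)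

theorem radius_zero : radius 0 = 0 := by norm_num [radius]

theorem radius_lt_one (s : ℝ) : radius s < 1 := by
  have := Real.exp_pos s
  have : 0 < 2 / (Real.exp s + 1) := by positivity
  rw [radius]; linarith

theorem strictMono_radius : StrictMono radius := by
  intro s t hst
  have h1 := Real.exp_pos s
  have h2 := Real.exp_lt_exp.2 hst
  have : 2 / (Real.exp t + 1) < 2 / (Real.exp s + 1) := by gcongr
  rw [radius, radius]; linarith

theorem radius_pos {s : ℝ} (hs : 0 < s) : 0 < radius s := by
  simpa [radius_zero] using strictMono_radius hs

theorem contDiff_radius : ContDiff ℝ ∞ radius := by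
  unfold radius
  refine contDiff_const.sub (contDiff_const.div (Real.contDiff_exp.add contDiff_const) fun s => ?_)
  have := Real.exp_pos s
  positivity

theorem continuous_radius : Continuous radius := contDiff_radius.continuous

theorem log_radius (s : ℝ) : Real.log ((1 + radius s) / (1 - radius s)) = s := by
  have h := Real.exp_pos s
  have : (1 + radius s) / (1 - radius s) = Real.exp s := by
    rw [radius]; field_simp; ring
  rw [this, Real.log_exp]

theorem radius_log {r : ℝ} (h0 : 0 ≤ r) (h1 : r < 1) :
    radius (Real.log ((1 + r) / (1 - r))) = r := by
  have h2 : 0 < 1 - r := by linarith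
  rw [radius, Real.exp_log (by positivity)]
  field_simp; ring

theorem image_radius_Ioi : radius '' Set.Ioi 0 = Set.Ioo 0 1 := by
  ext r
  constructor
  · rintro ⟨s, hs, rfl⟩
    exact ⟨radius_pos hs, radius_lt_one s⟩
  · rintro ⟨h0, h1⟩
    refine ⟨_, ?_, radius_log h0.le h1⟩
    have h2 : 0 < 1 - r := by linarith
    refine Real.log_pos ?_
    rw [lt_div_iff₀ h2]; linarith

variable {N : ℕ}

theorem rho_of_norm_eq_radius {x : EuclideanSpace ℝ (Fin N)} {s : ℝ} (hx : ‖x‖ = radius s) :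
    rho x = (Real.exp s + 1) ^ 2 / (2 * Real.exp s) := by
  have h := Real.exp_pos s
  have e : 1 - radius s ^ 2 = 4 * Real.exp s / (Real.exp s + 1) ^ 2 := by
    rw [radius]; field_simp; ring
  rw [rho, hx, e]
  field_simp; ring

theorem rho_pos {x : EuclideanSpace ℝ (Fin N)} (hx : x ∈ ball N) : 0 < rho x := by
  have h : ‖x‖ < 1 := by simpa [ball] using hx
  have := norm_nonneg x
  have : 0 < 1 - ‖x‖ ^ 2 := by nlinarith
  rw [rho]; positivity

theorem hasDerivAt_radius (s : ℝ) {x : EuclideanSpace ℝ (Fin N)} (hx : ‖x‖ = radius s) :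
    HasDerivAt radius (rho x)⁻¹ s := by
  have h := Real.exp_pos s
  have h1 := (((Real.hasDerivAt_exp s).add_const 1).inv (by positivity)).const_mul 2
  have h2 := h1.const_sub 1
  rw [rho_of_norm_eq_radius hx]
  refine (h2.congr_deriv ?_).congr_of_eventuallyEq (Eventually.of_forall fun t => ?_)
  · field_simp
  · simp [radius, div_eq_mul_inv]

theorem rho_mul_radius {x : EuclideanSpace ℝ (Fin N)} {s : ℝ} (hx : ‖x‖ = radius s) :
    rho x * radius s = Real.sinh s := by
  have h := Real.exp_pos s
  rw [rho_of_norm_eq_radius hx, radius, Real.sinh_eq, Real.exp_neg]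
  field_simp; ring

theorem norm_radius_smul {s : ℝ} (hs : 0 ≤ s) (θ : Metric.sphere (0 : EuclideanSpace ℝ (Fin N)) 1) :
    ‖radius s • (θ : EuclideanSpace ℝ (Fin N))‖ = radius s := by
  have : 0 ≤ radius s := by simpa [radius_zero] using strictMono_radius.monotone hs
  rw [norm_smul, norm_eq_of_mem_sphere, mul_one, Real.norm_of_nonneg this]

theorem dist0_radius_smul {s : ℝ} (hs : 0 ≤ s)
    (θ : Metric.sphere (0 : EuclideanSpace ℝ (Fin N)) 1) :
    dist0 (radius s • (θ : EuclideanSpace ℝ (Fin N))) = s := by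
  rw [dist0, norm_radius_smul hs, log_radius]

theorem measurable_rho : Measurable (rho : EuclideanSpace ℝ (Fin N) → ℝ) := by
  unfold rho; fun_prop

theorem measurable_dist0 : Measurable (dist0 : EuclideanSpace ℝ (Fin N) → ℝ) := by
  unfold dist0; fun_prop

/-- The radial factor `sinh^{N-1} s ds` of the hyperbolic volume. -/
noncomputable def radialMeasure (N : ℕ) : Measure ℝ :=
  (volume.restrict (Set.Ioi 0)).withDensity fun s => ENNReal.ofReal (Real.sinh s ^ (N - 1))

/-- Hyperbolic polar coordinates. -/
noncomputable def polar (p : Metric.sphere (0 : EuclideanSpace ℝ (Fin N)) 1 × ℝ) :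
    EuclideanSpace ℝ (Fin N) := radius p.2 • (p.1 : EuclideanSpace ℝ (Fin N))

theorem continuous_polar : Continuous (polar (N := N)) :=
  (continuous_radius.comp continuous_snd).smul (continuous_subtype_val.comp continuous_fst)

theorem measurable_sinh_pow (n : ℕ) : Measurable fun s => ENNReal.ofReal (Real.sinh s ^ n) :=
  ((Real.continuous_sinh.pow n).measurable).ennreal_ofReal

instance : SFinite (radialMeasure N) := by
  unfold radialMeasure; infer_instance

theorem lintegral_radialMeasure (F : ℝ → ENNReal) :
    ∫⁻ s, F s ∂radialMeasure N =
      ∫⁻ s in Set.Ioi 0, ENNReal.ofReal (Real.sinh s ^ (N - 1)) * F s := by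
  rw [radialMeasure, lintegral_withDensity_eq_lintegral_mul_non_measurable _
    (measurable_sinh_pow _) (Eventually.of_forall fun s => ENNReal.ofReal_lt_top)]
  rfl

theorem lintegral_vol (hN : 3 ≤ N) {F : EuclideanSpace ℝ (Fin N) → ENNReal} (hF : Measurable F) :
    ∫⁻ x, F x ∂vol N = ∫⁻ θ, ∫⁻ s, F (polar (θ, s)) ∂radialMeasure N
      ∂(volume : Measure (EuclideanSpace ℝ (Fin N))).toSphere := by
  have hnt : Nontrivial (EuclideanSpace ℝ (Fin N)) := by
    have : Nonempty (Fin N) := ⟨⟨0, by omega⟩⟩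
    infer_instance
  have hball : MeasurableSet (ball N) := Metric.isOpen_ball.measurableSet
  set D : EuclideanSpace ℝ (Fin N) → ENNReal := (ball N).indicator
    fun x => ENNReal.ofReal (rho x ^ N) * F x with hD
  have hDm : Measurable D := (((measurable_rho.pow_const N).ennreal_ofReal).mul hF).indicator hball
  have h1 : ∫⁻ x, F x ∂vol N = ∫⁻ x, D x := by
    rw [vol, lintegral_withDensity_eq_lintegral_mul _ (measurable_rho.pow_const N).ennreal_ofReal hF,
      hD, lintegral_indicator hball]
    rfl
  have h2 : ∫⁻ x, D x = ∫⁻ x : ({0}ᶜ : Set (EuclideanSpace ℝ (Fin N))), D x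
      ∂(volume.comap Subtype.val) := by
    rw [lintegral_subtype_comap (measurableSet_singleton _).compl, restrict_compl_singleton]
  have hmp := (volume : Measure (EuclideanSpace ℝ (Fin N))).measurePreserving_homeomorphUnitSphereProd
  have h3 : ∫⁻ x : ({0}ᶜ : Set (EuclideanSpace ℝ (Fin N))), D x ∂(volume.comap Subtype.val) =
      ∫⁻ p, D (p.2.1 • (p.1 : EuclideanSpace ℝ (Fin N)))
        ∂((volume : Measure (EuclideanSpace ℝ (Fin N))).toSphere.prod
          (Measure.volumeIoiPow (Module.finrank ℝ (EuclideanSpace ℝ (Fin N)) - 1))) := by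
    rw [← hmp.lintegral_comp]
    · refine lintegral_congr fun x => ?_
      congr 1
      have : ‖(x : EuclideanSpace ℝ (Fin N))‖ ≠ 0 := norm_ne_zero_iff.2 x.2
      simp [homeomorphUnitSphereProd, smul_smul, this]
    · exact hDm.comp (by fun_prop)
  rw [h1, h2, h3, lintegral_prod (fun p :
      Metric.sphere (0 : EuclideanSpace ℝ (Fin N)) 1 × Set.Ioi (0 : ℝ) => D (p.2.1 • (p.1 : EuclideanSpace ℝ (Fin N))))
    (hDm.comp (by fun_prop)).aemeasurable, finrank_euclideanSpace,
    Fintype.card_fin]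
  refine lintegral_congr fun θ => ?_
  have hrm : Measurable fun r : ℝ => D (r • (θ : EuclideanSpace ℝ (Fin N))) :=
    hDm.comp (by fun_prop)
  rw [Measure.volumeIoiPow]
  refine (lintegral_withDensity_eq_lintegral_mul _ (by fun_prop)
    (hrm.comp measurable_subtype_coe)).trans ?_
  have h4 := lintegral_subtype_comap (μ := volume) (measurableSet_Ioi (a := (0 : ℝ)))
    fun r => ENNReal.ofReal (r ^ (N - 1)) * D (r • (θ : EuclideanSpace ℝ (Fin N)))
  refine h4.trans ?_
  have h5 : ∫⁻ r in Set.Ioi (0 : ℝ), ENNReal.ofReal (r ^ (N - 1)) *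
        D (r • (θ : EuclideanSpace ℝ (Fin N))) =
      ∫⁻ r in Set.Ioo (0 : ℝ) 1, ENNReal.ofReal (r ^ (N - 1)) *
        D (r • (θ : EuclideanSpace ℝ (Fin N))) := by
    rw [← Set.Ioi_inter_Iio, ← Measure.restrict_restrict measurableSet_Ioi,
      ← lintegral_indicator measurableSet_Ioi, ← lintegral_indicator measurableSet_Ioi,
      ← lintegral_indicator measurableSet_Iio]
    refine lintegral_congr fun r => ?_
    by_cases hr0 : r ∈ Set.Ioi (0 : ℝ)
    · by_cases hr1 : r ∈ Set.Iio (1 : ℝ)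
      · rw [Set.indicator_of_mem hr1]
      · rw [Set.indicator_of_notMem hr1, Set.indicator_of_mem hr0, hD, Set.indicator_of_notMem,
          mul_zero]
        have : ‖r • (θ : EuclideanSpace ℝ (Fin N))‖ = r := by
          rw [norm_smul, norm_eq_of_mem_sphere, mul_one, Real.norm_of_nonneg (le_of_lt hr0)]
        rw [ball, mem_ball_zero_iff, this]
        exact hr1
    · by_cases hr1 : r ∈ Set.Iio (1 : ℝ)
      · rw [Set.indicator_of_mem hr1]
      · rw [Set.indicator_of_notMem hr1, Set.indicator_of_notMem hr0]
  rw [h5, ← image_radius_Ioi, lintegral_image_eq_lintegral_abs_deriv_mul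
    (f' := fun s => (rho (polar (θ, s)))⁻¹) measurableSet_Ioi
    (fun s hs => (hasDerivAt_radius s (norm_radius_smul (le_of_lt hs) θ)).hasDerivWithinAt)
    strictMono_radius.injective.injOn, lintegral_radialMeasure]
  refine setLIntegral_congr_fun measurableSet_Ioi fun s hs => ?_
  have hnorm := norm_radius_smul (le_of_lt hs) θ
  have hmem : polar (θ, s) ∈ ball N := by
    rw [ball, mem_ball_zero_iff]; exact hnorm.trans_lt (radius_lt_one s)
  have hρ := rho_pos hmem
  have hr := radius_pos hs
  have hsinh := rho_mul_radius hnorm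
  change ENNReal.ofReal |(rho (polar (θ, s)))⁻¹| * (ENNReal.ofReal (radius s ^ (N - 1)) *
    D (polar (θ, s))) = _
  rw [hD, Set.indicator_of_mem hmem, ← mul_assoc, ← mul_assoc, abs_of_pos (inv_pos.2 hρ),
    ← ENNReal.ofReal_mul (by positivity), ← ENNReal.ofReal_mul (by positivity)]
  congr 2
  rw [← hsinh]
  change (rho (polar (θ, s)))⁻¹ * radius s ^ (N - 1) * rho (polar (θ, s)) ^ N =
    (rho (polar (θ, s)) * radius s) ^ (N - 1)
  obtain ⟨M, rfl⟩ : ∃ M, N = M + 1 := ⟨N - 1, by omega⟩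
  rw [Nat.add_sub_cancel, mul_pow, pow_succ]
  field_simp

theorem vol_eq_map (hN : 3 ≤ N) :
    vol N = Measure.map polar ((volume : Measure (EuclideanSpace ℝ (Fin N))).toSphere.prod
      (radialMeasure N)) := by
  ext A hA
  have hm : Measurable (A.indicator (1 : EuclideanSpace ℝ (Fin N) → ENNReal)) :=
    measurable_one.indicator hA
  have h := lintegral_vol hN hm
  rw [lintegral_indicator_one hA] at h
  rw [h, ← lintegral_indicator_one hA, lintegral_map hm continuous_polar.measurable,
    lintegral_prod (fun p => A.indicator 1 (polar p))
      (hm.comp continuous_polar.measurable).aemeasurable]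

theorem integral_radialMeasure (h : ℝ → ℝ) :
    ∫ s, h s ∂radialMeasure N = ∫ s in Set.Ioi 0, Real.sinh s ^ (N - 1) * h s := by
  rw [radialMeasure, integral_withDensity_eq_integral_toReal_smul (measurable_sinh_pow _)
    (Eventually.of_forall fun s => ENNReal.ofReal_lt_top)]
  refine setIntegral_congr_fun measurableSet_Ioi fun s hs => ?_
  simp only [smul_eq_mul]
  rw [ENNReal.toReal_ofReal (pow_nonneg (Real.sinh_pos_iff.2 hs).le _)]

theorem integral_vol (hN : 3 ≤ N) {h : EuclideanSpace ℝ (Fin N) → ℝ} (hh : Integrable h (vol N)) :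
    ∫ x, h x ∂vol N = ∫ θ, (∫ s in Set.Ioi 0, Real.sinh s ^ (N - 1) * h (polar (θ, s)))
      ∂(volume : Measure (EuclideanSpace ℝ (Fin N))).toSphere := by
  rw [vol_eq_map hN] at hh ⊢
  rw [integral_map continuous_polar.measurable.aemeasurable hh.aestronglyMeasurable, integral_prod]
  · simp only [integral_radialMeasure]
  · exact hh.comp_measurable continuous_polar.measurable

theorem ae_vol_mem (hN : 3 ≤ N) : ∀ᵐ x ∂vol N, x ∈ ball N ∧ x ≠ 0 := by
  have hac : vol N ≪ volume.restrict (ball N) := withDensity_absolutelyContinuous _ _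
  have hnt : Nontrivial (EuclideanSpace ℝ (Fin N)) := by
    have : Nonempty (Fin N) := ⟨⟨0, by omega⟩⟩
    infer_instance
  have h0 : ∀ᵐ x ∂(volume : Measure (EuclideanSpace ℝ (Fin N))), x ≠ 0 := by
    simp [ae_iff, measure_singleton]
  refine hac.ae_le ?_
  filter_upwards [ae_restrict_mem Metric.isOpen_ball.measurableSet, ae_restrict_of_ae h0] with x h1 h2
  exact ⟨h1, h2⟩

theorem dist0_pos {x : EuclideanSpace ℝ (Fin N)} (hx : x ∈ ball N) (h0 : x ≠ 0) : 0 < dist0 x := by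
  have h1 : ‖x‖ < 1 := by simpa [ball] using hx
  have h2 := norm_pos_iff.2 h0
  have h3 : 0 < 1 - ‖x‖ := by linarith
  refine Real.log_pos ?_
  rw [lt_div_iff₀ h3]; linarith

end PoincareBall

namespace HalfLine

variable {k f h : ℝ → ℝ}

theorem memLp_div_kernel (hk : IsTailKernel k) (hc : Continuous h) (hcs : HasCompactSupport h)
    (hs : tsupport h ⊆ Set.Ioi 0) : MemLp (fun t => h t / k t) 2 (volume.restrict (Set.Ioi 0)) := by
  have h1 : ContinuousOn (fun t => h t / k t) (Set.Ioi 0) :=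
    hc.continuousOn.div hk.cont fun t ht => (hk.pos t ht).ne'
  refine (memLp_two_iff_integrable_sq (h1.aestronglyMeasurable measurableSet_Ioi)).2 ?_
  have h2 : IntegrableOn (fun t => (h t / k t) ^ 2) (tsupport h) :=
    ((h1.mono hs).pow 2).integrableOn_compact hcs.isCompact
  refine ((integrableOn_iff_integrable_of_support_subset ?_).1 h2).integrableOn
  intro t ht
  refine subset_tsupport h fun h0 => ht ?_
  simp [h0]

theorem tail_div_kernel (hk : IsTailKernel k) {s : ℝ} (hs : 0 < s) :
    tail k (fun t => h t / k t) s = ∫ t in Set.Ioi s, h t :=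
  setIntegral_congr_fun measurableSet_Ioi fun t ht => mul_div_cancel₀ _ (hk.pos t (hs.trans ht)).ne'

/-- Functions `h / k` with `h` smooth and compactly supported in `(0, ∞)` are dense in `L²`. -/
theorem exists_smooth_div_kernel_tendsto (hk : IsTailKernel k)
    (hf : MemLp f 2 (volume.restrict (Set.Ioi 0))) :
    ∃ h : ℕ → ℝ → ℝ, (∀ n, ContDiff ℝ ∞ (h n) ∧ HasCompactSupport (h n) ∧
      tsupport (h n) ⊆ Set.Ioi 0) ∧
      Tendsto (fun n => ∫ t in Set.Ioi 0, (h n t / k t - f t) ^ 2) atTop (𝓝 0) := by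
  let S : Submodule ℝ (Lp ℝ 2 (volume.restrict (Set.Ioi (0 : ℝ)))) :=
    { carrier := {F | ∃ h : ℝ → ℝ, (ContDiff ℝ ∞ h ∧ HasCompactSupport h ∧
        tsupport h ⊆ Set.Ioi 0) ∧ F =ᵐ[volume.restrict (Set.Ioi 0)] fun t => h t / k t}
      zero_mem' := ⟨0, ⟨contDiff_const, HasCompactSupport.zero, by simp [tsupport]⟩, by
        filter_upwards [Lp.coeFn_zero ℝ 2 (volume.restrict (Set.Ioi (0 : ℝ)))] with t ht
        rw [ht]; simp⟩
      add_mem' := by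
        rintro F G ⟨h, ⟨h1, h2, h3⟩, h4⟩ ⟨g, ⟨g1, g2, g3⟩, g4⟩
        refine ⟨h + g, ⟨h1.add g1, h2.add g2,
          (tsupport_add h g).trans (Set.union_subset h3 g3)⟩, ?_⟩
        filter_upwards [Lp.coeFn_add F G, h4, g4] with t e1 e2 e3
        rw [e1, Pi.add_apply, e2, e3, Pi.add_apply, add_div]
      smul_mem' := by
        rintro c F ⟨h, ⟨h1, h2, h3⟩, h4⟩
        refine ⟨c • h, ⟨h1.const_smul c, h2.smul_left (f := fun _ => c),
          (closure_mono (Function.support_const_smul_subset c h)).trans h3⟩, ?_⟩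
        filter_upwards [Lp.coeFn_smul c F, h4] with t e1 e2
        rw [e1, Pi.smul_apply, e2, Pi.smul_apply, smul_eq_mul, smul_eq_mul, mul_div_assoc] }
  have hmem : ∀ g : ℝ → ℝ, (hg : ContDiff ℝ ∞ g) → (hgc : HasCompactSupport g) →
      (hgs : tsupport g ⊆ Set.Ioi 0) →
      (memLp_div_kernel hk hg.continuous hgc hgs).toLp _ ∈ S := fun g hg hgc hgs =>
    ⟨g, ⟨hg, hgc, hgs⟩, MemLp.coeFn_toLp _⟩
  have hS : S.topologicalClosure = ⊤ := by
    rw [Submodule.topologicalClosure_eq_top_iff, Submodule.eq_bot_iff]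
    intro F hF
    rw [Submodule.mem_orthogonal] at hF
    have hloc : LocallyIntegrableOn (fun t => F t / k t) (Set.Ioi 0) := by
      have h1 : LocallyIntegrableOn F (Set.Ioi 0) := by
        rw [locallyIntegrableOn_iff isOpen_Ioi.isLocallyClosed]
        intro K hK1 hK2
        have : MemLp F 2 (volume.restrict K) :=
          (Lp.memLp F).mono_measure (Measure.restrict_mono hK1 le_rfl)
        have : IsFiniteMeasure (volume.restrict K) := ⟨by simpa using hK2.measure_lt_top⟩
        exact MemLp.integrable one_le_two ‹_›
      have h2 := h1.mul_continuousOn (hk.cont.inv₀ fun t ht => (hk.pos t ht).ne')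
        isOpen_Ioi.isLocallyClosed
      exact h2
    have hae := isOpen_Ioi.ae_eq_zero_of_integral_contDiff_smul_eq_zero hloc (by
      intro g hg hgc hgs
      have h1 := hF _ (hmem g hg hgc hgs)
      rw [← Lp.toLp_coeFn F (Lp.memLp F), inner_toLp] at h1
      rw [← setIntegral_eq_integral_of_forall_compl_eq_zero (s := Set.Ioi 0) fun t ht => by
        rw [image_eq_zero_of_notMem_tsupport (fun h => ht (hgs h)), zero_smul]]
      refine Eq.trans ?_ h1
      congr 1; ext t
      simp only [smul_eq_mul]; ring)
    rw [Lp.eq_zero_iff_ae_eq_zero]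
    refine (ae_restrict_iff' measurableSet_Ioi).2 ?_
    filter_upwards [hae] with t ht ht0
    exact (div_eq_zero_iff.1 (ht ht0)).resolve_right (hk.pos t ht0).ne'
  have hcl : hf.toLp f ∈ closure (S : Set (Lp ℝ 2 (volume.restrict (Set.Ioi (0 : ℝ))))) := by
    rw [← Submodule.topologicalClosure_coe, hS]; trivial
  obtain ⟨F, hFS, hF⟩ := mem_closure_iff_seq_limit.1 hcl
  choose h hh hFh using hFS
  refine ⟨h, hh, ?_⟩
  have h1 : Tendsto (fun n => ‖F n - hf.toLp f‖ ^ 2) atTop (𝓝 0) := by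
    have := (tendsto_iff_norm_sub_tendsto_zero.1 hF).pow 2
    simpa using this
  refine h1.congr fun n => ?_
  rw [← real_inner_self_eq_norm_sq, L2.inner_def]
  refine integral_congr_ae ?_
  filter_upwards [Lp.coeFn_sub (F n) (hf.toLp f), hFh n, hf.coeFn_toLp] with t e1 e2 e3
  rw [e1, Pi.sub_apply, e2, e3]
  simp [sq]

end HalfLine

namespace PoincareBall

open HalfLine

variable {N : ℕ}

theorem hasFDerivAt_dist0 {x : EuclideanSpace ℝ (Fin N)} (hx : x ∈ ball N) (h0 : x ≠ 0) :
    HasFDerivAt dist0 (rho x • ‖x‖⁻¹ • innerSL ℝ x) x := by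
  have h1 : ‖x‖ < 1 := by simpa [ball] using hx
  have h2 := norm_pos_iff.2 h0
  have h3 : HasFDerivAt (fun y : EuclideanSpace ℝ (Fin N) => ‖y‖) (‖x‖⁻¹ • innerSL ℝ x) x := by
    have := (hasStrictFDerivAt_norm_sq x).hasFDerivAt.sqrt (by positivity)
    simp only [Real.sqrt_sq (norm_nonneg _)] at this
    refine this.congr_fderiv ?_
    rw [two_smul, ← two_smul ℝ, smul_smul]
    congr 1; field_simp
  have h4 : HasDerivAt (fun r : ℝ => Real.log ((1 + r) / (1 - r))) (rho x) ‖x‖ := by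
    have h5 : 1 - ‖x‖ ≠ 0 := by linarith
    have h6 : 1 + ‖x‖ ≠ 0 := by positivity
    have := (((hasDerivAt_id ‖x‖).const_add 1).div ((hasDerivAt_id ‖x‖).const_sub 1) h5).log
      (div_ne_zero h6 h5)
    refine this.congr_deriv ?_
    have h7 : 1 - ‖x‖ ^ 2 ≠ 0 := by
      have : 1 - ‖x‖ ^ 2 = (1 - ‖x‖) * (1 + ‖x‖) := by ring
      rw [this]; exact mul_ne_zero h5 h6
    simp only [id, rho, Pi.div_apply]
    field_simp; ring
  exact h4.comp_hasFDerivAt x h3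

theorem contDiffAt_dist0 {x : EuclideanSpace ℝ (Fin N)} (hx : x ∈ ball N) (h0 : x ≠ 0) :
    ContDiffAt ℝ ∞ dist0 x := by
  have h1 : ‖x‖ < 1 := by simpa [ball] using hx
  have h5 : 1 - ‖x‖ ≠ 0 := by linarith
  have h6 : 1 + ‖x‖ ≠ 0 := by positivity
  have hn : ContDiffAt ℝ ∞ (fun y : EuclideanSpace ℝ (Fin N) => ‖y‖) x := contDiffAt_norm ℝ h0
  exact ((contDiffAt_const.add hn).div (contDiffAt_const.sub hn) h5).log (div_ne_zero h6 h5)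

theorem norm_eq_radius_dist0 {x : EuclideanSpace ℝ (Fin N)} (hx : x ∈ ball N) :
    ‖x‖ = radius (dist0 x) := by
  have h1 : ‖x‖ < 1 := by simpa [ball] using hx
  exact (radius_log (norm_nonneg x) h1).symm

/-- The radial function on the ball with profile `s ↦ ∫_s^∞ h`. -/
noncomputable def radialTest (N : ℕ) (h : ℝ → ℝ) (x : EuclideanSpace ℝ (Fin N)) : ℝ :=
  open Classical in if x ∈ ball N then ∫ t in Set.Ioi (dist0 x), h t else 0

theorem radialTest_of_mem {h : ℝ → ℝ} {x : EuclideanSpace ℝ (Fin N)} (hx : x ∈ ball N) :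
    radialTest N h x = ∫ t in Set.Ioi (dist0 x), h t := if_pos hx

theorem hasDerivAt_integral_Ioi {h : ℝ → ℝ} (hc : Continuous h) (hcs : HasCompactSupport h) (s : ℝ) :
    HasDerivAt (fun s => ∫ t in Set.Ioi s, h t) (-h s) s := by
  have hi := hc.integrable_of_hasCompactSupport (μ := volume) hcs
  have h1 : HasDerivAt (fun x => ∫ t in s..x, h t) (h s) s :=
    intervalIntegral.integral_hasDerivAt_right (by simp)
      (hc.stronglyMeasurableAtFilter _ _) hc.continuousAt
  refine (h1.const_sub (∫ t in Set.Ioi s, h t)).congr_of_eventuallyEq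
    (Eventually.of_forall fun x => ?_)
  simp only [← intervalIntegral.integral_Ioi_sub_Ioi' hi.integrableOn hi.integrableOn]
  ring

theorem contDiff_integral_Ioi {h : ℝ → ℝ} (hc : ContDiff ℝ ∞ h) (hcs : HasCompactSupport h) :
    ContDiff ℝ ∞ (fun s => ∫ t in Set.Ioi s, h t) := by
  have hd := hasDerivAt_integral_Ioi hc.continuous hcs
  refine contDiff_infty_iff_deriv.2 ⟨fun s => (hd s).differentiableAt, ?_⟩
  have : deriv (fun s => ∫ t in Set.Ioi s, h t) = fun s => -h s := funext fun s => (hd s).deriv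
  rw [this]; exact hc.neg

theorem exists_bounds_of_tsupport {h : ℝ → ℝ} (hcs : HasCompactSupport h)
    (hs : tsupport h ⊆ Set.Ioi 0) :
    ∃ a b : ℝ, 0 < a ∧ 0 < b ∧ (∀ t, t < a → h t = 0) ∧ ∀ t, b < t → h t = 0 := by
  rcases (tsupport h).eq_empty_or_nonempty with he | hne
  · have : ∀ t, h t = 0 := fun t => image_eq_zero_of_notMem_tsupport (by simp [he])
    exact ⟨1, 1, one_pos, one_pos, fun t _ => this t, fun t _ => this t⟩
  · have h1 := hcs.isCompact.sInf_mem hne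
    have h2 := hcs.isCompact.sSup_mem hne
    refine ⟨sInf (tsupport h), sSup (tsupport h), hs h1, hs h2, fun t ht => ?_, fun t ht => ?_⟩
    · exact image_eq_zero_of_notMem_tsupport fun hmem =>
        absurd (csInf_le hcs.isCompact.bddBelow hmem) (not_le.2 ht)
    · exact image_eq_zero_of_notMem_tsupport fun hmem =>
        absurd (le_csSup hcs.isCompact.bddAbove hmem) (not_le.2 ht)

theorem isTestFunction_radialTest {h : ℝ → ℝ} (hc : ContDiff ℝ ∞ h) (hcs : HasCompactSupport h)
    (hs : tsupport h ⊆ Set.Ioi 0) : IsTestFunction (radialTest N h) := by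
  obtain ⟨a, b, ha, hb, hla, hlb⟩ := exists_bounds_of_tsupport hcs hs
  have hi := hc.continuous.integrable_of_hasCompactSupport (μ := volume) hcs
  have hzero : ∀ x : EuclideanSpace ℝ (Fin N), radius b < ‖x‖ → radialTest N h x = 0 := by
    intro x hx
    by_cases hxb : x ∈ ball N
    · rw [radialTest_of_mem hxb]
      refine setIntegral_eq_zero_of_forall_eq_zero fun t ht => hlb t ?_
      rw [norm_eq_radius_dist0 hxb, strictMono_radius.lt_iff_lt] at hx
      exact hx.trans ht
    · exact if_neg hxb
  have hsupp : tsupport (radialTest N h) ⊆ Metric.closedBall 0 (radius b) := by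
    refine closure_minimal (fun x hx => ?_) Metric.isClosed_closedBall
    rw [mem_closedBall_zero_iff]
    by_contra hcon
    exact hx (hzero x (not_le.1 hcon))
  refine ⟨?_, ?_, ?_⟩
  · rw [contDiff_iff_contDiffAt]
    intro x
    rcases lt_or_ge ‖x‖ (radius a) with h1 | h1
    · refine (contDiffAt_const (c := ∫ t in Set.Ioi (0 : ℝ), h t)).congr_of_eventuallyEq ?_
      have : Metric.ball (0 : EuclideanSpace ℝ (Fin N)) (radius a) ∈ 𝓝 x :=
        Metric.isOpen_ball.mem_nhds (by simpa using h1)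
      filter_upwards [this] with y hy
      have hy1 : ‖y‖ < radius a := by simpa using hy
      have hyb : y ∈ ball N := by
        rw [ball, mem_ball_zero_iff]; exact hy1.trans (radius_lt_one a)
      rw [radialTest_of_mem hyb, ← sub_eq_zero,
        intervalIntegral.integral_Ioi_sub_Ioi' hi.integrableOn hi.integrableOn]
      rw [norm_eq_radius_dist0 hyb, strictMono_radius.lt_iff_lt] at hy1
      rw [intervalIntegral.integral_congr (g := fun _ => (0 : ℝ)) (fun t ht => hla t
        (ht.2.trans_lt (max_lt hy1 ha)))]
      simp
    · by_cases hxb : x ∈ ball N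
      · have hx0 : x ≠ 0 := by
          rintro rfl
          rw [norm_zero] at h1
          exact absurd (radius_pos ha) (not_lt.2 h1)
        refine ((contDiff_integral_Ioi hc hcs).contDiffAt.comp x
          (contDiffAt_dist0 hxb hx0)).congr_of_eventuallyEq ?_
        filter_upwards [Metric.isOpen_ball.mem_nhds hxb] with y hy
        exact radialTest_of_mem hy
      · refine (contDiffAt_const (c := (0 : ℝ))).congr_of_eventuallyEq ?_
        have hx1 : radius b < ‖x‖ := by
          rw [ball, mem_ball_zero_iff, not_lt] at hxb
          exact (radius_lt_one b).trans_le hxb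
        filter_upwards [(isOpen_lt continuous_const continuous_norm).mem_nhds hx1] with y hy
        exact hzero y hy
  · exact HasCompactSupport.of_support_subset_isCompact (isCompact_closedBall 0 (radius b))
      ((subset_tsupport _).trans hsupp)
  · refine hsupp.trans fun x hx => ?_
    rw [mem_closedBall_zero_iff] at hx
    rw [ball, mem_ball_zero_iff]
    exact hx.trans_lt (radius_lt_one b)

theorem hgrad_radialTest {h : ℝ → ℝ} (hc : ContDiff ℝ ∞ h) (hcs : HasCompactSupport h)
    {x : EuclideanSpace ℝ (Fin N)} (hx : x ∈ ball N) (h0 : x ≠ 0) :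
    hgrad (radialTest N h) x = (-h (dist0 x)) • (‖x‖⁻¹ • x) := by
  have h1 := (hasDerivAt_integral_Ioi hc.continuous hcs (dist0 x)).comp_hasFDerivAt x
    (hasFDerivAt_dist0 hx h0)
  have h2 : HasGradientAt (radialTest N h) ((-h (dist0 x)) • rho x • ‖x‖⁻¹ • x) x := by
    rw [hasGradientAt_iff_hasFDerivAt]
    refine (h1.congr_fderiv ?_).congr_of_eventuallyEq ?_
    · ext y
      simp
    · filter_upwards [Metric.isOpen_ball.mem_nhds hx] with y hy
      exact radialTest_of_mem hy
  rw [hgrad, h2.gradient, smul_comm _ (-h (dist0 x)), smul_smul (rho x)⁻¹, inv_mul_cancel₀ (rho_pos hx).ne',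
    one_smul]

theorem lintegral_vol_radial (hN : 3 ≤ N) {F : ℝ → ENNReal} (hF : Measurable F) :
    ∫⁻ x, F (dist0 x) ∂vol N =
      (volume : Measure (EuclideanSpace ℝ (Fin N))).toSphere Set.univ *
        ∫⁻ s in Set.Ioi 0, ENNReal.ofReal (Real.sinh s ^ (N - 1)) * F s := by
  rw [lintegral_vol hN (F := fun x => F (dist0 x)) (hF.comp measurable_dist0)]
  have : ∀ θ : Metric.sphere (0 : EuclideanSpace ℝ (Fin N)) 1,
      ∫⁻ s, F (dist0 (polar (θ, s))) ∂radialMeasure N =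
        ∫⁻ s in Set.Ioi 0, ENNReal.ofReal (Real.sinh s ^ (N - 1)) * F s := by
    intro θ
    rw [lintegral_radialMeasure]
    refine setLIntegral_congr_fun measurableSet_Ioi fun s hs => ?_
    simp only [polar, dist0_radius_smul (le_of_lt hs)]
  simp only [this]
  rw [lintegral_const, mul_comm]

theorem norm_inv_smul_self {x : EuclideanSpace ℝ (Fin N)} (h0 : x ≠ 0) : ‖‖x‖⁻¹ • x‖ = 1 := by
  rw [norm_smul, norm_inv, norm_norm, inv_mul_cancel₀ (norm_ne_zero_iff.2 h0)]

/-- The hyperbolic gradient of the radial function with profile `tail k f`. -/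
noncomputable def radialGrad (N : ℕ) (k f : ℝ → ℝ) (x : EuclideanSpace ℝ (Fin N)) :
    EuclideanSpace ℝ (Fin N) :=
  (-(k (dist0 x) * f (dist0 x))) • (‖x‖⁻¹ • x)

theorem measurable_hypKernel (n : ℕ) (α : ℝ) : Measurable (hypKernel n α) := by
  unfold hypKernel
  exact (((measurable_id.pow_const α).mul (Real.continuous_sinh.measurable.pow_const n)).sqrt).inv

theorem measurable_radialGrad {k f : ℝ → ℝ} (hk : Measurable k) (hf : Measurable f) :
    Measurable (radialGrad N k f) := by
  have h1 : Measurable fun x : EuclideanSpace ℝ (Fin N) => k (dist0 x) * f (dist0 x) :=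
    (hk.comp measurable_dist0).mul (hf.comp measurable_dist0)
  exact h1.neg.smul (measurable_norm.inv.smul measurable_id)

theorem sinh_pow_mul_rpow_mul_hypKernel_sq (n : ℕ) (α : ℝ) {s : ℝ} (hs : 0 < s) :
    Real.sinh s ^ n * (s ^ α * hypKernel n α s ^ 2) = 1 := by
  rw [hypKernel_sq n α hs, ← mul_assoc, mul_comm (Real.sinh s ^ n)]
  exact mul_inv_cancel₀ (hypWeight_pos n α hs).ne'

/-- Radial functions whose profile is a tail integral belong to the energy space. -/
theorem memH10_radial (hN : 3 ≤ N) {α : ℝ} (hγ : 0 < ((N - 1 : ℕ) : ℝ) - 1 + α) {f : ℝ → ℝ}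
    (hfm : Measurable f) (hf : MemLp f 2 (volume.restrict (Set.Ioi 0))) :
    MemH10 α (fun x : EuclideanSpace ℝ (Fin N) => tail (hypKernel (N - 1) α) f (dist0 x))
      (radialGrad N (hypKernel (N - 1) α) f) := by
  set k := hypKernel (N - 1) α with hkd
  have hk : IsTailKernel k := isTailKernel_hypKernel hγ
  obtain ⟨h, hh, hlim⟩ := exists_smooth_div_kernel_tendsto hk hf
  have hmem : ∀ n, MemLp (fun t => h n t / k t) 2 (volume.restrict (Set.Ioi 0)) := fun n =>
    memLp_div_kernel hk (hh n).1.continuous (hh n).2.1 (hh n).2.2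
  refine ⟨(measurable_radialGrad (measurable_hypKernel _ _) hfm).aestronglyMeasurable,
    fun n => radialTest N (h n),
    fun n => isTestFunction_radialTest (hh n).1 (hh n).2.1 (hh n).2.2, ?_, ?_⟩
  · have key : ∀ n, ∫⁻ x, ENNReal.ofReal (dist0 x ^ α *
        ‖hgrad (radialTest N (h n)) x - radialGrad N k f x‖ ^ 2) ∂vol N =
        (volume : Measure (EuclideanSpace ℝ (Fin N))).toSphere Set.univ *
          ENNReal.ofReal (∫ t in Set.Ioi 0, (h n t / k t - f t) ^ 2) := by
      intro n
      have hm : Measurable fun s => ENNReal.ofReal (s ^ α * (h n s - k s * f s) ^ 2) :=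
        ((measurable_id.pow_const α).mul (((hh n).1.continuous.measurable.sub
          ((measurable_hypKernel _ _).mul hfm)).pow_const 2)).ennreal_ofReal
      rw [lintegral_congr_ae (g := fun x => ENNReal.ofReal (dist0 x ^ α *
        (h n (dist0 x) - k (dist0 x) * f (dist0 x)) ^ 2)), lintegral_vol_radial hN hm]
      · congr 1
        rw [ofReal_integral_eq_lintegral_ofReal (f := fun t => (h n t / k t - f t) ^ 2)
          ((hmem n).sub hf).integrable_sq (Eventually.of_forall fun _ => sq_nonneg _)]
        refine setLIntegral_congr_fun measurableSet_Ioi fun s hs => ?_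
        have hks := hk.pos s hs
        have e := sinh_pow_mul_rpow_mul_hypKernel_sq (N - 1) α hs
        rw [← ENNReal.ofReal_mul (pow_nonneg (Real.sinh_pos_iff.2 hs).le _)]
        congr 1
        rw [← hkd] at e
        have e2 : h n s - k s * f s = k s * (h n s / k s - f s) := by field_simp
        rw [e2]
        linear_combination (h n s / k s - f s) ^ 2 * e
      · filter_upwards [ae_vol_mem hN] with x hx
        rw [hgrad_radialTest (hh n).1 (hh n).2.1 hx.1 hx.2, radialGrad, ← sub_smul, norm_smul,
          norm_inv_smul_self hx.2, mul_one, Real.norm_eq_abs, sq_abs]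
        congr 2; ring
    simp only [key]
    have h1 := ENNReal.tendsto_ofReal hlim
    rw [ENNReal.ofReal_zero] at h1
    have h2 := ENNReal.Tendsto.const_mul h1 (Or.inr (measure_ne_top
      (volume : Measure (EuclideanSpace ℝ (Fin N))).toSphere Set.univ))
    simpa using h2
  · filter_upwards [ae_vol_mem hN] with x hx
    have hd := dist0_pos hx.1 hx.2
    rw [tendsto_iff_norm_sub_tendsto_zero]
    have hb : ∀ n, ‖radialTest N (h n) x - tail k f (dist0 x)‖ ≤
        √(∫ t in Set.Ioi (dist0 x), k t ^ 2) * √(∫ t in Set.Ioi 0, (h n t / k t - f t) ^ 2) := by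
      intro n
      have h1 := abs_tail_le_sqrt hk ((hmem n).sub hf) hd
      have h2 : tail k ((fun t => h n t / k t) - f) (dist0 x) =
          radialTest N (h n) x - tail k f (dist0 x) := by
        rw [radialTest_of_mem hx.1, ← tail_div_kernel hk hd, sub_eq_add_neg,
          ← neg_one_smul ℝ f, tail_add hk (hmem n) (hf.const_smul _) hd, tail_smul]
        ring
      rw [h2] at h1
      exact h1
    refine squeeze_zero (fun n => norm_nonneg _) hb ?_
    have h3 := (Real.continuous_sqrt.tendsto 0).comp hlim
    rw [Real.sqrt_zero] at h3
    simpa using h3.const_mul (√(∫ t in Set.Ioi (dist0 x), k t ^ 2))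

end PoincareBall

namespace PoincareBall

open HalfLine

variable {N : ℕ}

theorem hypWeight_integrableOn_Ioc {n : ℕ} {p R : ℝ} (hp : -1 < p + n) (hR : 0 < R) :
    IntegrableOn (hypWeight n p) (Set.Ioc 0 R) := by
  have h1 : IntegrableOn (fun s : ℝ => s ^ (p + n) * (Real.sinh R / R) ^ n) (Set.Ioc 0 R) :=
    ((intervalIntegrable_iff_integrableOn_Ioc_of_le hR.le).1
      (intervalIntegral.intervalIntegrable_rpow' hp)).mul_const _
  refine h1.mono' (((continuousOn_hypWeight n p).mono fun s hs => hs.1).aestronglyMeasurable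
    measurableSet_Ioc) ?_
  filter_upwards [ae_restrict_mem measurableSet_Ioc] with s hs
  rw [Real.norm_of_nonneg (hypWeight_pos n p hs.1).le, hypWeight_eq n p hs.1]
  have := sinh_div_self_pos hs.1
  have := Real.rpow_nonneg hs.1.le (p + n)
  exact mul_le_mul_of_nonneg_left
    (pow_le_pow_left₀ (by positivity) (sinh_div_self_mono hs.1 hs.2) n) (by positivity)

theorem continuous_hgrad {φ : EuclideanSpace ℝ (Fin N) → ℝ} (hφ : IsTestFunction φ) :
    Continuous (hgrad φ) := by
  have h1 : Continuous fun x : EuclideanSpace ℝ (Fin N) => (rho x)⁻¹ := by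
    simp only [rho, inv_div]; fun_prop
  have h2 : Continuous (gradient φ) := by
    unfold gradient
    exact (LinearIsometryEquiv.continuous _).comp (hφ.smooth.continuous_fderiv (by simp))
  exact h1.smul h2

theorem hgrad_eq_zero_of_notMem_tsupport {φ : EuclideanSpace ℝ (Fin N) → ℝ}
    {x : EuclideanSpace ℝ (Fin N)} (hx : x ∉ tsupport φ) : hgrad φ x = 0 := by
  have h : fderiv ℝ φ x = 0 := by
    by_contra h
    exact hx (support_fderiv_subset ℝ h)
  rw [hgrad, gradient, h, map_zero, smul_zero]

theorem exists_norm_hgrad_le {φ : EuclideanSpace ℝ (Fin N) → ℝ} (hφ : IsTestFunction φ) :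
    ∃ M, ∀ x, ‖hgrad φ x‖ ≤ M :=
  (HasCompactSupport.of_support_subset_isCompact hφ.compact.isCompact fun _ hx =>
    not_not.1 fun h => hx (hgrad_eq_zero_of_notMem_tsupport h)).exists_bound_of_continuous
      (continuous_hgrad hφ)

theorem exists_radius_tsupport {φ : EuclideanSpace ℝ (Fin N) → ℝ} (hφ : IsTestFunction φ) :
    ∃ R, 0 < R ∧ ∀ x ∈ tsupport φ, dist0 x < R := by
  obtain ⟨r, hr, hs⟩ := exists_lt_subset_ball (isClosed_tsupport φ) hφ.support_subset
  have hmem : max r (1 / 2) ∈ radius '' Set.Ioi 0 := by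
    rw [image_radius_Ioi]
    exact ⟨lt_max_of_lt_right (by norm_num), max_lt hr (by norm_num)⟩
  obtain ⟨R, hR, hRr⟩ := hmem
  refine ⟨R, hR, fun x hx => ?_⟩
  rw [← strictMono_radius.lt_iff_lt, hRr, ← norm_eq_radius_dist0 (hφ.support_subset hx)]
  exact lt_max_of_lt_left (by simpa using hs hx)

theorem hasDerivAt_polar {φ : EuclideanSpace ℝ (Fin N) → ℝ} (hφ : IsTestFunction φ)
    (θ : Metric.sphere (0 : EuclideanSpace ℝ (Fin N)) 1) {s : ℝ} (hs : 0 ≤ s) :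
    HasDerivAt (fun s => φ (polar (θ, s)))
      (inner ℝ (hgrad φ (polar (θ, s))) (θ : EuclideanSpace ℝ (Fin N))) s := by
  have h1 : HasDerivAt (fun s => polar (θ, s))
      ((rho (polar (θ, s)))⁻¹ • (θ : EuclideanSpace ℝ (Fin N))) s :=
    (hasDerivAt_radius s (norm_radius_smul hs θ)).smul_const (θ : EuclideanSpace ℝ (Fin N))
  have h2 := ((hφ.smooth.differentiable (by simp)) (polar (θ, s))).hasGradientAt.hasFDerivAt
  refine (h2.comp_hasDerivAt s h1).congr_deriv ?_
  simp [hgrad, inner_smul_left]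

/-- The function whose tail integral is `φ` along the ray in direction `θ`. -/
noncomputable def rayDensity (α : ℝ) (φ : EuclideanSpace ℝ (Fin N) → ℝ)
    (θ : Metric.sphere (0 : EuclideanSpace ℝ (Fin N)) 1) (s : ℝ) : ℝ :=
  -(inner ℝ (hgrad φ (polar (θ, s))) (θ : EuclideanSpace ℝ (Fin N))) / hypKernel (N - 1) α s

theorem rayDensity_sq_le (α : ℝ) (φ : EuclideanSpace ℝ (Fin N) → ℝ)
    (θ : Metric.sphere (0 : EuclideanSpace ℝ (Fin N)) 1) {s : ℝ} (hs : 0 < s) :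
    rayDensity α φ θ s ^ 2 ≤ Real.sinh s ^ (N - 1) * (s ^ α * ‖hgrad φ (polar (θ, s))‖ ^ 2) := by
  have h1 := abs_real_inner_le_norm (hgrad φ (polar (θ, s))) (θ : EuclideanSpace ℝ (Fin N))
  rw [norm_eq_of_mem_sphere, mul_one] at h1
  rw [rayDensity, div_pow, hypKernel_sq _ _ hs, neg_sq, div_inv_eq_mul]
  have h2 := hypWeight_pos (N - 1) α hs
  have h3 : inner ℝ (hgrad φ (polar (θ, s))) (θ : EuclideanSpace ℝ (Fin N)) ^ 2 ≤
      ‖hgrad φ (polar (θ, s))‖ ^ 2 := by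
    rw [← sq_abs]; gcongr
  calc _ ≤ ‖hgrad φ (polar (θ, s))‖ ^ 2 * hypWeight (N - 1) α s := by
        exact mul_le_mul_of_nonneg_right h3 h2.le
    _ = _ := by rw [hypWeight]; ring

theorem continuousOn_rayDensity {α : ℝ} {φ : EuclideanSpace ℝ (Fin N) → ℝ} (hφ : IsTestFunction φ)
    (θ : Metric.sphere (0 : EuclideanSpace ℝ (Fin N)) 1) :
    ContinuousOn (rayDensity α φ θ) (Set.Ioi 0) := by
  refine ContinuousOn.div ?_ (continuousOn_hypKernel _ _) fun s hs => (hypKernel_pos _ _ hs).ne'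
  exact (((continuous_hgrad hφ).comp (continuous_polar.comp
    (Continuous.prodMk_right θ))).inner continuous_const).neg.continuousOn

theorem polar_notMem_tsupport {φ : EuclideanSpace ℝ (Fin N) → ℝ} {R : ℝ} (hR : 0 < R)
    (h : ∀ x ∈ tsupport φ, dist0 x < R) (θ : Metric.sphere (0 : EuclideanSpace ℝ (Fin N)) 1)
    {s : ℝ} (hs : R < s) : polar (θ, s) ∉ tsupport φ := fun hx => by
  have := h _ hx
  rw [polar, dist0_radius_smul (hR.trans hs).le] at this
  linarith

theorem memLp_rayDensity {α : ℝ} (hα : -1 < α + (N - 1 : ℕ)) {φ : EuclideanSpace ℝ (Fin N) → ℝ}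
    (hφ : IsTestFunction φ) (θ : Metric.sphere (0 : EuclideanSpace ℝ (Fin N)) 1) :
    MemLp (rayDensity α φ θ) 2 (volume.restrict (Set.Ioi 0)) := by
  have hm := (continuousOn_rayDensity (α := α) hφ θ).aestronglyMeasurable (μ := volume)
    measurableSet_Ioi
  obtain ⟨M, hM⟩ := exists_norm_hgrad_le hφ
  obtain ⟨R, hR, hsupp⟩ := exists_radius_tsupport hφ
  refine (memLp_two_iff_integrable_sq hm).2 ?_
  have h1 := IntegrableOn.integrable_indicator
    ((hypWeight_integrableOn_Ioc hα hR).mul_const (M ^ 2)) measurableSet_Ioc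
  refine h1.integrableOn.mono' (hm.pow 2) ?_
  filter_upwards [ae_restrict_mem measurableSet_Ioi] with s hs
  rw [Real.norm_of_nonneg (sq_nonneg _)]
  by_cases hsR : s ≤ R
  · rw [Set.indicator_of_mem (Set.mem_Ioc.2 ⟨hs, hsR⟩)]
    refine (rayDensity_sq_le α φ θ hs).trans ?_
    have h2 := hypWeight_pos (N - 1) α hs
    calc _ = hypWeight (N - 1) α s * ‖hgrad φ (polar (θ, s))‖ ^ 2 := by rw [hypWeight]; ring
      _ ≤ _ := by gcongr; exact hM _
  · rw [Set.indicator_of_notMem fun h => hsR h.2, rayDensity, hgrad_eq_zero_of_notMem_tsupport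
      (polar_notMem_tsupport hR hsupp θ (not_le.1 hsR))]
    simp

theorem tail_rayDensity {α : ℝ} (hγ : 0 < ((N - 1 : ℕ) : ℝ) - 1 + α)
    {φ : EuclideanSpace ℝ (Fin N) → ℝ} (hφ : IsTestFunction φ)
    (θ : Metric.sphere (0 : EuclideanSpace ℝ (Fin N)) 1) {s : ℝ} (hs : 0 < s) :
    tail (hypKernel (N - 1) α) (rayDensity α φ θ) s = φ (polar (θ, s)) := by
  have hk := isTailKernel_hypKernel hγ
  obtain ⟨R, hR, hsupp⟩ := exists_radius_tsupport hφ
  have hi := integrableOn_tail hk (memLp_rayDensity (α := α) (by linarith) hφ θ) hs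
  have he : ∀ t ∈ Set.Ioi s, hypKernel (N - 1) α t * rayDensity α φ θ t =
      -inner ℝ (hgrad φ (polar (θ, t))) (θ : EuclideanSpace ℝ (Fin N)) := fun t ht =>
    mul_div_cancel₀ _ (hypKernel_pos _ _ (hs.trans ht)).ne'
  have h0 : Tendsto (fun t => φ (polar (θ, t))) atTop (𝓝 0) := by
    refine tendsto_const_nhds.congr' ?_
    filter_upwards [eventually_gt_atTop R] with t ht
    exact (image_eq_zero_of_notMem_tsupport (polar_notMem_tsupport hR hsupp θ ht)).symm
  have h1 := integral_Ioi_of_hasDerivAt_of_tendsto'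
    (fun t (ht : t ∈ Set.Ici s) => (hasDerivAt_polar hφ θ (hs.le.trans ht)))
    ((hi.congr_fun he measurableSet_Ioi).neg.congr_fun (fun t _ => by simp) measurableSet_Ioi) h0
  rw [tail, setIntegral_congr_fun measurableSet_Ioi he, integral_neg, h1]
  ring

/-- The square of the norm of `L²(d^α dV)`, for vector fields. -/
noncomputable def energy (α : ℝ) (G : EuclideanSpace ℝ (Fin N) → EuclideanSpace ℝ (Fin N)) :
    ENNReal := ∫⁻ x, ENNReal.ofReal (dist0 x ^ α * ‖G x‖ ^ 2) ∂vol N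

theorem lintegral_rayDensity_sq_le (hN : 3 ≤ N) {α : ℝ} {φ : EuclideanSpace ℝ (Fin N) → ℝ}
    (hφ : IsTestFunction φ) :
    ∫⁻ θ, (∫⁻ s in Set.Ioi 0, ENNReal.ofReal (rayDensity α φ θ s ^ 2))
      ∂(volume : Measure (EuclideanSpace ℝ (Fin N))).toSphere ≤ energy α (hgrad φ) := by
  have hm : Measurable fun x : EuclideanSpace ℝ (Fin N) =>
      ENNReal.ofReal (dist0 x ^ α * ‖hgrad φ x‖ ^ 2) :=
    ((measurable_dist0.pow_const α).mul
      ((continuous_hgrad hφ).measurable.norm.pow_const 2)).ennreal_ofReal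
  rw [energy, lintegral_vol hN hm]
  refine lintegral_mono fun θ => ?_
  rw [lintegral_radialMeasure]
  refine setLIntegral_mono' measurableSet_Ioi fun s hs => ?_
  rw [← ENNReal.ofReal_mul (pow_nonneg (Real.sinh_pos_iff.2 hs).le _)]
  refine ENNReal.ofReal_le_ofReal ((rayDensity_sq_le α φ θ hs).trans ?_)
  rw [polar, dist0_radius_smul (le_of_lt hs)]

theorem energy_hgrad_lt_top (hN : 3 ≤ N) {α : ℝ} (hα : -1 < α + (N - 1 : ℕ))
    {φ : EuclideanSpace ℝ (Fin N) → ℝ} (hφ : IsTestFunction φ) : energy α (hgrad φ) < ⊤ := by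
  obtain ⟨M, hM⟩ := exists_norm_hgrad_le hφ
  obtain ⟨R, hR, hsupp⟩ := exists_radius_tsupport hφ
  set F : ℝ → ENNReal := (Set.Ioc 0 R).indicator fun s => ENNReal.ofReal (s ^ α * M ^ 2) with hF
  have hFm : Measurable F :=
    ((measurable_id.pow_const α).mul_const _).ennreal_ofReal.indicator measurableSet_Ioc
  have h1 : energy α (hgrad φ) ≤ ∫⁻ x : EuclideanSpace ℝ (Fin N), F (dist0 x) ∂vol N := by
    refine lintegral_mono_ae ?_
    filter_upwards [ae_vol_mem hN] with x hx
    have hd := dist0_pos hx.1 hx.2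
    by_cases hxs : x ∈ tsupport φ
    · rw [hF, Set.indicator_of_mem (Set.mem_Ioc.2 ⟨hd, (hsupp x hxs).le⟩)]
      have := Real.rpow_nonneg hd.le α
      gcongr; exact hM x
    · simp [hgrad_eq_zero_of_notMem_tsupport hxs]
  refine h1.trans_lt ?_
  rw [lintegral_vol_radial hN hFm]
  refine ENNReal.mul_lt_top (measure_lt_top _ _) ?_
  have h2 := IntegrableOn.integrable_indicator
    ((hypWeight_integrableOn_Ioc hα hR).mul_const (M ^ 2)) measurableSet_Ioc
  refine lt_of_le_of_lt ?_ (h2.integrableOn (s := Set.Ioi 0)).lintegral_lt_top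
  refine setLIntegral_mono' measurableSet_Ioi fun s hs => ?_
  by_cases hsR : s ≤ R
  · have hmem := Set.mem_Ioc.2 ⟨hs, hsR⟩
    rw [hF, Set.indicator_of_mem hmem, Set.indicator_of_mem hmem,
      ← ENNReal.ofReal_mul (pow_nonneg (Real.sinh_pos_iff.2 hs).le _), hypWeight]
    refine le_of_eq ?_
    congr 1; ring
  · rw [hF, Set.indicator_of_notMem fun h => hsR h.2]
    simp

end PoincareBall

theorem integrable_and_tendsto_integral {X : Type*} [MeasurableSpace X] {μ : Measure X}
    {F : ℕ → X → ℝ} {f : X → ℝ} (hf : AEStronglyMeasurable f μ) (hF : ∀ n, Integrable (F n) μ)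
    (h : Tendsto (fun n => ∫⁻ x, ‖F n x - f x‖ₑ ∂μ) atTop (𝓝 0)) :
    Integrable f μ ∧ Tendsto (fun n => ∫ x, F n x ∂μ) atTop (𝓝 (∫ x, f x ∂μ)) := by
  refine ⟨?_, tendsto_integral_of_L1 f hf (Eventually.of_forall hF) h⟩
  obtain ⟨n, hn⟩ := (h.eventually (gt_mem_nhds ENNReal.zero_lt_top)).exists
  have h1 : Integrable (fun x => F n x - f x) μ := ⟨(hF n).aestronglyMeasurable.sub hf, hn⟩
  exact ((hF n).sub h1).congr (Eventually.of_forall fun x => sub_sub_cancel _ _)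

theorem tendsto_zero_of_sq_le_mul {a b : ℕ → ENNReal} {C : ENNReal} (hC : C ≠ ⊤)
    (h : ∀ n, a n ^ 2 ≤ C * b n) (hb : Tendsto b atTop (𝓝 0)) : Tendsto a atTop (𝓝 0) := by
  have h1 : Tendsto (fun n => C * b n) atTop (𝓝 0) := by
    simpa using ENNReal.Tendsto.const_mul hb (Or.inr hC)
  have h2 := tendsto_of_tendsto_of_tendsto_of_le_of_le tendsto_const_nhds h1 (fun _ => zero_le) h
  have h3 := h2.ennrpow_const (1 / 2)
  rw [ENNReal.zero_rpow_of_pos (by norm_num)] at h3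
  refine h3.congr fun n => ?_
  rw [← ENNReal.rpow_natCast, ← ENNReal.rpow_mul]
  norm_num

namespace PoincareBall

open HalfLine

variable {N : ℕ} {α : ℝ}

theorem IsTestFunction.sub {φ ψ : EuclideanSpace ℝ (Fin N) → ℝ} (hφ : IsTestFunction φ)
    (hψ : IsTestFunction ψ) : IsTestFunction fun x => φ x - ψ x := by
  have h : tsupport (fun x => φ x - ψ x) ⊆ tsupport φ ∪ tsupport ψ := by
    refine closure_minimal (fun x hx => ?_) ((isClosed_tsupport φ).union (isClosed_tsupport ψ))
    by_contra hn
    rw [Set.mem_union, not_or] at hn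
    refine hx (sub_eq_zero.2 ?_)
    rw [image_eq_zero_of_notMem_tsupport hn.1, image_eq_zero_of_notMem_tsupport hn.2]
  exact ⟨hφ.smooth.sub hψ.smooth, (hφ.compact.isCompact.union hψ.compact.isCompact).of_isClosed_subset
    (isClosed_tsupport _) h, h.trans (Set.union_subset hφ.support_subset hψ.support_subset)⟩

theorem hgrad_sub {φ ψ : EuclideanSpace ℝ (Fin N) → ℝ} (hφ : IsTestFunction φ)
    (hψ : IsTestFunction ψ) (x : EuclideanSpace ℝ (Fin N)) :
    hgrad (fun x => φ x - ψ x) x = hgrad φ x - hgrad ψ x := by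
  have h1 := hφ.smooth.differentiable (by simp) x
  have h2 := hψ.smooth.differentiable (by simp) x
  rw [hgrad, hgrad, hgrad, ← smul_sub, gradient, fderiv_fun_sub h1 h2, map_sub, gradient, gradient]

theorem dist0_nonneg {x : EuclideanSpace ℝ (Fin N)} (hx : x ∈ ball N) : 0 ≤ dist0 x := by
  have h1 : ‖x‖ < 1 := by simpa [ball] using hx
  have h3 : 0 < 1 - ‖x‖ := by linarith
  refine Real.log_nonneg ?_
  rw [le_div_iff₀ h3]; linarith [norm_nonneg x]

theorem energy_add_le (hN : 3 ≤ N) {A B : EuclideanSpace ℝ (Fin N) → EuclideanSpace ℝ (Fin N)}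
    (hA : AEStronglyMeasurable A (vol N)) :
    energy α (fun x => A x + B x) ≤ 2 * energy α A + 2 * energy α B := by
  have hm : AEMeasurable (fun x => 2 * ENNReal.ofReal (dist0 x ^ α * ‖A x‖ ^ 2)) (vol N) :=
    (((measurable_dist0.pow_const α).aemeasurable.mul
      (hA.norm.aemeasurable.pow_const 2)).ennreal_ofReal).const_mul 2
  rw [energy, energy, energy, ← lintegral_const_mul' _ _ ENNReal.ofNat_ne_top,
    ← lintegral_const_mul' _ _ ENNReal.ofNat_ne_top, ← lintegral_add_left' hm]
  refine lintegral_mono_ae ?_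
  filter_upwards [ae_vol_mem hN] with x hx
  have hd := Real.rpow_nonneg (dist0_nonneg hx.1) α
  have h2 : ∀ c : ℝ, 2 * ENNReal.ofReal c = ENNReal.ofReal (2 * c) := fun c => by
    rw [ENNReal.ofReal_mul zero_le_two, ENNReal.ofReal_ofNat]
  rw [h2, h2, ← ENNReal.ofReal_add (by positivity) (by positivity)]
  refine ENNReal.ofReal_le_ofReal ?_
  have h1 := norm_add_le (A x) (B x)
  have h2 : ‖A x + B x‖ ^ 2 ≤ 2 * ‖A x‖ ^ 2 + 2 * ‖B x‖ ^ 2 := by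
    nlinarith [norm_nonneg (A x + B x), sq_nonneg (‖A x‖ - ‖B x‖)]
  calc _ ≤ dist0 x ^ α * (2 * ‖A x‖ ^ 2 + 2 * ‖B x‖ ^ 2) := by gcongr
    _ = _ := by ring

theorem energy_sub_comm (A B : EuclideanSpace ℝ (Fin N) → EuclideanSpace ℝ (Fin N)) :
    energy α (fun x => A x - B x) = energy α (fun x => B x - A x) := by
  simp only [energy, norm_sub_rev]

/-- Cauchy–Schwarz in `L²(d^α dV)`. -/
theorem lintegral_inner_sq_le (hN : 3 ≤ N)
    {A B : EuclideanSpace ℝ (Fin N) → EuclideanSpace ℝ (Fin N)}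
    (hA : AEStronglyMeasurable A (vol N)) (hB : AEStronglyMeasurable B (vol N)) :
    (∫⁻ x, ‖dist0 x ^ α * inner ℝ (A x) (B x)‖ₑ ∂vol N) ^ 2 ≤ energy α A * energy α B := by
  have hd := (measurable_dist0 (N := N)).pow_const α
  have hm : ∀ G : EuclideanSpace ℝ (Fin N) → EuclideanSpace ℝ (Fin N),
      AEStronglyMeasurable G (vol N) →
      AEMeasurable (fun x => ENNReal.ofReal (√(dist0 x ^ α) * ‖G x‖)) (vol N) := fun G hG =>
    (hd.sqrt.aemeasurable.mul hG.norm.aemeasurable).ennreal_ofReal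
  have he : ∀ G : EuclideanSpace ℝ (Fin N) → EuclideanSpace ℝ (Fin N),
      ∫⁻ x, ENNReal.ofReal (√(dist0 x ^ α) * ‖G x‖) ^ 2 ∂vol N = energy α G := fun G => by
    refine lintegral_congr_ae ?_
    filter_upwards [ae_vol_mem hN] with x hx
    rw [← ENNReal.ofReal_pow (by positivity), mul_pow,
      Real.sq_sqrt (Real.rpow_nonneg (dist0_nonneg hx.1) α)]
  have h := lintegral_mul_sq_le (vol N) (hm A hA) (hm B hB)
  rw [he, he] at h
  refine le_trans ?_ h
  gcongr ?_ ^ 2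
  refine lintegral_mono_ae ?_
  filter_upwards [ae_vol_mem hN] with x hx
  have hdx := Real.rpow_nonneg (dist0_nonneg hx.1) α
  rw [← ENNReal.ofReal_mul (by positivity), Real.enorm_eq_ofReal_abs]
  refine ENNReal.ofReal_le_ofReal ?_
  rw [abs_mul, abs_of_nonneg hdx]
  have := Real.mul_self_sqrt hdx
  calc _ ≤ dist0 x ^ α * (‖A x‖ * ‖B x‖) := by gcongr; exact abs_real_inner_le_norm _ _
    _ = (√(dist0 x ^ α) * √(dist0 x ^ α)) * (‖A x‖ * ‖B x‖) := by rw [this]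
    _ = _ := by ring

theorem MemH10.energy_lt_top (hN : 3 ≤ N) (hα : -1 < α + (N - 1 : ℕ))
    {u : EuclideanSpace ℝ (Fin N) → ℝ} {G : EuclideanSpace ℝ (Fin N) → EuclideanSpace ℝ (Fin N)}
    (h : MemH10 α u G) : energy α G < ⊤ := by
  obtain ⟨φ, hφ, hlim, -⟩ := h.approx
  obtain ⟨n, hn⟩ := (hlim.eventually (gt_mem_nhds ENNReal.zero_lt_top)).exists
  have h1 := energy_add_le (α := α) hN (A := hgrad (φ n)) (B := fun x => G x - hgrad (φ n) x)
    (continuous_hgrad (hφ n)).aestronglyMeasurable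
  simp only [add_sub_cancel] at h1
  refine h1.trans_lt (ENNReal.add_lt_top.2 ⟨ENNReal.mul_lt_top ENNReal.ofNat_lt_top
    (energy_hgrad_lt_top hN hα (hφ n)), ENNReal.mul_lt_top ENNReal.ofNat_lt_top ?_⟩)
  rw [energy_sub_comm]; exact hn

theorem integrable_inner (hN : 3 ≤ N)
    {A B : EuclideanSpace ℝ (Fin N) → EuclideanSpace ℝ (Fin N)}
    (hA : AEStronglyMeasurable A (vol N)) (hB : AEStronglyMeasurable B (vol N))
    (hA' : energy α A < ⊤) (hB' : energy α B < ⊤) :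
    Integrable (fun x => dist0 x ^ α * inner ℝ (A x) (B x)) (vol N) := by
  refine ⟨((measurable_dist0.pow_const α).aestronglyMeasurable).mul (hA.inner hB), ?_⟩
  have h := (lintegral_inner_sq_le (α := α) hN hA hB).trans_lt (ENNReal.mul_lt_top hA' hB')
  exact (ENNReal.pow_lt_top_iff.1 h).resolve_right two_ne_zero

theorem tendsto_integral_inner (hN : 3 ≤ N)
    {A B : EuclideanSpace ℝ (Fin N) → EuclideanSpace ℝ (Fin N)}
    {Bn : ℕ → EuclideanSpace ℝ (Fin N) → EuclideanSpace ℝ (Fin N)}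
    (hA : AEStronglyMeasurable A (vol N)) (hB : AEStronglyMeasurable B (vol N))
    (hBn : ∀ n, AEStronglyMeasurable (Bn n) (vol N))
    (hA' : energy α A < ⊤) (hBn' : ∀ n, energy α (Bn n) < ⊤)
    (h : Tendsto (fun n => energy α fun x => Bn n x - B x) atTop (𝓝 0)) :
    Tendsto (fun n => ∫ x, dist0 x ^ α * inner ℝ (A x) (Bn n x) ∂vol N) atTop
      (𝓝 (∫ x, dist0 x ^ α * inner ℝ (A x) (B x) ∂vol N)) := by
  refine (integrable_and_tendsto_integral
    (((measurable_dist0.pow_const α).aestronglyMeasurable).mul (hA.inner hB))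
    (fun n => integrable_inner hN hA (hBn n) hA' (hBn' n)) ?_).2
  refine tendsto_zero_of_sq_le_mul hA'.ne (fun n => ?_) h
  refine le_trans (le_of_eq ?_) (lintegral_inner_sq_le (α := α) hN hA ((hBn n).sub hB))
  congr 1
  refine lintegral_congr fun x => ?_
  rw [Pi.mul_apply, inner_sub_right, mul_sub]

/-- A radial weight `W` such that `φ ↦ ∫ W φ` is bounded for the energy norm on every ray, with
constant `√C`. -/
structure IsControlled (n : ℕ) (k W : ℝ → ℝ) (C : ENNReal) : Prop where
  cont : ContinuousOn W (Set.Ioi 0)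
  ne_top : C ≠ ⊤
  bound : ∀ g, MemLp g 2 (volume.restrict (Set.Ioi 0)) →
    (∫⁻ s in Set.Ioi 0, ENNReal.ofReal (Real.sinh s ^ n) * ‖W s * tail k g s‖ₑ) ^ 2 ≤
      C * ∫⁻ s in Set.Ioi 0, ENNReal.ofReal (g s ^ 2)

theorem exists_measurable_eqOn {W : ℝ → ℝ} (hW : ContinuousOn W (Set.Ioi 0)) :
    ∃ W' : ℝ → ℝ, Measurable W' ∧ ∀ s, 0 < s → W' s = W s := by
  classical
  exact ⟨(Set.Ioi 0).piecewise W 0, hW.measurable_piecewise continuousOn_const measurableSet_Ioi,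
    fun s hs => Set.piecewise_eq_of_mem _ _ _ hs⟩

theorem aestronglyMeasurable_comp_dist0 (hN : 3 ≤ N) {W : ℝ → ℝ} (hW : ContinuousOn W (Set.Ioi 0)) :
    AEStronglyMeasurable (fun x : EuclideanSpace ℝ (Fin N) => W (dist0 x)) (vol N) := by
  obtain ⟨W', hm, he⟩ := exists_measurable_eqOn hW
  refine (hm.comp measurable_dist0).aestronglyMeasurable.congr ?_
  filter_upwards [ae_vol_mem hN] with x hx
  exact he _ (dist0_pos hx.1 hx.2)

theorem IsControlled.lintegral_sq_le (hN : 3 ≤ N) (hγ : 0 < ((N - 1 : ℕ) : ℝ) - 1 + α)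
    {W : ℝ → ℝ} {C : ENNReal} (hW : IsControlled (N - 1) (hypKernel (N - 1) α) W C)
    {φ : EuclideanSpace ℝ (Fin N) → ℝ} (hφ : IsTestFunction φ) :
    (∫⁻ x, ‖W (dist0 x) * φ x‖ₑ ∂vol N) ^ 2 ≤
      C * (volume : Measure (EuclideanSpace ℝ (Fin N))).toSphere Set.univ *
        energy α (hgrad φ) := by
  obtain ⟨W', hm, he⟩ := exists_measurable_eqOn hW.cont
  set S := (volume : Measure (EuclideanSpace ℝ (Fin N))).toSphere
  have hFm : Measurable fun x : EuclideanSpace ℝ (Fin N) => ‖W' (dist0 x) * φ x‖ₑ :=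
    ((hm.comp measurable_dist0).mul hφ.smooth.continuous.measurable).enorm
  have hae : ∫⁻ x, ‖W (dist0 x) * φ x‖ₑ ∂vol N = ∫⁻ x, ‖W' (dist0 x) * φ x‖ₑ ∂vol N := by
    refine lintegral_congr_ae ?_
    filter_upwards [ae_vol_mem hN] with x hx
    rw [he _ (dist0_pos hx.1 hx.2)]
  rw [hae, lintegral_vol hN hFm]
  set A : Metric.sphere (0 : EuclideanSpace ℝ (Fin N)) 1 → ENNReal := fun θ =>
    ∫⁻ s, ‖W' (dist0 (polar (θ, s))) * φ (polar (θ, s))‖ₑ ∂radialMeasure N with hA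
  have hAm : Measurable A := (hFm.comp continuous_polar.measurable).lintegral_prod_right'
  have hA2 : ∀ θ, A θ ^ 2 ≤ C * ∫⁻ s in Set.Ioi 0, ENNReal.ofReal (rayDensity α φ θ s ^ 2) := by
    intro θ
    refine le_trans (le_of_eq ?_)
      (hW.bound (rayDensity α φ θ) (memLp_rayDensity (by linarith) hφ θ))
    rw [hA]
    simp only [lintegral_radialMeasure]
    congr 1
    refine setLIntegral_congr_fun measurableSet_Ioi fun s hs => ?_
    rw [tail_rayDensity hγ hφ θ hs, polar, dist0_radius_smul (le_of_lt hs), he s hs]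
  have h1 := lintegral_mul_sq_le S hAm.aemeasurable (aemeasurable_const (b := (1 : ENNReal)))
  simp only [mul_one, one_pow, lintegral_one] at h1
  refine h1.trans ?_
  calc (∫⁻ θ, A θ ^ 2 ∂S) * S Set.univ
      ≤ (C * energy α (hgrad φ)) * S Set.univ := by
        gcongr
        refine (lintegral_mono hA2).trans ?_
        rw [lintegral_const_mul' _ _ hW.ne_top]
        gcongr
        exact lintegral_rayDensity_sq_le hN hφ
    _ = _ := by ring

theorem IsControlled.integrable_and_tendsto (hN : 3 ≤ N) (hγ : 0 < ((N - 1 : ℕ) : ℝ) - 1 + α)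
    {W : ℝ → ℝ} {C : ENNReal} (hW : IsControlled (N - 1) (hypKernel (N - 1) α) W C)
    {φ : ℕ → EuclideanSpace ℝ (Fin N) → ℝ} {v : EuclideanSpace ℝ (Fin N) → ℝ}
    {H : EuclideanSpace ℝ (Fin N) → EuclideanSpace ℝ (Fin N)}
    (hφ : ∀ n, IsTestFunction (φ n)) (hH : AEStronglyMeasurable H (vol N))
    (hlim : Tendsto (fun n => energy α fun x => hgrad (φ n) x - H x) atTop (𝓝 0))
    (hv : ∀ᵐ x ∂(vol N), Tendsto (fun n => φ n x) atTop (𝓝 (v x))) :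
    (∀ n, Integrable (fun x => W (dist0 x) * φ n x) (vol N)) ∧
    Integrable (fun x => W (dist0 x) * v x) (vol N) ∧
      Tendsto (fun n => ∫ x, W (dist0 x) * φ n x ∂vol N) atTop
        (𝓝 (∫ x, W (dist0 x) * v x ∂vol N)) := by
  set K := C * (volume : Measure (EuclideanSpace ℝ (Fin N))).toSphere Set.univ with hK
  have hKt : K ≠ ⊤ := ENNReal.mul_ne_top hW.ne_top (measure_ne_top _ _)
  have hWm := aestronglyMeasurable_comp_dist0 hN hW.cont
  have hφm : ∀ n, AEStronglyMeasurable (fun x => W (dist0 x) * φ n x) (vol N) := fun n =>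
    hWm.mul (hφ n).smooth.continuous.aestronglyMeasurable
  have h_int : ∀ n, Integrable (fun x => W (dist0 x) * φ n x) (vol N) := fun n => by
    refine ⟨hφm n, ?_⟩
    have := (hW.lintegral_sq_le hN hγ (hφ n)).trans_lt (ENNReal.mul_lt_top hKt.lt_top
      (energy_hgrad_lt_top hN (by linarith) (hφ n)))
    exact (ENNReal.pow_lt_top_iff.1 this).resolve_right two_ne_zero
  have hvm : AEStronglyMeasurable v (vol N) := aestronglyMeasurable_of_tendsto_ae atTop
    (fun n => (hφ n).smooth.continuous.aestronglyMeasurable) hv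
  refine ⟨h_int, integrable_and_tendsto_integral (hWm.mul hvm) h_int ?_⟩
  set δ : ℕ → ENNReal := fun n => energy α fun x => hgrad (φ n) x - H x
  have hcau : ∀ n m, (∫⁻ x, ‖W (dist0 x) * φ n x - W (dist0 x) * φ m x‖ₑ ∂vol N) ^ 2 ≤
      K * (2 * δ n + 2 * δ m) := by
    intro n m
    have h1 := hW.lintegral_sq_le hN hγ ((hφ n).sub (hφ m))
    simp only [mul_sub] at h1
    refine h1.trans ?_
    gcongr
    have h2 := energy_add_le (α := α) hN (A := fun x => hgrad (φ n) x - H x)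
      (B := fun x => H x - hgrad (φ m) x) ((continuous_hgrad (hφ n)).aestronglyMeasurable.sub hH)
    rw [energy_sub_comm H] at h2
    simp only [sub_add_sub_cancel] at h2
    refine le_trans (le_of_eq ?_) h2
    congr 1
    exact funext (hgrad_sub (hφ n) (hφ m))
  have hfatou : ∀ n, (∫⁻ x, ‖W (dist0 x) * φ n x - W (dist0 x) * v x‖ₑ ∂vol N) ^ 2 ≤
      (K * 2) * δ n := by
    intro n
    have hle : ∫⁻ x, ‖W (dist0 x) * φ n x - W (dist0 x) * v x‖ₑ ∂vol N ≤
        liminf (fun m => ∫⁻ x, ‖W (dist0 x) * φ n x - W (dist0 x) * φ m x‖ₑ ∂vol N) atTop := by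
      refine le_trans (le_of_eq (lintegral_congr_ae ?_)) (lintegral_liminf_le'
        (f := fun m x => ‖W (dist0 x) * φ n x - W (dist0 x) * φ m x‖ₑ)
        fun m => ((hφm n).sub (hφm m)).enorm)
      filter_upwards [hv] with x hx
      exact (((tendsto_const_nhds.sub (hx.const_mul (W (dist0 x)))).enorm).liminf_eq).symm
    have hr : Tendsto (fun m => (K * (2 * δ n + 2 * δ m)) ^ (1 / 2 : ℝ)) atTop
        (𝓝 ((K * (2 * δ n + 2 * 0)) ^ (1 / 2 : ℝ))) :=
      (ENNReal.Tendsto.const_mul (tendsto_const_nhds.add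
        (ENNReal.Tendsto.const_mul hlim (Or.inr ENNReal.ofNat_ne_top))) (Or.inr hKt)).ennrpow_const _
    have h2 : ∫⁻ x, ‖W (dist0 x) * φ n x - W (dist0 x) * v x‖ₑ ∂vol N ≤
        (K * (2 * δ n + 2 * 0)) ^ (1 / 2 : ℝ) := by
      rw [← hr.liminf_eq]
      refine hle.trans (liminf_le_liminf (Eventually.of_forall fun m => ?_))
      rw [one_div, ENNReal.le_rpow_inv_iff two_pos, ENNReal.rpow_two]
      exact hcau n m
    rw [one_div, ENNReal.le_rpow_inv_iff two_pos, ENNReal.rpow_two] at h2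
    refine h2.trans (le_of_eq ?_)
    rw [mul_zero, add_zero, mul_assoc K]
  exact tendsto_zero_of_sq_le_mul (ENNReal.mul_ne_top hKt ENNReal.ofNat_ne_top) hfatou hlim

end PoincareBall

namespace PoincareBall

open HalfLine

variable {N : ℕ} {α β lam q : ℝ} {f : ℝ → ℝ}

theorem sinh_pow_mul_enorm {n : ℕ} {s : ℝ} (hs : 0 < s) (a : ℝ) :
    ENNReal.ofReal (Real.sinh s ^ n) * ‖a‖ₑ = ENNReal.ofReal (Real.sinh s ^ n * |a|) := by
  rw [Real.enorm_eq_ofReal_abs, ENNReal.ofReal_mul (pow_nonneg (Real.sinh_pos_iff.2 hs).le _)]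

theorem exists_isControlled_hardy {n : ℕ} (hγ : 0 < (n : ℝ) - 1 + α)
    (hf : MemLp f 2 (volume.restrict (Set.Ioi 0))) :
    ∃ C, IsControlled n (hypKernel n α) (fun s => s ^ (α - 2) * tail (hypKernel n α) f s) C := by
  set k := hypKernel n α
  have hk : IsTailKernel k := isTailKernel_hypKernel hγ
  set D := ENNReal.ofReal ((2 / ((n : ℝ) - 1 + α)) ^ 2)
  refine ⟨(∫⁻ s in Set.Ioi 0, ENNReal.ofReal (hypWeight n (α - 2) s * tail k f s ^ 2)) * D, ?_, ?_,
    fun g hg => ?_⟩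
  · exact (continuousOn_id.rpow_const fun s hs => Or.inl (ne_of_gt hs)).mul (continuousOn_tail hk hf)
  · exact ENNReal.mul_ne_top (hardy hγ hf).1.lintegral_lt_top.ne ENNReal.ofReal_ne_top
  · have hm : ∀ g, MemLp g 2 (volume.restrict (Set.Ioi 0)) →
        AEMeasurable (fun s => ENNReal.ofReal (√(hypWeight n (α - 2) s) * |tail k g s|))
          (volume.restrict (Set.Ioi 0)) := fun g hg =>
      (((continuousOn_hypWeight n (α - 2)).sqrt.mul
        (continuousOn_tail hk hg).abs).aestronglyMeasurable measurableSet_Ioi).aemeasurable.ennreal_ofReal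
    have he : ∀ g : ℝ → ℝ,
        ∫⁻ s in Set.Ioi 0, ENNReal.ofReal (√(hypWeight n (α - 2) s) * |tail k g s|) ^ 2 =
          ∫⁻ s in Set.Ioi 0, ENNReal.ofReal (hypWeight n (α - 2) s * tail k g s ^ 2) := fun g => by
      refine setLIntegral_congr_fun measurableSet_Ioi fun s hs => ?_
      rw [← ENNReal.ofReal_pow (by positivity), mul_pow, sq_abs,
        Real.sq_sqrt (hypWeight_pos n _ hs).le]
    have h := lintegral_mul_sq_le _ (hm f hf) (hm g hg)
    rw [he, he] at h
    calc _ = _ := ?_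
      _ ≤ _ := h
      _ ≤ _ := mul_le_mul_right (lintegral_hardy hγ hg.aestronglyMeasurable) _
      _ = _ := (mul_assoc _ _ _).symm
    congr 1
    refine setLIntegral_congr_fun measurableSet_Ioi fun s hs => ?_
    have h1 := Real.mul_self_sqrt (hypWeight_pos n (α - 2) hs).le
    rw [sinh_pow_mul_enorm hs, ← ENNReal.ofReal_mul (by positivity), abs_mul, abs_mul,
      abs_of_nonneg (Real.rpow_nonneg (le_of_lt hs) _)]
    congr 1
    calc _ = hypWeight n (α - 2) s * (|tail k f s| * |tail k g s|) := by rw [hypWeight]; ring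
      _ = (√(hypWeight n (α - 2) s) * √(hypWeight n (α - 2) s)) *
          (|tail k f s| * |tail k g s|) := by rw [h1]
      _ = _ := by ring

theorem exists_isControlled_rpow {n : ℕ} {m₁ κ : ℝ → ℝ} {C : ℝ}
    (hw : IsAdapted (hypKernel n α) m₁ (hypWeight n β) κ q C) (hq : 2 < q)
    (hf : MemLp f 2 (volume.restrict (Set.Ioi 0))) :
    ∃ C, IsControlled n (hypKernel n α) (fun s => s ^ β * (|tail (hypKernel n α) f s| ^ (q - 2) *
      tail (hypKernel n α) f s)) C := by
  set k := hypKernel n α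
  have hT := continuousOn_tail hw.kernel hf
  set A := (∫ s in Set.Ioi 0, hypWeight n β s * κ s ^ q) *
    √(∫ t in Set.Ioi 0, f t ^ 2) ^ (q - 1) with hA
  have hA0 : 0 ≤ A := mul_nonneg (setIntegral_nonneg measurableSet_Ioi fun s hs =>
    mul_nonneg (hypWeight_pos n β hs).le (Real.rpow_nonneg (hw.kappa_nonneg s hs) _))
      (Real.rpow_nonneg (Real.sqrt_nonneg _) _)
  refine ⟨ENNReal.ofReal (A ^ 2), ?_, ENNReal.ofReal_ne_top, fun g hg => ?_⟩
  · exact (continuousOn_id.rpow_const fun s hs => Or.inl (ne_of_gt hs)).mul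
      ((hT.abs.rpow_const fun s _ => Or.inr (by linarith)).mul hT)
  · have hle : ∫⁻ s in Set.Ioi 0, ENNReal.ofReal (Real.sinh s ^ n) *
        ‖s ^ β * (|tail k f s| ^ (q - 2) * tail k f s) * tail k g s‖ₑ ≤
          ENNReal.ofReal (A * √(∫ t in Set.Ioi 0, g t ^ 2)) := by
      have hi := hw.integrable_kappa.mul_const (√(∫ t in Set.Ioi 0, f t ^ 2) ^ (q - 1) *
        √(∫ t in Set.Ioi 0, g t ^ 2))
      have e : A * √(∫ t in Set.Ioi 0, g t ^ 2) = ∫ s in Set.Ioi 0, hypWeight n β s * κ s ^ q *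
          (√(∫ t in Set.Ioi 0, f t ^ 2) ^ (q - 1) * √(∫ t in Set.Ioi 0, g t ^ 2)) := by
        rw [integral_mul_const, hA, mul_assoc]
      rw [e, ofReal_integral_eq_lintegral_ofReal hi]
      · refine setLIntegral_mono' measurableSet_Ioi fun s hs => ?_
        rw [sinh_pow_mul_enorm hs]
        refine ENNReal.ofReal_le_ofReal (le_trans (le_of_eq ?_)
          (norm_rpow_mul_tail_le hw hq hf hg hs))
        rw [← abs_of_nonneg (pow_nonneg (Real.sinh_pos_iff.2 hs).le n), ← abs_mul, hypWeight]
        congr 1; ring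
      · filter_upwards [ae_restrict_mem measurableSet_Ioi] with s hs
        exact mul_nonneg (mul_nonneg (hypWeight_pos n β hs).le
          (Real.rpow_nonneg (hw.kappa_nonneg s hs) _))
          (mul_nonneg (Real.rpow_nonneg (Real.sqrt_nonneg _) _) (Real.sqrt_nonneg _))
    calc _ ≤ _ := pow_le_pow_left' hle 2
      _ = _ := by
        rw [← ENNReal.ofReal_pow (by positivity), mul_pow, Real.sq_sqrt
          (integral_nonneg fun _ => sq_nonneg _), ENNReal.ofReal_mul (sq_nonneg A),
          ofReal_integral_eq_lintegral_ofReal hg.integrable_sq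
            (Eventually.of_forall fun _ => sq_nonneg _)]

theorem sinh_pow_mul_inner_radialGrad (φ : EuclideanSpace ℝ (Fin N) → ℝ)
    (θ : Metric.sphere (0 : EuclideanSpace ℝ (Fin N)) 1) {s : ℝ} (hs : 0 < s) :
    Real.sinh s ^ (N - 1) * (dist0 (polar (θ, s)) ^ α *
      inner ℝ (radialGrad N (hypKernel (N - 1) α) f (polar (θ, s))) (hgrad φ (polar (θ, s)))) =
        f s * rayDensity α φ θ s := by
  have hr := radius_pos hs
  have e := sinh_pow_mul_rpow_mul_hypKernel_sq (N - 1) α hs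
  have hk := hypKernel_pos (N - 1) α hs
  have h1 : dist0 (polar (θ, s)) = s := dist0_radius_smul hs.le θ
  have h2 : ‖polar (θ, s)‖⁻¹ • polar (θ, s) = (θ : EuclideanSpace ℝ (Fin N)) := by
    rw [polar, norm_radius_smul hs.le, smul_smul, inv_mul_cancel₀ hr.ne', one_smul]
  rw [radialGrad, h1, h2, inner_smul_left, real_inner_comm, rayDensity]
  set c := inner ℝ (hgrad φ (polar (θ, s))) (θ : EuclideanSpace ℝ (Fin N))
  simp only [conj_trivial]
  field_simp
  linear_combination (-(f s * c)) * e

theorem integrable_integral_polar (hN : 3 ≤ N) {h : EuclideanSpace ℝ (Fin N) → ℝ}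
    (hh : Integrable h (vol N)) :
    Integrable (fun θ => ∫ s in Set.Ioi 0, Real.sinh s ^ (N - 1) * h (polar (θ, s)))
      (volume : Measure (EuclideanSpace ℝ (Fin N))).toSphere := by
  rw [vol_eq_map hN] at hh
  have := (hh.comp_measurable continuous_polar.measurable).integral_prod_left
  simpa only [Function.comp_def, integral_radialMeasure] using this

/-- The weak formulation on the ball follows from the one on the half-line. -/
theorem isWeakSolution_radial (hN : 3 ≤ N) (hγ : 0 < ((N - 1 : ℕ) : ℝ) - 1 + α) {κ : ℝ → ℝ} {C : ℝ}
    (hw : IsAdapted (hypKernel (N - 1) α) (hypWeight (N - 1) (α - 2)) (hypWeight (N - 1) β) κ q C)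
    (hq : 2 < q) (hfm : Measurable f) (hf : MemLp f 2 (volume.restrict (Set.Ioi 0)))
    (hsol : ∀ g, MemLp g 2 (volume.restrict (Set.Ioi 0)) → ∫ s in Set.Ioi 0, f s * g s =
      lam * (∫ s in Set.Ioi 0, hypWeight (N - 1) (α - 2) s *
        (tail (hypKernel (N - 1) α) f s * tail (hypKernel (N - 1) α) g s)) +
      ∫ s in Set.Ioi 0, hypWeight (N - 1) β s * (|tail (hypKernel (N - 1) α) f s| ^ (q - 2) *
        tail (hypKernel (N - 1) α) f s * tail (hypKernel (N - 1) α) g s)) :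
    IsWeakSolution α β lam q
      (fun x : EuclideanSpace ℝ (Fin N) => tail (hypKernel (N - 1) α) f (dist0 x)) := by
  set k := hypKernel (N - 1) α with hkd
  have hα : -1 < α + (N - 1 : ℕ) := by linarith
  have hG := memH10_radial hN hγ hfm hf
  rw [← hkd] at hG
  have hGe := hG.energy_lt_top hN hα
  obtain ⟨C₁, hC₁⟩ := exists_isControlled_hardy hγ hf
  obtain ⟨C₂, hC₂⟩ := exists_isControlled_rpow hw hq hf
  refine ⟨radialGrad N k f, hG, fun v H hv => ?_⟩
  have hHe := hv.energy_lt_top hN hα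
  have hHm := hv.aestronglyMeasurable_grad
  obtain ⟨φ, hφ, hlim, hae⟩ := hv.approx
  have hφm : ∀ n, AEStronglyMeasurable (hgrad (φ n)) (vol N) := fun n =>
    (continuous_hgrad (hφ n)).aestronglyMeasurable
  have hφe : ∀ n, energy α (hgrad (φ n)) < ⊤ := fun n => energy_hgrad_lt_top hN hα (hφ n)
  have hi0 := fun n => integrable_inner hN hG.aestronglyMeasurable_grad (hφm n) hGe (hφe n)
  have ht0 := tendsto_integral_inner hN hG.aestronglyMeasurable_grad hHm hφm hGe hφe hlim
  obtain ⟨hi1, hI1, ht1⟩ := hC₁.integrable_and_tendsto hN hγ hφ hHm hlim hae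
  obtain ⟨hi2, hI2, ht2⟩ := hC₂.integrable_and_tendsto hN hγ hφ hHm hlim hae
  simp only [← hkd, mul_assoc] at hi1 hI1 ht1 hi2 hI2 ht2
  simp only [mul_assoc]
  refine ⟨integrable_inner hN hG.aestronglyMeasurable_grad hHm hGe hHe, hI1, hI2, ?_⟩
  refine tendsto_nhds_unique ht0 (((ht1.const_mul lam).add ht2).congr fun n => ?_)
  have hg : ∀ θ, MemLp (rayDensity α (φ n) θ) 2 (volume.restrict (Set.Ioi 0)) :=
    memLp_rayDensity hα (hφ n)
  have hray : ∀ (θ : Metric.sphere (0 : EuclideanSpace ℝ (Fin N)) 1) s, 0 < s →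
      dist0 (polar (θ, s)) = s ∧ φ n (polar (θ, s)) = tail k (rayDensity α (φ n) θ) s :=
    fun θ s hs => ⟨dist0_radius_smul hs.le θ, (tail_rayDensity hγ (hφ n) θ hs).symm⟩
  have hj1 := integral_vol hN (hi1 n)
  have hj2 := integral_vol hN (hi2 n)
  rw [hj1, hj2, integral_vol hN (hi0 n), ← integral_const_mul, ← integral_add]
  · refine integral_congr_ae (Eventually.of_forall fun θ => ?_)
    have h := hsol _ (hg θ)
    simp only
    rw [setIntegral_congr_fun measurableSet_Ioi fun s hs =>
      sinh_pow_mul_inner_radialGrad (α := α) (f := f) (φ n) θ hs, h]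
    congr 1
    · congr 1
      refine setIntegral_congr_fun measurableSet_Ioi fun s hs => ?_
      rw [(hray θ s hs).1, (hray θ s hs).2, hypWeight]
      ring
    · refine setIntegral_congr_fun measurableSet_Ioi fun s hs => ?_
      rw [(hray θ s hs).1, (hray θ s hs).2, hypWeight]
      ring
  · exact (integrable_integral_polar hN (hi1 n)).const_mul _
  · exact integrable_integral_polar hN (hi2 n)

end PoincareBall

theorem theorem1p2 (N : ℕ) (hN : 3 ≤ N) (α β lam q : ℝ)
    (hβ : α - 2 < β) (hα : -(N : ℝ) < α - 2)
    (hlam : lam < (((N : ℝ) - 2 + α) / 2) ^ 2)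
    (hq : 2 < q) (hq' : q < 2 * ((N : ℝ) + β) / ((N : ℝ) - 2 + α)) :
    ∃ u : EuclideanSpace ℝ (Fin N) → ℝ,
      PoincareBall.IsWeakSolution α β lam q u ∧
      PoincareBall.IsRadial u ∧
      ContinuousOn u (PoincareBall.ball N \ {0}) ∧
      ∀ x ∈ PoincareBall.ball N \ {0}, 0 < u x := by
  have hn : ((N - 1 : ℕ) : ℝ) = (N : ℝ) - 1 := by
    rw [Nat.cast_sub (by omega), Nat.cast_one]
  have hγ : 0 < ((N - 1 : ℕ) : ℝ) - 1 + α := by rw [hn]; linarith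
  have hγ' : 0 < (N : ℝ) - 2 + α := by linarith
  have e : ((N - 1 : ℕ) : ℝ) - 1 + α = (N : ℝ) - 2 + α := by rw [hn]; ring
  have hqβ : q / 2 * (((N - 1 : ℕ) : ℝ) - 1 + α) < ((N - 1 : ℕ) : ℝ) + 1 + β := by
    rw [lt_div_iff₀ hγ'] at hq'
    rw [e, hn]; linarith
  have hw := HalfLine.isAdapted_hyp (show 1 ≤ N - 1 by omega) hγ hq hqβ
  have hl : lam * (2 / (((N - 1 : ℕ) : ℝ) - 1 + α)) ^ 2 < 1 := by
    rw [e, div_pow, mul_div_assoc', div_lt_one (by positivity)]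
    rw [div_pow, lt_div_iff₀ (by norm_num)] at hlam
    linarith
  obtain ⟨f, hfm, hf, hpos, hsol⟩ := HalfLine.exists_pos_weak_solution hw hq hl
  refine ⟨fun x => HalfLine.tail (HalfLine.hypKernel (N - 1) α) f (PoincareBall.dist0 x),
    PoincareBall.isWeakSolution_radial hN hγ hw hq hfm hf hsol, ?_, ?_, ?_⟩
  · intro x _ y _ hxy
    simp only [PoincareBall.dist0, hxy]
  · refine (HalfLine.continuousOn_tail hw.kernel hf).comp (fun x hx => ?_) fun x hx => PoincareBall.dist0_pos hx.1 hx.2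
    exact (PoincareBall.contDiffAt_dist0 hx.1 hx.2).continuousAt.continuousWithinAt
  · exact fun x hx => hpos _ (PoincareBall.dist0_pos hx.1 hx.2)
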